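/- Let $X$ be a compact smooth manifold with boundary, $\dim X=n+1$, let $\rho$ be a boundary defining function of $X$ (a smooth function $\rho\ge 0$ on $X$ with $\rho^{-1}(0)=\partial X$ and $d\rho\neq 0$ on $\partial X$), and let $h$ be a Riemannian metric on $X$, smooth up to the boundary, with $|d\rho|_h=1$ on $\partial X$. Let $g=\rho^{-2}h$ be the corresponding asymptotically hyperbolic metric on the interior $X^\circ$, let $\Delta_g\ge 0$ be its Laplacian on functions, and let $\operatorname{Spec}(\Delta_g)$ be the point spectrum of $\Delta_g$, i.e. the set of $\mu\in\mathbb C$ for which there is a function $v\in L^2(X,\mathrm{vol}_g)$ on $X^\circ$, $v\not\equiv 0$, with $\Delta_g v=\mu v$. Let $\zeta\in\mathbb C$ with $\operatorname{Re}\zeta\ge n/2$, $\zeta\ne n/2$ and $\zeta(n-\zeta)\notin\operatorname{Spec}(\Delta_g)$. Suppose that the function $u:X^\circ\to\mathbb C$ solves $\Delta_g u=\zeta(n-\zeta)u$ on $X^\circ$ and satisfies $$u=\rho^{\zeta}f+O(\rho^{\zeta+\epsilon})\qquad\text{at }\partial X$$ for some $f\in C^\infty(\partial X)$ and some $\epsilon>0$;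 that is, for some extension $F\in C^\infty(X)$ of $f$ one has $|u-\rho^\zeta F|\le C\rho^{\operatorname{Re}\zeta+\epsilon}$ near $\partial X$. Then $u=0$ on $X^\circ$. -/

import Mathlib

open Set MeasureTheory Filter
open scoped Manifold ContDiff Topology

noncomputable section

namespace AsympHyp

/-- The coordinate space of a manifold of dimension `n + 1`. -/
abbrev Coord (n : ℕ) : Type := EuclideanSpace ℝ (Fin (n + 1))

/-- Smooth Riemannian metrics on the manifold with boundary `X` (smooth up to the boundary). -/
abbrev Metric (n : ℕ) (X : Type*) [TopologicalSpace X]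
    [ChartedSpace (EuclideanHalfSpace (n + 1)) X] [IsManifold (𝓡∂ (n + 1)) ∞ X] :=
  Bundle.ContMDiffRiemannianMetric (𝓡∂ (n + 1)) ∞ (Coord n)
    (fun p : X => TangentSpace (𝓡∂ (n + 1)) p)

section Coordinates

variable {n : ℕ}

/-- The Laplacian `-(1 / √det G) ∑ᵢ ∂ᵢ (√det G ∑ⱼ Gⁱʲ ∂ⱼ v)` of a metric with coefficient
matrix `G`, on an open part of coordinate space (with the sign that makes it nonnegative). -/
def coordLaplacian (G : Coord n → Matrix (Fin (n + 1)) (Fin (n + 1)) ℝ) (v : Coord n → ℂ)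
    (z : Coord n) : ℂ :=
  -((Real.sqrt (G z).det)⁻¹ : ℝ) *
    ∑ i, fderiv ℝ (fun w : Coord n =>
      ∑ j, ((Real.sqrt (G w).det * (G w)⁻¹ i j : ℝ) : ℂ) *
        fderiv ℝ v w (EuclideanSpace.single j 1)) z (EuclideanSpace.single i 1)

end Coordinates

variable {n : ℕ} {X : Type*} [TopologicalSpace X]
  [ChartedSpace (EuclideanHalfSpace (n + 1)) X]

/-- `ρ` is a boundary defining function: smooth up to the boundary, nonnegative, with zero set
`∂X`, and `dρ ≠ 0` on `∂X`. -/
structure IsBoundaryDefining (n : ℕ) {X : Type*} [TopologicalSpace X]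
    [ChartedSpace (EuclideanHalfSpace (n + 1)) X] (ρ : X → ℝ) : Prop where
  smooth : ContMDiff (𝓡∂ (n + 1)) 𝓘(ℝ, ℝ) ∞ ρ
  nonneg : ∀ p, 0 ≤ ρ p
  eq_zero_iff : ∀ p, ρ p = 0 ↔ p ∈ (𝓡∂ (n + 1)).boundary X
  mfderiv_ne_zero : ∀ p ∈ (𝓡∂ (n + 1)).boundary X,
    mfderiv (𝓡∂ (n + 1)) 𝓘(ℝ, ℝ) ρ p ≠ 0

variable [IsManifold (𝓡∂ (n + 1)) ∞ X]

/-- The length `|dρ|_h` at `p`, i.e. the norm of the covector `dρ` dual to the norm of `h`. -/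
def covectorNorm (h : Metric n X) (ρ : X → ℝ) (p : X) : ℝ :=
  sSup {r : ℝ | ∃ v : TangentSpace (𝓡∂ (n + 1)) p, h.inner p v v ≤ 1 ∧
    r = (mfderiv (𝓡∂ (n + 1)) 𝓘(ℝ, ℝ) ρ p v : ℝ)}

/-- The metric `g = ρ⁻² h` on the interior of `X`. -/
def conformalMetric (h : Metric n X) (ρ : X → ℝ) (p : X)
    (v w : TangentSpace (𝓡∂ (n + 1)) p) : ℝ :=
  (ρ p ^ 2)⁻¹ * h.inner p v w

/-- The `i`-th coordinate vector field of the chart around `x`, at the point with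
coordinates `z`. -/
def coordVector (x : X) (z : Coord n) (i : Fin (n + 1)) :
    TangentSpace (𝓡∂ (n + 1)) ((extChartAt (𝓡∂ (n + 1)) x).symm z) :=
  mfderivWithin 𝓘(ℝ, Coord n) (𝓡∂ (n + 1)) (extChartAt (𝓡∂ (n + 1)) x).symm
    (range (𝓡∂ (n + 1))) z (EuclideanSpace.single i (1 : ℝ) : Coord n)

/-- The matrix `g(∂ᵢ, ∂ⱼ)` of `g = ρ⁻² h` in the chart around `x`. -/
def gram (h : Metric n X) (ρ : X → ℝ) (x : X) (z : Coord n) :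
    Matrix (Fin (n + 1)) (Fin (n + 1)) ℝ :=
  Matrix.of fun i j => conformalMetric h ρ ((extChartAt (𝓡∂ (n + 1)) x).symm z)
    (coordVector x z i) (coordVector x z j)

/-- The (nonnegative) Laplacian `Δ_g u` of `g = ρ⁻² h`, at interior points of `X`. It is an
invariant of `g`, so at each point it is computed in the preferred chart there. -/
def laplacian (h : Metric n X) (ρ : X → ℝ) (u : X → ℂ) (p : X) : ℂ :=
  coordLaplacian (gram h ρ p) (u ∘ (extChartAt (𝓡∂ (n + 1)) p).symm)
    (extChartAt (𝓡∂ (n + 1)) p p)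

/-- `u` is a (classical) solution of `Δ_g u = μ u` on the interior of `X`. -/
structure IsEigensolution (h : Metric n X) (ρ : X → ℝ) (μ : ℂ) (u : X → ℂ) : Prop where
  contMDiffOn : ContMDiffOn (𝓡∂ (n + 1)) 𝓘(ℝ, ℂ) 2 u ((𝓡∂ (n + 1)).interior X)
  eq : ∀ p ∈ (𝓡∂ (n + 1)).interior X, laplacian h ρ u p = μ * u p

section Volume

variable [MeasurableSpace X] [BorelSpace X]

/-- The Riemannian measure `√det g dz` of `g = ρ⁻² h` on the interior points in the domain of
the chart around `x`, as a measure on `X`. -/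
def chartVolume (h : Metric n X) (ρ : X → ℝ) (x : X) : Measure X :=
  ((volume.restrict (interior (extChartAt (𝓡∂ (n + 1)) x).target)).withDensity
    (fun z => ENNReal.ofReal (Real.sqrt (gram h ρ x z).det))).map
      (extChartAt (𝓡∂ (n + 1)) x).symm

/-- The Riemannian measure of `g = ρ⁻² h` (extended by zero to `∂X`). The measures of the
charts agree on overlaps, and the measure glued from them is the least one that dominates
each of them. -/
def riemannianVolume (h : Metric n X) (ρ : X → ℝ) : Measure X :=
  ⨆ x : X, chartVolume h ρ x

/-- The point spectrum of `Δ_g` on `L²(X, vol_g)`: the `μ` for which `Δ_g v = μ v` has a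
solution `v ∈ L²(X, vol_g)` that is not identically zero. -/
def pointSpectrum (h : Metric n X) (ρ : X → ℝ) : Set ℂ :=
  {μ | ∃ v : X → ℂ, IsEigensolution h ρ μ v ∧ MemLp v 2 (riemannianVolume h ρ) ∧
    ∃ p ∈ (𝓡∂ (n + 1)).interior X, v p ≠ 0}

end Volume

/-- `F` is an extension of `f : ∂X → ℂ` to a function that is smooth on `X`; the functions `f`
in `C^∞(∂X)` are those that have such an extension. -/
structure IsSmoothExtension (f : (𝓡∂ (n + 1)).boundary X → ℂ) (F : X → ℂ) : Prop where
  smooth : ContMDiff (𝓡∂ (n + 1)) 𝓘(ℝ, ℂ) ∞ F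
  eq : ∀ p : (𝓡∂ (n + 1)).boundary X, F p = f p

/-- `u = ρ^ζ f + O(ρ^{ζ + ε})` at `∂X`, with `f ∈ C^∞(∂X)` extended smoothly to `X`. The bound
is a pointwise one, with no condition on derivatives. -/
def HasBoundaryExpansion (ρ : X → ℝ) (u : X → ℂ) (ζ : ℂ) (ε : ℝ)
    (f : (𝓡∂ (n + 1)).boundary X → ℂ) : Prop :=
  ∃ F : X → ℂ, IsSmoothExtension f F ∧
    (fun p => u p - (ρ p : ℂ) ^ ζ * F p) =O[comap ρ (𝓝[>] 0)]
      (fun p => ρ p ^ (ζ.re + ε))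

end AsympHyp

end

/-! The whole point is that $u\in L^2(X,\mathrm{vol}_g)$: a nonzero $u$ is then an $L^2$
eigenfunction for $\zeta(n-\zeta)$, which is excluded.

A shell $\{\rho\sim\delta\}$ has volume $O(\delta^{-n})$ (`exists_shell_volume_le`), so a function
of size $\rho^\sigma$ has mass $O(\delta^{2\sigma-n})$ there. If $\operatorname{Re}\zeta>n/2$, then
$u=O(\rho^{\operatorname{Re}\zeta})$ and the masses of dyadic shells form a convergent geometric
series (`memLp_two_of_slab_le`).

On the critical line $\zeta=n/2+i\lambda$, $\lambda\ne0$, size alone gives only bounded mass per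
shell. But the eigenvalue $n^2/4+\lambda^2$ is real, so by Green's formula the imaginary part of the
flux $\bar u\langle d\rho,du\rangle$, averaged over a shell, is zero
(`IsEigensolution.flux_eq_zero`). Insert $u=\rho^\zeta(F+r)$ with $r=O(\rho^\epsilon)$. The leading
part of the flux is $\zeta$ times an average of $\rho^{n-1}|F|^2|d\rho|_g^2\ge0$, with imaginary
part $\lambda$ times that average. If all other terms are $O(\delta^\epsilon)$, the average is too;
hence so is the mass of $u$ in the shell (`exists_slab_mass_le`), and the dyadic sum converges
again.

The difficulty is that nothing is known about $dr$. Two devices replace such a bound. Where $\langle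
d\rho,dr\rangle$ meets $\bar F$, it is integrated by parts:
$\rho^{n-1}\nabla_g\rho\,d\mathrm{vol}_g=\nabla_h\rho\,d\mathrm{vol}_h$ is smooth up to $\partial
X$, so its divergence is bounded (`exists_divergence_bound`). Where a gradient meets $\bar r$, it is
kept as $du$, whose energy in a shell is bounded by the mass of $u$ in a larger shell
(`exists_caccioppoli`). `energy_error_eq` is the pointwise identity that separates these terms, and
`norm_energy_error_le` bounds the errors.

Integrals over level sets are replaced throughout by cutoffs in $\rho/\delta$, so no collar
coordinates are needed. The first half of the file supplies the calculus behind this: chart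
independence of the Laplacian, the volume and $\langle da,db\rangle_g$, and the global weak
equation. -/

noncomputable section

namespace AsympHyp

/-! ### Smooth dependence of determinants and inverse matrices -/

section MatrixSmooth

variable {E : Type*} [NormedAddCommGroup E] [NormedSpace ℝ E] {m : ℕ} {k : WithTop ℕ∞} {s : Set E}

theorem contDiffOn_det {M : E → Matrix (Fin m) (Fin m) ℝ}
    (hM : ∀ i j, ContDiffOn ℝ k (fun z => M z i j) s) :
    ContDiffOn ℝ k (fun z => (M z).det) s := by
  simp only [Matrix.det_apply']
  exact ContDiffOn.sum fun σ _ => contDiffOn_const.mul (contDiffOn_prod fun i _ => hM _ _)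

/-- Cramer's rule: an entry of the inverse is a quotient of two determinants. -/
theorem contDiffOn_inv_entry {M : E → Matrix (Fin m) (Fin m) ℝ}
    (hM : ∀ i j, ContDiffOn ℝ k (fun z => M z i j) s) (hdet : ∀ z ∈ s, (M z).det ≠ 0)
    (i j : Fin m) : ContDiffOn ℝ k (fun z => (M z)⁻¹ i j) s := by
  have : (fun z => (M z)⁻¹ i j) =
      fun z => ((M z).det)⁻¹ * ((M z).updateRow j (Pi.single i 1)).det := by
    ext z
    simp [Matrix.inv_def, Matrix.adjugate_apply, Ring.inverse_eq_inv']
  rw [this]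
  refine ((contDiffOn_det hM).inv hdet).mul (contDiffOn_det fun a b => ?_)
  by_cases ha : a = j
  · subst ha
    simpa using contDiffOn_const
  · simpa [Matrix.updateRow_ne ha] using hM a b

theorem contDiffOn_sqrt_det {M : E → Matrix (Fin m) (Fin m) ℝ}
    (hM : ∀ i j, ContDiffOn ℝ k (fun z => M z i j) s) (hdet : ∀ z ∈ s, 0 < (M z).det) :
    ContDiffOn ℝ k (fun z => Real.sqrt (M z).det) s :=
  (contDiffOn_det hM).sqrt fun z hz => (hdet z hz).ne'

end MatrixSmooth

/-! ### Linear algebra of the dual metric on complex covectors -/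

section Cometric

variable {n : ℕ}

/-- The coordinate vector `eᵢ`. -/
abbrev stdVec (i : Fin (n + 1)) : Coord n := EuclideanSpace.single i (1 : ℝ)

/-- The complex bilinear pairing of covectors dual to the metric with matrix `M`. -/
def cometric (M : Matrix (Fin (n + 1)) (Fin (n + 1)) ℝ) (α β : Coord n →L[ℝ] ℂ) : ℂ :=
  ∑ i, ∑ j, ((M⁻¹ i j : ℝ) : ℂ) * α (stdVec i) * β (stdVec j)

variable {M : Matrix (Fin (n + 1)) (Fin (n + 1)) ℝ}

theorem cometric_add_left (α α' β : Coord n →L[ℝ] ℂ) :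
    cometric M (α + α') β = cometric M α β + cometric M α' β := by
  simp only [cometric, ← Finset.sum_add_distrib, add_apply]
  exact Finset.sum_congr rfl fun i _ => Finset.sum_congr rfl fun j _ => by ring

theorem cometric_smul_left (c : ℂ) (α β : Coord n →L[ℝ] ℂ) :
    cometric M (c • α) β = c * cometric M α β := by
  simp only [cometric, Finset.mul_sum, smul_apply, smul_eq_mul]
  exact Finset.sum_congr rfl fun i _ => Finset.sum_congr rfl fun j _ => by ring

theorem cometric_comm (hM : M.IsHermitian) (α β : Coord n →L[ℝ] ℂ) :
    cometric M α β = cometric M β α := by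
  have hs : ∀ i j, M⁻¹ i j = M⁻¹ j i := fun i j => by
    simpa using (hM.inv.apply j i)
  unfold cometric
  rw [Finset.sum_comm]
  refine Finset.sum_congr rfl fun i _ => Finset.sum_congr rfl fun j _ => ?_
  rw [hs j i]; ring

theorem cometric_add_right (α β β' : Coord n →L[ℝ] ℂ) :
    cometric M α (β + β') = cometric M α β + cometric M α β' := by
  simp only [cometric, ← Finset.sum_add_distrib, add_apply]
  exact Finset.sum_congr rfl fun i _ => Finset.sum_congr rfl fun j _ => by ring

theorem cometric_smul_right (c : ℂ) (α β : Coord n →L[ℝ] ℂ) :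
    cometric M α (c • β) = c * cometric M α β := by
  simp only [cometric, Finset.mul_sum, smul_apply, smul_eq_mul]
  exact Finset.sum_congr rfl fun i _ => Finset.sum_congr rfl fun j _ => by ring

theorem cometric_zero_right (α : Coord n →L[ℝ] ℂ) : cometric M α 0 = 0 := by
  simp [cometric]

/-- The conjugate of a complex-valued covector. -/
def conjCovec (α : Coord n →L[ℝ] ℂ) : Coord n →L[ℝ] ℂ :=
  Complex.conjCLE.toContinuousLinearMap.comp α

theorem conjCovec_apply (α : Coord n →L[ℝ] ℂ) (v : Coord n) :
    conjCovec α v = (starRingEnd ℂ) (α v) := rfl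

theorem cometric_conj_conj (α β : Coord n →L[ℝ] ℂ) :
    cometric M (conjCovec α) (conjCovec β) = (starRingEnd ℂ) (cometric M α β) := by
  simp [cometric, conjCovec_apply, map_sum]

/-- With $\alpha=a+ib$, symmetry cancels the cross terms and leaves the sum of the quadratic form at
$a$ and at $b$. -/
theorem cometric_conj_self (hM : M.PosDef) (α : Coord n →L[ℝ] ℂ) :
    ∃ r : ℝ, 0 ≤ r ∧ cometric M α (conjCovec α) = r := by
  have hs : ∀ i j, M⁻¹ i j = M⁻¹ j i := fun i j => by
    simpa using (hM.1.inv.apply j i)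
  have hp := hM.inv.posSemidef
  have hq : ∀ x : Fin (n + 1) → ℝ, 0 ≤ ∑ i, ∑ j, M⁻¹ i j * x i * x j := fun x => by
    have := hp.dotProduct_mulVec_nonneg x
    simp only [dotProduct, Matrix.mulVec, Pi.star_apply, star_trivial, Finset.mul_sum] at this
    refine this.trans_eq ?_
    exact Finset.sum_congr rfl fun i _ => Finset.sum_congr rfl fun j _ => by ring
  refine ⟨(∑ i, ∑ j, M⁻¹ i j * (α (stdVec i)).re * (α (stdVec j)).re) +
    ∑ i, ∑ j, M⁻¹ i j * (α (stdVec i)).im * (α (stdVec j)).im, add_nonneg (hq _) (hq _), ?_⟩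
  have him : ∑ i, ∑ j, M⁻¹ i j * ((α (stdVec i)).im * (α (stdVec j)).re) =
      ∑ i, ∑ j, M⁻¹ i j * ((α (stdVec i)).re * (α (stdVec j)).im) := by
    rw [Finset.sum_comm]
    refine Finset.sum_congr rfl fun i _ => Finset.sum_congr rfl fun j _ => ?_
    rw [hs j i]; ring
  apply Complex.ext
  · simp [cometric, conjCovec_apply, ← Finset.sum_add_distrib]
  · simp only [cometric, conjCovec_apply, Complex.im_sum, Complex.ofReal_im]
    have : ∀ i j, (((M⁻¹ i j : ℝ) : ℂ) * α (stdVec i) * (starRingEnd ℂ) (α (stdVec j))).im =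
      M⁻¹ i j * ((α (stdVec i)).im * (α (stdVec j)).re) -
        M⁻¹ i j * ((α (stdVec i)).re * (α (stdVec j)).im) := fun i j => by
      simp; ring
    simp only [this, Finset.sum_sub_distrib, him, sub_self]

theorem cometric_conj_self_re_nonneg (hM : M.PosDef) (α : Coord n →L[ℝ] ℂ) :
    0 ≤ (cometric M α (conjCovec α)).re := by
  obtain ⟨r, hr, h⟩ := cometric_conj_self hM α
  simpa [h] using hr

theorem cometric_conj_self_im (hM : M.PosDef) (α : Coord n →L[ℝ] ℂ) :
    (cometric M α (conjCovec α)).im = 0 := by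
  obtain ⟨r, hr, h⟩ := cometric_conj_self hM α
  simp [h]

theorem conjCovec_add (α β : Coord n →L[ℝ] ℂ) :
    conjCovec (α + β) = conjCovec α + conjCovec β := by
  ext v; simp [conjCovec_apply]

theorem conjCovec_smul (c : ℂ) (α : Coord n →L[ℝ] ℂ) :
    conjCovec (c • α) = (starRingEnd ℂ) c • conjCovec α := by
  ext v; simp [conjCovec_apply]

/-- The Cauchy–Schwarz inequality, in additive form. -/
theorem two_mul_norm_cometric_le (hM : M.PosDef) (α β : Coord n →L[ℝ] ℂ)
    (hβ : conjCovec β = β) (t : ℝ) :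
    2 * t * ‖cometric M α β‖ ≤
      (cometric M α (conjCovec α)).re + t ^ 2 * (cometric M β β).re := by
  set b := cometric M α β with hb
  -- $c$ is the phase of $b$. Positivity at $\alpha-tc\beta$ then produces $-2t|b|$ as the mixed
  -- term.
  obtain ⟨c, hc, hcb⟩ : ∃ c : ℂ, ‖c‖ = 1 ∧ (starRingEnd ℂ) c * b = ‖b‖ := by
    by_cases h0 : b = 0
    · exact ⟨1, by simp, by simp [h0]⟩
    · refine ⟨b / ‖b‖, by simp [h0], ?_⟩
      have : ((‖b‖ : ℝ) : ℂ) ≠ 0 := by simpa using h0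
      rw [map_div₀, Complex.conj_ofReal, div_mul_eq_mul_div, mul_comm, Complex.mul_conj,
        Complex.normSq_eq_norm_sq]
      field_simp
      push_cast; ring
  have h := cometric_conj_self_re_nonneg hM (α + (-(t : ℂ) * c) • β)
  have hb' : cometric M β (conjCovec α) = (starRingEnd ℂ) b := by
    rw [hb, ← cometric_conj_conj, hβ, cometric_comm hM.1]
  rw [conjCovec_add, conjCovec_smul, hβ, cometric_add_left, cometric_add_right,
    cometric_add_right, cometric_smul_left, cometric_smul_left, cometric_smul_right,
    cometric_smul_right, hb', ← hb] at h
  have e1 : (starRingEnd ℂ) (-(t : ℂ) * c) * b = ((-t * ‖b‖ : ℝ) : ℂ) := by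
    rw [map_mul, mul_assoc, hcb]; simp
  have e2 : (-(t : ℂ) * c) * (starRingEnd ℂ) b = ((-t * ‖b‖ : ℝ) : ℂ) := by
    have := congrArg (starRingEnd ℂ) e1
    simpa only [map_mul, Complex.conj_conj, Complex.conj_ofReal] using this
  have e3 : (-(t : ℂ) * c) * ((starRingEnd ℂ) (-(t : ℂ) * c) * cometric M β β) =
      ((t ^ 2 : ℝ) : ℂ) * cometric M β β := by
    rw [← mul_assoc, Complex.mul_conj, Complex.normSq_eq_norm_sq]
    simp [hc]
  rw [e1, e2, e3] at h
  simp only [Complex.add_re, Complex.ofReal_re, Complex.re_ofReal_mul] at h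
  linarith

theorem fderiv_conj {v : Coord n → ℂ} (z : Coord n) :
    fderiv ℝ (fun w => (starRingEnd ℂ) (v w)) z = conjCovec (fderiv ℝ v z) := by
  have := Complex.conjCLE.comp_fderiv (f := v) (x := z)
  exact this

end Cometric

/-! ### Integration by parts in coordinates -/

section WeakForm

variable {n : ℕ}

theorem fderiv_eq_zero_of_notMem_tsupport {F : Type*} [NormedAddCommGroup F] [NormedSpace ℝ F]
    {φ : Coord n → F} {z : Coord n} (hz : z ∉ tsupport φ) : fderiv ℝ φ z = 0 := by
  by_contra h
  exact hz (support_fderiv_subset ℝ h)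

/-- A function that is continuous on an open set and vanishes off a compact subset of it is
integrable. -/
theorem integrable_of_continuousOn_of_zero {F : Type*} [NormedAddCommGroup F] {f : Coord n → F} {K W : Set (Coord n)}
    (hK : IsCompact K) (hKW : K ⊆ W) (hf : ContinuousOn f W) (h0 : ∀ z, z ∉ K → f z = 0) :
    Integrable f :=
  (integrableOn_iff_integrable_of_support_subset fun z hz => by
    by_contra h; exact hz (h0 z h)).1 ((hf.mono hKW).integrableOn_compact hK)

/-- Integration by parts against a compactly supported function. -/
theorem integral_div_pairing {W : Set (Coord n)} (hW : IsOpen W) {Y : Fin (n + 1) → Coord n → ℂ}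
    (hY : ∀ i, ContDiffOn ℝ 1 (Y i) W) {φ : Coord n → ℂ} (hφ : ContDiff ℝ 1 φ)
    (hc : HasCompactSupport φ) (hs : tsupport φ ⊆ W) :
    ∫ z in W, ∑ i, Y i z * fderiv ℝ φ z (stdVec i) =
      -∫ z in W, (∑ i, fderiv ℝ (Y i) z (stdVec i)) * φ z := by
  have hφ0 : ∀ z, z ∉ tsupport φ → φ z = 0 := fun z hz => image_eq_zero_of_notMem_tsupport hz
  have hdφ0 : ∀ i z, z ∉ tsupport φ → fderiv ℝ φ z (stdVec i) = 0 := fun i z hz => by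
    rw [fderiv_eq_zero_of_notMem_tsupport hz]; rfl
  have hdφ : ∀ i, Continuous fun z => fderiv ℝ φ z (stdVec i) := fun i =>
    (hφ.continuous_fderiv one_ne_zero).clm_apply continuous_const
  have hdY : ∀ i, ContinuousOn (fun z => fderiv ℝ (Y i) z (stdVec i)) W := fun i =>
    ((hY i).continuousOn_fderiv_of_isOpen hW le_rfl).clm_apply continuousOn_const
  have i1 : ∀ i, Integrable fun z => fderiv ℝ (Y i) z (stdVec i) * φ z := fun i =>
    integrable_of_continuousOn_of_zero hc hs ((hdY i).mul hφ.continuous.continuousOn)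
      fun z hz => by rw [hφ0 z hz, mul_zero]
  have i2 : ∀ i, Integrable fun z => Y i z * fderiv ℝ φ z (stdVec i) := fun i =>
    integrable_of_continuousOn_of_zero hc hs ((hY i).continuousOn.mul (hdφ i).continuousOn)
      fun z hz => by rw [hdφ0 i z hz, mul_zero]
  have i3 : ∀ i, Integrable fun z => Y i z * φ z := fun i =>
    integrable_of_continuousOn_of_zero hc hs
      ((hY i).continuousOn.mul hφ.continuous.continuousOn) fun z hz => by rw [hφ0 z hz, mul_zero]
  -- The integration by parts takes place on the whole space; `Y i` need be differentiable only on
  -- the support of `φ`, which lies in `W`.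
  have key : ∀ i, ∫ z, Y i z * fderiv ℝ φ z (stdVec i) =
      -∫ z, fderiv ℝ (Y i) z (stdVec i) * φ z := fun i =>
    integral_mul_fderiv_eq_neg_fderiv_mul_of_integrable (i1 i) (i2 i) (i3 i)
      (fun z hz => ((hY i).differentiableOn one_ne_zero).differentiableAt
        (hW.mem_nhds (hs hz)))
      fun z _ => (hφ.differentiable one_ne_zero) z
  rw [setIntegral_eq_integral_of_forall_compl_eq_zero, setIntegral_eq_integral_of_forall_compl_eq_zero]
  · simp only [Finset.sum_mul]
    rw [integral_finsetSum _ fun i _ => i2 i, integral_finsetSum _ fun i _ => i1 i,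
      ← Finset.sum_neg_distrib]
    exact Finset.sum_congr rfl fun i _ => key i
  · intro z hz
    rw [hφ0 z fun h => hz (hs h), mul_zero]
  · intro z hz
    exact Finset.sum_eq_zero fun i _ => by rw [hdφ0 i z fun h => hz (hs h), mul_zero]

/-- The flux coefficients `√det G ∑ⱼ Gⁱʲ ∂ⱼ v` of the Laplacian are `C¹`. -/
theorem contDiffOn_flux {W : Set (Coord n)} (hW : IsOpen W)
    {G : Coord n → Matrix (Fin (n + 1)) (Fin (n + 1)) ℝ}
    (hG : ∀ i j, ContDiffOn ℝ ∞ (fun z => G z i j) W) (hpos : ∀ z ∈ W, 0 < (G z).det)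
    {v : Coord n → ℂ} (hv : ContDiffOn ℝ 2 v W) (i : Fin (n + 1)) :
    ContDiffOn ℝ 1 (fun w => ∑ j, ((Real.sqrt (G w).det * (G w)⁻¹ i j : ℝ) : ℂ) *
        fderiv ℝ v w (stdVec j)) W := by
  refine ContDiffOn.sum fun j _ => ContDiffOn.mul ?_ ?_
  · refine Complex.ofRealCLM.contDiff.comp_contDiffOn ?_
    exact ((contDiffOn_sqrt_det hG hpos).mul
      (contDiffOn_inv_entry hG (fun z hz => (hpos z hz).ne') i j)).of_le (by norm_cast)
  · exact (hv.fderiv_of_isOpen hW (by norm_num)).clm_apply contDiffOn_const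

/-- The weak form of the coordinate Laplacian. -/
theorem integral_coordLaplacian_mul {W : Set (Coord n)} (hW : IsOpen W)
    {G : Coord n → Matrix (Fin (n + 1)) (Fin (n + 1)) ℝ}
    (hG : ∀ i j, ContDiffOn ℝ ∞ (fun z => G z i j) W) (hpos : ∀ z ∈ W, 0 < (G z).det)
    (hH : ∀ z ∈ W, (G z).IsHermitian)
    {v : Coord n → ℂ} (hv : ContDiffOn ℝ 2 v W) {φ : Coord n → ℂ} (hφ : ContDiff ℝ 1 φ)
    (hc : HasCompactSupport φ) (hs : tsupport φ ⊆ W) :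
    ∫ z in W, (Real.sqrt (G z).det : ℂ) * cometric (G z) (fderiv ℝ v z) (fderiv ℝ φ z) =
      ∫ z in W, (Real.sqrt (G z).det : ℂ) * (coordLaplacian G v z * φ z) := by
  have h := integral_div_pairing hW (contDiffOn_flux hW hG hpos hv) hφ hc hs
  rw [← integral_neg] at h
  refine Eq.trans ?_ (h.trans ?_)
  · refine setIntegral_congr_fun hW.measurableSet fun z hz => ?_
    simp only [cometric]
    rw [← cometric, cometric_comm (hH z hz)]
    simp only [cometric, Finset.mul_sum, Finset.sum_mul]
    refine Finset.sum_congr rfl fun i _ => Finset.sum_congr rfl fun j _ => ?_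
    push_cast; ring
  · refine setIntegral_congr_fun hW.measurableSet fun z hz => ?_
    have : ((Real.sqrt (G z).det : ℝ) : ℂ) ≠ 0 :=
      Complex.ofReal_ne_zero.2 (Real.sqrt_pos.2 (hpos z hz)).ne'
    simp only [coordLaplacian]
    push_cast
    field_simp

theorem continuousOn_coordLaplacian {W : Set (Coord n)} (hW : IsOpen W)
    {G : Coord n → Matrix (Fin (n + 1)) (Fin (n + 1)) ℝ}
    (hG : ∀ i j, ContDiffOn ℝ ∞ (fun z => G z i j) W) (hpos : ∀ z ∈ W, 0 < (G z).det)
    {v : Coord n → ℂ} (hv : ContDiffOn ℝ 2 v W) : ContinuousOn (coordLaplacian G v) W := by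
  unfold coordLaplacian
  refine ContinuousOn.mul ?_ (continuousOn_finsetSum _ fun i _ => ?_)
  · refine ContinuousOn.neg (Complex.continuous_ofReal.comp_continuousOn ?_)
    exact (contDiffOn_sqrt_det hG hpos).continuousOn.inv₀
      fun z hz => (Real.sqrt_pos.2 (hpos z hz)).ne'
  · exact ((contDiffOn_flux hW hG hpos hv i).continuousOn_fderiv_of_isOpen hW le_rfl).clm_apply
      continuousOn_const

end WeakForm

/-! ### Invariance of the Laplacian under change of coordinates -/

section Diffeo

variable {n : ℕ}

/-- The Jacobian matrix of a linear endomorphism of coordinate space. -/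
def jacobian (T : Coord n →L[ℝ] Coord n) : Matrix (Fin (n + 1)) (Fin (n + 1)) ℝ :=
  Matrix.of fun k i => T (stdVec i) k

theorem det_jacobian (T : Coord n →L[ℝ] Coord n) : (jacobian T).det = T.det := by
  have : jacobian T = LinearMap.toMatrix (EuclideanSpace.basisFun (Fin (n + 1)) ℝ).toBasis
      (EuclideanSpace.basisFun (Fin (n + 1)) ℝ).toBasis T.toLinearMap := by
    ext i j
    simp [jacobian, LinearMap.toMatrix_apply]
  rw [this, LinearMap.det_toMatrix]

theorem apply_stdVec_eq_sum {F : Type*} [NormedAddCommGroup F] [NormedSpace ℝ F]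
    (α : Coord n →L[ℝ] F) (T : Coord n →L[ℝ] Coord n) (i : Fin (n + 1)) :
    α (T (stdVec i)) = ∑ k, jacobian T k i • α (stdVec k) := by
  conv_lhs => rw [← (EuclideanSpace.basisFun (Fin (n + 1)) ℝ).sum_repr (T (stdVec i))]
  simp [map_sum, jacobian]

/-- Covectors pull back by $J^T$ and $J(J^TMJ)^{-1}J^T=M^{-1}$, so the dual pairing does not see the
coordinates. -/
theorem cometric_comp (M : Matrix (Fin (n + 1)) (Fin (n + 1)) ℝ) (T : Coord n →L[ℝ] Coord n)
    (hT : T.det ≠ 0) (α β : Coord n →L[ℝ] ℂ) :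
    cometric ((jacobian T).transpose * M * jacobian T) (α.comp T) (β.comp T) =
      cometric M α β := by
  set J := jacobian T with hJ
  have hu : IsUnit J.det := by rw [hJ, det_jacobian]; exact hT.isUnit
  have hc : ∀ (N : Matrix (Fin (n + 1)) (Fin (n + 1)) ℝ) (γ δ : Coord n →L[ℝ] ℂ),
      cometric N γ δ = (fun i => γ (stdVec i)) ⬝ᵥ
        (N⁻¹.map Complex.ofRealHom).mulVec (fun j => δ (stdVec j)) := fun N γ δ => by
    simp only [cometric, dotProduct, Matrix.mulVec, Finset.mul_sum, Matrix.map_apply,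
      Complex.ofRealHom_eq_coe]
    exact Finset.sum_congr rfl fun i _ => Finset.sum_congr rfl fun j _ => by ring
  have hv : ∀ γ : Coord n →L[ℝ] ℂ, (fun i => (γ.comp T) (stdVec i)) =
      (J.transpose.map Complex.ofRealHom).mulVec fun i => γ (stdVec i) := fun γ => by
    ext i
    simp only [ContinuousLinearMap.comp_apply, apply_stdVec_eq_sum, Matrix.mulVec, dotProduct,
      Matrix.map_apply, Matrix.transpose_apply, Complex.ofRealHom_eq_coe, hJ, Complex.real_smul]
  have key : J * (J.transpose * M * J)⁻¹ * J.transpose = M⁻¹ := by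
    rw [Matrix.mul_inv_rev, Matrix.mul_inv_rev, ← Matrix.mul_assoc, Matrix.mul_nonsing_inv _ hu,
      Matrix.one_mul, Matrix.mul_assoc, Matrix.nonsing_inv_mul _ (by simpa using hu),
      Matrix.mul_one]
  rw [hc, hc, hv, hv, ← key, Matrix.map_mul, Matrix.map_mul, ← Matrix.mulVec_mulVec,
    ← Matrix.mulVec_mulVec, Matrix.dotProduct_mulVec _ (J.map _), ← Matrix.mulVec_transpose,
    ← Matrix.transpose_map]

/-- The Jacobian factor here is the one in the change of variables formula; hence $\sqrt{\det
G}\,dz$ is independent of the chart. -/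
theorem sqrt_det_congr (M : Matrix (Fin (n + 1)) (Fin (n + 1)) ℝ) (T : Coord n →L[ℝ] Coord n) :
    Real.sqrt ((jacobian T).transpose * M * jacobian T).det = |T.det| * Real.sqrt M.det := by
  rw [Matrix.det_mul, Matrix.det_mul, Matrix.det_transpose, det_jacobian,
    show T.det * M.det * T.det = T.det ^ 2 * M.det by ring, Real.sqrt_mul (sq_nonneg _),
    Real.sqrt_sq_eq_abs]

/-- A diffeomorphism between open subsets of coordinate space. -/
structure IsDiffeoOn (τ σ : Coord n → Coord n) (W W' : Set (Coord n)) : Prop where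
  isOpen : IsOpen W
  isOpen' : IsOpen W'
  contDiffOn : ContDiffOn ℝ ∞ τ W
  contDiffOn' : ContDiffOn ℝ ∞ σ W'
  mapsTo : MapsTo τ W W'
  mapsTo' : MapsTo σ W' W
  leftInvOn : LeftInvOn σ τ W
  rightInvOn : RightInvOn σ τ W'

namespace IsDiffeoOn

variable {τ σ : Coord n → Coord n} {W W' : Set (Coord n)}

theorem symm (h : IsDiffeoOn τ σ W W') : IsDiffeoOn σ τ W' W :=
  ⟨h.isOpen', h.isOpen, h.contDiffOn', h.contDiffOn, h.mapsTo', h.mapsTo, h.rightInvOn,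
    h.leftInvOn⟩

theorem differentiableAt (h : IsDiffeoOn τ σ W W') {z : Coord n} (hz : z ∈ W) :
    DifferentiableAt ℝ τ z :=
  (h.contDiffOn.differentiableOn (by simp)).differentiableAt (h.isOpen.mem_nhds hz)

theorem fderiv_comp_fderiv (h : IsDiffeoOn τ σ W W') {z : Coord n} (hz : z ∈ W) :
    (fderiv ℝ σ (τ z)).comp (fderiv ℝ τ z) = ContinuousLinearMap.id ℝ _ := by
  rw [← fderiv_comp z (h.symm.differentiableAt (h.mapsTo hz)) (h.differentiableAt hz)]
  have : σ ∘ τ =ᶠ[𝓝 z] id := by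
    filter_upwards [h.isOpen.mem_nhds hz] with w hw using h.leftInvOn hw
  rw [this.fderiv_eq, fderiv_id]

theorem det_fderiv_ne_zero (h : IsDiffeoOn τ σ W W') {z : Coord n} (hz : z ∈ W) :
    (fderiv ℝ τ z).det ≠ 0 := by
  have h1 : ((fderiv ℝ σ (τ z)).toLinearMap * (fderiv ℝ τ z).toLinearMap) = 1 := by
    ext v
    have := congrArg (fun T => T v) (h.fderiv_comp_fderiv hz)
    simp only [ContinuousLinearMap.comp_apply, ContinuousLinearMap.id_apply] at this
    simp [this]
  have h2 := congrArg LinearMap.det h1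
  rw [map_mul, map_one] at h2
  exact right_ne_zero_of_mul_eq_one h2

theorem image_eq (h : IsDiffeoOn τ σ W W') : τ '' W = W' :=
  (h.mapsTo.image_subset).antisymm fun w hw => ⟨σ w, h.mapsTo' hw, h.rightInvOn hw⟩

theorem image_inter_preimage (h : IsDiffeoOn τ σ W W') (A : Set (Coord n)) :
    τ '' (W ∩ τ ⁻¹' A) = W' ∩ A := by
  rw [Set.image_inter_preimage, h.image_eq]

theorem hasFDerivWithinAt (h : IsDiffeoOn τ σ W W') {z : Coord n} (hz : z ∈ W)
    (s : Set (Coord n)) : HasFDerivWithinAt τ (fderiv ℝ τ z) s z :=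
  (h.differentiableAt hz).hasFDerivAt.hasFDerivWithinAt

theorem setIntegral_comp (h : IsDiffeoOn τ σ W W') (g : Coord n → ℂ) :
    ∫ w in W', g w = ∫ z in W, ((|(fderiv ℝ τ z).det| : ℝ) : ℂ) * g (τ z) := by
  rw [← h.image_eq, integral_image_eq_integral_abs_det_fderiv_smul volume h.isOpen.measurableSet
    (fun z hz => h.hasFDerivWithinAt hz W) h.leftInvOn.injOn]
  simp only [Complex.real_smul]

theorem fderiv_comp_apply (h : IsDiffeoOn τ σ W W') {v : Coord n → ℂ} {z : Coord n} (hz : z ∈ W)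
    (hv : DifferentiableAt ℝ v (τ z)) :
    fderiv ℝ (v ∘ τ) z = (fderiv ℝ v (τ z)).comp (fderiv ℝ τ z) :=
  fderiv_comp z hv (h.differentiableAt hz)

end IsDiffeoOn

variable {τ σ : Coord n → Coord n} {W W' : Set (Coord n)}

/-- The function `φ` on `W`, transported to `W'` and extended by zero. -/
theorem transport_compactSupport (h : IsDiffeoOn τ σ W W') {φ : Coord n → ℂ}
    (hφ : ContDiff ℝ 1 φ) (hc : HasCompactSupport φ) (hs : tsupport φ ⊆ W) :
    ContDiff ℝ 1 (W'.indicator (φ ∘ σ)) ∧ HasCompactSupport (W'.indicator (φ ∘ σ)) ∧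
      tsupport (W'.indicator (φ ∘ σ)) ⊆ W' := by
  have hK : IsCompact (τ '' tsupport φ) :=
    hc.isCompact.image_of_continuousOn (h.contDiffOn.continuousOn.mono hs)
  have hKW : τ '' tsupport φ ⊆ W' := (image_mono hs).trans h.image_eq.subset
  have hsup : Function.support (W'.indicator (φ ∘ σ)) ⊆ τ '' tsupport φ := by
    intro w hw
    rw [Function.mem_support, indicator_apply_ne_zero] at hw
    exact ⟨σ w, subset_tsupport _ hw.2, h.rightInvOn hw.1⟩
  have ht : tsupport (W'.indicator (φ ∘ σ)) ⊆ τ '' tsupport φ :=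
    closure_minimal hsup hK.isClosed
  refine ⟨?_, HasCompactSupport.of_support_subset_isCompact hK hsup, ht.trans hKW⟩
  refine contDiff_iff_contDiffAt.2 fun w => ?_
  by_cases hw : w ∈ W'
  · have : W'.indicator (φ ∘ σ) =ᶠ[𝓝 w] φ ∘ σ := by
      filter_upwards [h.isOpen'.mem_nhds hw] with y hy using indicator_of_mem hy _
    refine ContDiffAt.congr_of_eventuallyEq ?_ this
    exact hφ.contDiffAt.comp w
      (((h.contDiffOn').of_le (by norm_cast)).contDiffAt (h.isOpen'.mem_nhds hw))
  · have hw' : w ∈ (tsupport (W'.indicator (φ ∘ σ)))ᶜ := fun h' => hw (hKW (ht h'))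
    refine ContDiffAt.congr_of_eventuallyEq (f := fun _ => 0) contDiffAt_const ?_
    filter_upwards [(isClosed_tsupport _).isOpen_compl.mem_nhds hw'] with y hy
    exact image_eq_zero_of_notMem_tsupport hy

/-- The coordinate Laplacian is invariant under diffeomorphisms. -/
theorem coordLaplacian_comp (h : IsDiffeoOn τ σ W W')
    {G G' : Coord n → Matrix (Fin (n + 1)) (Fin (n + 1)) ℝ}
    (hG : ∀ i j, ContDiffOn ℝ ∞ (fun z => G z i j) W)
    (hG' : ∀ i j, ContDiffOn ℝ ∞ (fun z => G' z i j) W')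
    (hpos : ∀ z ∈ W, (G z).PosDef) (hpos' : ∀ z ∈ W', (G' z).PosDef)
    (hGG : ∀ z ∈ W, G z =
      (jacobian (fderiv ℝ τ z)).transpose * G' (τ z) * jacobian (fderiv ℝ τ z))
    {v : Coord n → ℂ} (hv : ContDiffOn ℝ 2 v W') {z : Coord n} (hz : z ∈ W) :
    coordLaplacian G (v ∘ τ) z = coordLaplacian G' v (τ z) := by
  have hvτ : ContDiffOn ℝ 2 (v ∘ τ) W :=
    hv.comp (h.contDiffOn.of_le (by norm_cast)) h.mapsTo
  have hd : ∀ z ∈ W, 0 < (G z).det := fun z hz => (hpos z hz).det_pos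
  have hd' : ∀ z ∈ W', 0 < (G' z).det := fun z hz => (hpos' z hz).det_pos
  -- Second derivatives of `τ` are never computed. The two Laplacians have the same weak form, so
  -- the continuous function `f` integrates to zero against every test function and vanishes.
  set f : Coord n → ℂ := fun z => (Real.sqrt (G z).det : ℂ) *
    (coordLaplacian G (v ∘ τ) z - coordLaplacian G' v (τ z)) with hf
  have hs : ContinuousOn (fun z => (Real.sqrt (G z).det : ℂ)) W :=
    Complex.continuous_ofReal.comp_continuousOn (contDiffOn_sqrt_det hG hd).continuousOn
  have c1 := continuousOn_coordLaplacian h.isOpen hG hd hvτ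
  have c2 : ContinuousOn (fun z => coordLaplacian G' v (τ z)) W :=
    (continuousOn_coordLaplacian h.isOpen' hG' hd' hv).comp h.contDiffOn.continuousOn h.mapsTo
  have hfc : ContinuousOn f W := hs.mul (c1.sub c2)
  have hzero : ∀ᵐ z, z ∈ W → f z = 0 := by
    refine h.isOpen.ae_eq_zero_of_integral_contDiff_smul_eq_zero
      (hfc.locallyIntegrableOn h.isOpen.measurableSet) fun g hg hgc hgs => ?_
    set φ : Coord n → ℂ := fun z => (g z : ℂ) with hφdef
    have hφ : ContDiff ℝ 1 φ :=
      Complex.ofRealCLM.contDiff.comp (hg.of_le (by norm_cast))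
    have hsupp : tsupport φ = tsupport g := by
      unfold tsupport; congr 1; ext z; simp [hφdef]
    have hφc : HasCompactSupport φ := by rw [HasCompactSupport, hsupp]; exact hgc
    have hφs : tsupport φ ⊆ W := hsupp ▸ hgs
    obtain ⟨t1, t2, t3⟩ := transport_compactSupport h hφ hφc hφs
    set φ' := W'.indicator (φ ∘ σ) with hφ'
    have e1 := integral_coordLaplacian_mul h.isOpen hG hd (fun z hz => (hpos z hz).1) hvτ hφ
      hφc hφs
    have e2 := integral_coordLaplacian_mul h.isOpen' hG' hd' (fun z hz => (hpos' z hz).1) hv t1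
      t2 t3
    -- Both sides of the weak identity on `W'` are pulled back to `W`, to be compared with `e1`.
    rw [h.setIntegral_comp, h.setIntegral_comp] at e2
    have hφτ : ∀ z ∈ W, φ' (τ z) = φ z := fun z hz => by
      rw [hφ', indicator_of_mem (h.mapsTo hz), Function.comp_apply, h.leftInvOn hz]
    have hdet : ∀ z ∈ W, ((Real.sqrt (G z).det : ℝ) : ℂ) =
        ((|(fderiv ℝ τ z).det| : ℝ) : ℂ) * (Real.sqrt (G' (τ z)).det : ℂ) := fun z hz => by
      rw [hGG z hz, sqrt_det_congr]; push_cast; rfl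
    have e3 : ∫ z in W, (Real.sqrt (G z).det : ℂ) * (coordLaplacian G (v ∘ τ) z * φ z) =
        ∫ z in W, (Real.sqrt (G z).det : ℂ) * (coordLaplacian G' v (τ z) * φ z) := by
      rw [← e1]
      refine Eq.trans (Eq.trans ?_ e2) ?_
      · refine setIntegral_congr_fun h.isOpen.measurableSet fun z hz => ?_
        have hd1 : fderiv ℝ φ z = (fderiv ℝ φ' (τ z)).comp (fderiv ℝ τ z) := by
          rw [← h.fderiv_comp_apply hz (t1.differentiable one_ne_zero _)]
          refine Filter.EventuallyEq.fderiv_eq ?_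
          filter_upwards [h.isOpen.mem_nhds hz] with y hy using (hφτ y hy).symm
        have hd2 := h.fderiv_comp_apply hz ((hv.differentiableOn two_ne_zero).differentiableAt
          (h.isOpen'.mem_nhds (h.mapsTo hz)))
        rw [hdet z hz, hd1, hd2, hGG z hz, cometric_comp _ _ (h.det_fderiv_ne_zero hz), mul_assoc]
      · refine setIntegral_congr_fun h.isOpen.measurableSet fun z hz => ?_
        rw [hdet z hz, hφτ z hz, mul_assoc]
    have hφ0 : ∀ z, z ∉ tsupport φ → φ z = 0 := fun z hz => image_eq_zero_of_notMem_tsupport hz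
    have hint : ∀ {q : Coord n → ℂ}, ContinuousOn q W →
        IntegrableOn (fun z => (Real.sqrt (G z).det : ℂ) * (q z * φ z)) W := fun hq =>
      (integrable_of_continuousOn_of_zero hφc hφs
        (hs.mul (hq.mul hφ.continuous.continuousOn))
        fun z hz => by simp [hφ0 z hz]).integrableOn
    rw [← sub_eq_zero, ← integral_sub (hint c1) (hint c2)] at e3
    rw [← setIntegral_eq_integral_of_forall_compl_eq_zero (s := W), ← e3]
    · refine setIntegral_congr_fun h.isOpen.measurableSet fun z _ => ?_
      simp only [hf, hφdef, Complex.real_smul]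
      ring
    · intro z hz
      have : g z = 0 := image_eq_zero_of_notMem_tsupport fun h' => hz (hgs h')
      rw [this, zero_smul]
  have := Measure.eqOn_open_of_ae_eq (μ := volume) (f := f) (g := fun _ => 0)
    ((ae_restrict_iff' h.isOpen.measurableSet).2 hzero) h.isOpen hfc continuousOn_const hz
  have hne : ((Real.sqrt (G z).det : ℝ) : ℂ) ≠ 0 :=
    Complex.ofReal_ne_zero.2 (Real.sqrt_pos.2 (hd z hz)).ne'
  simpa [hf, hne, sub_eq_zero] using this

end Diffeo

/-! ### Charts, interior points and coordinate changes -/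

section Charts

variable {n : ℕ} {X : Type*} [TopologicalSpace X] [ChartedSpace (EuclideanHalfSpace (n + 1)) X]

/-- The interior of the target of the chart around `x`. -/
def chartInterior (n : ℕ) {X : Type*} [TopologicalSpace X]
    [ChartedSpace (EuclideanHalfSpace (n + 1)) X] (x : X) : Set (Coord n) :=
  interior (extChartAt (𝓡∂ (n + 1)) x).target

theorem isOpen_chartInterior (x : X) : IsOpen (chartInterior n x) := isOpen_interior

theorem chartInterior_subset_target (x : X) :
    chartInterior n x ⊆ (extChartAt (𝓡∂ (n + 1)) x).target := interior_subset

theorem chartInterior_symm_mem_source {x : X} {z : Coord n} (hz : z ∈ chartInterior n x) :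
    (extChartAt (𝓡∂ (n + 1)) x).symm z ∈ (extChartAt (𝓡∂ (n + 1)) x).source :=
  (extChartAt (𝓡∂ (n + 1)) x).map_target (chartInterior_subset_target x hz)

theorem extChartAt_right_inv {x : X} {z : Coord n} (hz : z ∈ chartInterior n x) :
    extChartAt (𝓡∂ (n + 1)) x ((extChartAt (𝓡∂ (n + 1)) x).symm z) = z :=
  (extChartAt (𝓡∂ (n + 1)) x).right_inv (chartInterior_subset_target x hz)

theorem chartInterior_subset_interior_range (x : X) :
    chartInterior n x ⊆ interior (range (𝓡∂ (n + 1))) :=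
  interior_mono (extChartAt_target_subset_range x)

theorem range_mem_nhds {x : X} {z : Coord n} (hz : z ∈ chartInterior n x) :
    range (𝓡∂ (n + 1)) ∈ 𝓝 z :=
  mem_interior_iff_mem_nhds.1 (chartInterior_subset_interior_range x hz)

/-- The coordinate change from the chart around `x` to the chart around `y`. -/
def transition (n : ℕ) {X : Type*} [TopologicalSpace X]
    [ChartedSpace (EuclideanHalfSpace (n + 1)) X] (x y : X) : Coord n → Coord n :=
  extChartAt (𝓡∂ (n + 1)) y ∘ (extChartAt (𝓡∂ (n + 1)) x).symm

/-- The interior points of the chart around `x` that lie in the domain of the chart around `y`. -/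
def overlap (n : ℕ) {X : Type*} [TopologicalSpace X]
    [ChartedSpace (EuclideanHalfSpace (n + 1)) X] (x y : X) : Set (Coord n) :=
  chartInterior n x ∩
    (extChartAt (𝓡∂ (n + 1)) x).symm ⁻¹' (extChartAt (𝓡∂ (n + 1)) y).source

theorem symm_transition {x y : X} {z : Coord n} (hz : z ∈ overlap n x y) :
    (extChartAt (𝓡∂ (n + 1)) y).symm (transition n x y z) =
      (extChartAt (𝓡∂ (n + 1)) x).symm z :=
  (extChartAt (𝓡∂ (n + 1)) y).left_inv hz.2

theorem transition_leftInvOn (x y : X) :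
    LeftInvOn (transition n y x) (transition n x y) (overlap n x y) := by
  intro z hz
  simp only [transition, Function.comp_apply]
  rw [(extChartAt (𝓡∂ (n + 1)) y).left_inv hz.2, extChartAt_right_inv hz.1]

theorem IsBoundaryDefining.pos_iff {ρ : X → ℝ} (hρ : IsBoundaryDefining n ρ) {p : X} :
    0 < ρ p ↔ p ∈ (𝓡∂ (n + 1)).interior X := by
  rw [(hρ.nonneg p).lt_iff_ne, ne_comm, Ne, hρ.eq_zero_iff, ← ModelWithCorners.compl_interior,
    mem_compl_iff, not_not]

variable [IsManifold (𝓡∂ (n + 1)) ∞ X]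

/-- Interior points are defined through the preferred chart at the point; for a smooth manifold any
chart of the atlas decides the same. -/
theorem extChartAt_mem_chartInterior_iff {x p : X}
    (hp : p ∈ (extChartAt (𝓡∂ (n + 1)) x).source) :
    extChartAt (𝓡∂ (n + 1)) x p ∈ chartInterior n x ↔ p ∈ (𝓡∂ (n + 1)).interior X := by
  rw [extChartAt_source] at hp
  exact (ModelWithCorners.isInteriorPoint_iff_of_mem_atlas (n := ∞) (by simp)
    (chart_mem_atlas _ x) hp).symm

theorem symm_mem_interior {x : X} {z : Coord n} (hz : z ∈ chartInterior n x) :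
    (extChartAt (𝓡∂ (n + 1)) x).symm z ∈ (𝓡∂ (n + 1)).interior X := by
  rw [← extChartAt_mem_chartInterior_iff (chartInterior_symm_mem_source hz),
    extChartAt_right_inv hz]
  exact hz

theorem isOpen_interior_manifold : IsOpen ((𝓡∂ (n + 1)).interior X) :=
  ModelWithCorners.isOpen_interior (n := ∞) (by simp)

theorem contMDiffOn_symm_chartInterior (x : X) (k : WithTop ℕ∞) (hk : k ≤ ∞) :
    ContMDiffOn 𝓘(ℝ, Coord n) (𝓡∂ (n + 1)) k (extChartAt (𝓡∂ (n + 1)) x).symm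
      (chartInterior n x) :=
  ((contMDiffOn_extChartAt_symm (n := ∞) x).mono (chartInterior_subset_target x)).of_le hk

/-- A function that is `Cᵏ` on the interior of `X` is `Cᵏ` in the charts. -/
theorem contDiffOn_comp_symm {F : Type*} [NormedAddCommGroup F] [NormedSpace ℝ F]
    {k : WithTop ℕ∞} (hk : k ≤ ∞) {a : X → F}
    (ha : ContMDiffOn (𝓡∂ (n + 1)) 𝓘(ℝ, F) k a ((𝓡∂ (n + 1)).interior X)) (x : X) :
    ContDiffOn ℝ k (a ∘ (extChartAt (𝓡∂ (n + 1)) x).symm) (chartInterior n x) :=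
  (ha.comp (contMDiffOn_symm_chartInterior x k hk) fun _ hz => symm_mem_interior hz).contDiffOn

theorem isOpen_overlap (x y : X) : IsOpen (overlap n x y) :=
  (contMDiffOn_symm_chartInterior x 0 (by simp)).continuousOn.isOpen_inter_preimage
    (isOpen_chartInterior x) (isOpen_extChartAt_source y)

theorem transition_mapsTo (x y : X) :
    MapsTo (transition n x y) (overlap n x y) (overlap n y x) := by
  intro z hz
  refine ⟨(extChartAt_mem_chartInterior_iff hz.2).2 (symm_mem_interior hz.1), ?_⟩
  rw [mem_preimage]
  rw [symm_transition hz]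
  exact chartInterior_symm_mem_source hz.1

theorem contDiffOn_transition (x y : X) : ContDiffOn ℝ ∞ (transition n x y) (overlap n x y) := by
  refine ContMDiffOn.contDiffOn ((contMDiffOn_extChartAt (n := ∞) (x := y)).comp
    ((contMDiffOn_symm_chartInterior x ∞ le_rfl).mono inter_subset_left) fun z hz => ?_)
  have := hz.2
  rwa [extChartAt_source] at this

theorem isDiffeoOn_transition (x y : X) :
    IsDiffeoOn (transition n x y) (transition n y x) (overlap n x y) (overlap n y x) where
  isOpen := isOpen_overlap x y
  isOpen' := isOpen_overlap y x
  contDiffOn := contDiffOn_transition x y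
  contDiffOn' := contDiffOn_transition y x
  mapsTo := transition_mapsTo x y
  mapsTo' := transition_mapsTo y x
  leftInvOn := transition_leftInvOn x y
  rightInvOn := transition_leftInvOn y x

end Charts

/-! ### The metric in coordinates -/

section Gram

variable {n : ℕ} {X : Type*} [TopologicalSpace X] [ChartedSpace (EuclideanHalfSpace (n + 1)) X]
  [IsManifold (𝓡∂ (n + 1)) ∞ X]

/-- The matrix `h(∂ᵢ, ∂ⱼ)` in the chart around `x`. -/
def coordMetric (h : Metric n X) (x : X) (z : Coord n) :
    Matrix (Fin (n + 1)) (Fin (n + 1)) ℝ :=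
  Matrix.of fun i j => h.inner ((extChartAt (𝓡∂ (n + 1)) x).symm z)
    (coordVector x z i) (coordVector x z j)

theorem gram_eq (h : Metric n X) (ρ : X → ℝ) (x : X) (z : Coord n) :
    gram h ρ x z = (ρ ((extChartAt (𝓡∂ (n + 1)) x).symm z) ^ 2)⁻¹ • coordMetric h x z := by
  ext i j
  simp [gram, coordMetric, conformalMetric]

/-- Identifies coordinate vector fields with the local frame of a trivialization of the tangent
bundle, which is known to be smooth. -/
theorem coordVector_eq_localFrame {x p : X} (hp : p ∈ (extChartAt (𝓡∂ (n + 1)) x).source)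
    (i : Fin (n + 1)) :
    have : IsManifold (𝓡∂ (n + 1)) 1 X := IsManifold.of_le (n := ∞) (by norm_cast)
    (Bundle.Trivialization.localFrame (trivializationAt (Coord n) (TangentSpace (𝓡∂ (n + 1))) x)
      (EuclideanSpace.basisFun (Fin (n + 1)) ℝ).toBasis i p : Coord n) =
    mfderivWithin 𝓘(ℝ, Coord n) (𝓡∂ (n + 1)) (extChartAt (𝓡∂ (n + 1)) x).symm
      (range (𝓡∂ (n + 1))) (extChartAt (𝓡∂ (n + 1)) x p) (stdVec i) := by
  have : IsManifold (𝓡∂ (n + 1)) 1 X := IsManifold.of_le (n := ∞) (by norm_cast)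
  rw [extChartAt_source] at hp
  refine Eq.trans ?_ (congrArg (fun T => T (stdVec i))
    (TangentBundle.symmL_trivializationAt (I := 𝓡∂ (n + 1)) hp))
  have hb : p ∈ (trivializationAt (Coord n) (TangentSpace (𝓡∂ (n + 1))) x).baseSet := hp
  rw [Bundle.Trivialization.localFrame_apply_of_mem_baseSet _ _ hb]
  simp only [Bundle.Trivialization.basisAt, Module.Basis.map_apply]
  refine Eq.trans ?_ (Bundle.Trivialization.symmL_apply _ hb _).symm
  simp

/-- `h` is evaluated on two smooth frame fields. That the domain is the whole target, boundary
points included, is the source of all later bounds that are uniform up to $\partial X$. -/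
theorem contDiffOn_coordMetric (h : Metric n X) (x : X) (i j : Fin (n + 1)) :
    ContDiffOn ℝ ∞ (fun z => coordMetric h x z i j) (extChartAt (𝓡∂ (n + 1)) x).target := by
  have : IsManifold (𝓡∂ (n + 1)) 1 X := IsManifold.of_le (n := ∞) (by norm_cast)
  set e := trivializationAt (Coord n) (TangentSpace (𝓡∂ (n + 1)) (M := X)) x
  set b := (EuclideanSpace.basisFun (Fin (n + 1)) ℝ).toBasis
  have hfr : ∀ i, ContMDiffOn (𝓡∂ (n + 1)) ((𝓡∂ (n + 1)).prod 𝓘(ℝ, Coord n)) ∞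
      (fun p : X => (⟨p, e.localFrame b i p⟩ : TangentBundle (𝓡∂ (n + 1)) X)) e.baseSet :=
    fun i => e.contMDiffOn_localFrame_baseSet ∞ b i
  have key : ContMDiffOn (𝓡∂ (n + 1)) 𝓘(ℝ, ℝ) ∞
      (fun p : X => h.inner p (e.localFrame b i p) (e.localFrame b j p)) e.baseSet := by
    intro p hp
    have := ContMDiffWithinAt.clm_bundle_apply₂ (F₁ := Coord n) (F₂ := Coord n) (F₃ := ℝ)
      (E₃ := Bundle.Trivial X ℝ) (b := fun p : X => p)
      (h.contMDiff.contMDiffAt.contMDiffWithinAt) (hfr i p hp) (hfr j p hp)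
    rw [Bundle.contMDiffWithinAt_totalSpace] at this
    exact this.2
  have hmaps : MapsTo (extChartAt (𝓡∂ (n + 1)) x).symm (extChartAt (𝓡∂ (n + 1)) x).target
      e.baseSet := by
    intro z hz
    have := (extChartAt (𝓡∂ (n + 1)) x).map_target hz
    rwa [extChartAt_source] at this
  refine ((key.comp (contMDiffOn_extChartAt_symm (n := ∞) x) hmaps).contDiffOn).congr
    fun z hz => ?_
  have hs := (extChartAt (𝓡∂ (n + 1)) x).map_target hz
  have e1 := coordVector_eq_localFrame hs i
  have e2 := coordVector_eq_localFrame hs j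
  rw [(extChartAt (𝓡∂ (n + 1)) x).right_inv hz] at e1 e2
  simp only [coordMetric, Matrix.of_apply, Function.comp_apply, coordVector]
  exact congrArg₂ (fun v w : Coord n => (h.inner ((extChartAt (𝓡∂ (n + 1)) x).symm z) v w : ℝ))
    e1.symm e2.symm

/-- The inner product `h` at `p`, on the model vector space. -/
def metricForm (h : Metric n X) (p : X) : Coord n →L[ℝ] Coord n →L[ℝ] ℝ := h.inner p

/-- The derivative of the inverse of the chart around `x`, as a map of the model vector space. -/
def chartFrame (n : ℕ) {X : Type*} [TopologicalSpace X]
    [ChartedSpace (EuclideanHalfSpace (n + 1)) X] [IsManifold (𝓡∂ (n + 1)) ∞ X] (x : X)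
    (z : Coord n) : Coord n →L[ℝ] Coord n :=
  mfderivWithin 𝓘(ℝ, Coord n) (𝓡∂ (n + 1)) (extChartAt (𝓡∂ (n + 1)) x).symm
    (range (𝓡∂ (n + 1))) z

theorem coordMetric_apply (h : Metric n X) (x : X) (z : Coord n) (i j : Fin (n + 1)) :
    coordMetric h x z i j = metricForm h ((extChartAt (𝓡∂ (n + 1)) x).symm z)
      (chartFrame n x z (stdVec i)) (chartFrame n x z (stdVec j)) := rfl

theorem chartFrame_injective (x : X) {z : Coord n}
    (hz : z ∈ (extChartAt (𝓡∂ (n + 1)) x).target) : Function.Injective (chartFrame n x z) := by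
  have : IsManifold (𝓡∂ (n + 1)) 1 X := IsManifold.of_le (n := ∞) (by norm_cast)
  have := isInvertible_mfderivWithin_extChartAt_symm (I := 𝓡∂ (n + 1)) hz
  exact this.injective

theorem posDef_coordMetric (h : Metric n X) (x : X) {z : Coord n}
    (hz : z ∈ (extChartAt (𝓡∂ (n + 1)) x).target) : (coordMetric h x z).PosDef := by
  refine Matrix.PosDef.of_dotProduct_mulVec_pos ?_ fun v hv => ?_
  · ext i j
    rw [Matrix.conjTranspose_apply, star_trivial]
    exact h.symm _ _ _
  · set p := (extChartAt (𝓡∂ (n + 1)) x).symm z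
    set w : Coord n := WithLp.toLp 2 v
    have hw : chartFrame n x z w = ∑ i, v i • chartFrame n x z (stdVec i) := by
      conv_lhs => rw [← (EuclideanSpace.basisFun (Fin (n + 1)) ℝ).sum_repr w]
      simp [map_sum, w]
    have hne : chartFrame n x z w ≠ 0 := fun h0 => hv <| by
      have : w = 0 := chartFrame_injective x hz (by rw [h0, map_zero])
      simpa [w] using this
    have hp : 0 < metricForm h p (chartFrame n x z w) (chartFrame n x z w) := h.pos p _ hne
    rw [hw] at hp
    simp only [map_sum, map_smul, sum_apply, smul_apply, smul_eq_mul] at hp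
    simp only [dotProduct, Matrix.mulVec, Pi.star_apply, star_trivial, Finset.mul_sum,
      coordMetric_apply]
    refine hp.trans_eq ?_
    rw [Finset.sum_comm]
    simp only [Finset.mul_sum]
    exact Finset.sum_congr rfl fun i _ => Finset.sum_congr rfl fun j _ => by ring

/-- The chain rule; at interior points the derivatives within the half space are ordinary ones. -/
theorem chartFrame_transition {x y : X} {z : Coord n} (hz : z ∈ overlap n x y) :
    chartFrame n x z =
      (chartFrame n y (transition n x y z)).comp (fderiv ℝ (transition n x y) z) := by
  have hW := (isOpen_overlap (n := n) x y).mem_nhds hz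
  have hz' := transition_mapsTo x y hz
  have e1 : chartFrame n x z = mfderiv 𝓘(ℝ, Coord n) (𝓡∂ (n + 1))
      (extChartAt (𝓡∂ (n + 1)) x).symm z := mfderivWithin_of_mem_nhds (range_mem_nhds hz.1)
  have e2 : chartFrame n y (transition n x y z) = mfderiv 𝓘(ℝ, Coord n) (𝓡∂ (n + 1))
      (extChartAt (𝓡∂ (n + 1)) y).symm (transition n x y z) :=
    mfderivWithin_of_mem_nhds (range_mem_nhds hz'.1)
  have hev : (extChartAt (𝓡∂ (n + 1)) x).symm =ᶠ[𝓝 z]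
      (extChartAt (𝓡∂ (n + 1)) y).symm ∘ transition n x y := by
    filter_upwards [hW] with w hw using (symm_transition hw).symm
  have d1 : MDifferentiableAt 𝓘(ℝ, Coord n) (𝓡∂ (n + 1)) (extChartAt (𝓡∂ (n + 1)) y).symm
      (transition n x y z) :=
    ((contMDiffOn_symm_chartInterior y ∞ le_rfl).contMDiffAt
      ((isOpen_chartInterior y).mem_nhds hz'.1)).mdifferentiableAt (by simp)
  have d2 : MDifferentiableAt 𝓘(ℝ, Coord n) 𝓘(ℝ, Coord n) (transition n x y) z :=
    ((isDiffeoOn_transition x y).differentiableAt hz).mdifferentiableAt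
  have e3 := mfderiv_comp z d1 d2
  rw [← hev.mfderiv_eq, mfderiv_eq_fderiv] at e3
  rw [e1, e2]
  exact e3

theorem coordMetric_transition (h : Metric n X) {x y : X} {z : Coord n}
    (hz : z ∈ overlap n x y) :
    coordMetric h x z = (jacobian (fderiv ℝ (transition n x y) z)).transpose *
      coordMetric h y (transition n x y z) * jacobian (fderiv ℝ (transition n x y) z) := by
  ext i j
  simp only [coordMetric_apply, symm_transition hz, chartFrame_transition hz, Matrix.mul_apply,
    Matrix.transpose_apply]
  have hk : ∀ i, ((chartFrame n y (transition n x y z)).comp (fderiv ℝ (transition n x y) z))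
      (stdVec i) = ∑ k, jacobian (fderiv ℝ (transition n x y) z) k i •
        chartFrame n y (transition n x y z) (stdVec k) := fun i => by
    rw [ContinuousLinearMap.comp_apply, apply_stdVec_eq_sum]
  simp only [hk, map_sum, map_smul, sum_apply, smul_apply, smul_eq_mul,
    Finset.mul_sum, Finset.sum_mul]
  exact Finset.sum_congr rfl fun k _ => Finset.sum_congr rfl fun l _ => by ring

theorem gram_transition (h : Metric n X) (ρ : X → ℝ) {x y : X} {z : Coord n}
    (hz : z ∈ overlap n x y) :
    gram h ρ x z = (jacobian (fderiv ℝ (transition n x y) z)).transpose *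
      gram h ρ y (transition n x y z) * jacobian (fderiv ℝ (transition n x y) z) := by
  rw [gram_eq, gram_eq, symm_transition hz, coordMetric_transition h hz, Matrix.mul_smul,
    Matrix.smul_mul]

variable {ρ : X → ℝ}

theorem IsBoundaryDefining.symm_pos (hρ : IsBoundaryDefining n ρ) {x : X} {z : Coord n}
    (hz : z ∈ chartInterior n x) : 0 < ρ ((extChartAt (𝓡∂ (n + 1)) x).symm z) :=
  hρ.pos_iff.2 (symm_mem_interior hz)

theorem contDiffOn_gram (h : Metric n X) (hρ : IsBoundaryDefining n ρ) (x : X)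
    (i j : Fin (n + 1)) :
    ContDiffOn ℝ ∞ (fun z => gram h ρ x z i j) (chartInterior n x) := by
  simp only [gram_eq, Matrix.smul_apply, smul_eq_mul]
  refine ContDiffOn.mul (ContDiffOn.inv ?_ fun z hz => ?_)
    ((contDiffOn_coordMetric h x i j).mono (chartInterior_subset_target x))
  · exact (contDiffOn_comp_symm le_rfl hρ.smooth.contMDiffOn x).pow 2
  · exact (pow_pos (hρ.symm_pos hz) 2).ne'

theorem posDef_gram (h : Metric n X) (hρ : IsBoundaryDefining n ρ) {x : X} {z : Coord n}
    (hz : z ∈ chartInterior n x) : (gram h ρ x z).PosDef := by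
  rw [gram_eq]
  exact (posDef_coordMetric h x (chartInterior_subset_target x hz)).smul
    (inv_pos.2 (pow_pos (hρ.symm_pos hz) 2))

/-- This is $d\mathrm{vol}_g=\rho^{-(n+1)}d\mathrm{vol}_h$. Together with the factor $\rho^2$ in
`cometric_gram` it fixes every power of $\rho$ used below. -/
theorem sqrt_det_gram (h : Metric n X) (hρ : IsBoundaryDefining n ρ) {x : X} {z : Coord n}
    (hz : z ∈ chartInterior n x) :
    Real.sqrt (gram h ρ x z).det = (ρ ((extChartAt (𝓡∂ (n + 1)) x).symm z) ^ (n + 1))⁻¹ *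
      Real.sqrt (coordMetric h x z).det := by
  have hp := hρ.symm_pos hz
  rw [gram_eq, Matrix.det_smul, Fintype.card_fin, Real.sqrt_mul (by positivity),
    inv_pow, ← pow_mul, mul_comm 2, pow_mul, ← inv_pow, Real.sqrt_sq (by positivity)]

theorem cometric_gram (h : Metric n X) (hρ : IsBoundaryDefining n ρ) {x : X} {z : Coord n}
    (hz : z ∈ chartInterior n x) (α β : Coord n →L[ℝ] ℂ) :
    cometric (gram h ρ x z) α β = (ρ ((extChartAt (𝓡∂ (n + 1)) x).symm z) : ℂ) ^ 2 *
      cometric (coordMetric h x z) α β := by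
  have hp := hρ.symm_pos hz
  have hdet : IsUnit (coordMetric h x z).det :=
    (posDef_coordMetric h x (chartInterior_subset_target x hz)).det_pos.ne'.isUnit
  have : (gram h ρ x z)⁻¹ = (ρ ((extChartAt (𝓡∂ (n + 1)) x).symm z) ^ 2) •
      (coordMetric h x z)⁻¹ := by
    rw [gram_eq]
    refine Matrix.inv_eq_left_inv ?_
    rw [Matrix.smul_mul, Matrix.mul_smul, Matrix.nonsing_inv_mul _ hdet, smul_smul,
      mul_inv_cancel₀ (by positivity), one_smul]
  simp only [cometric, this, Matrix.smul_apply, smul_eq_mul, Finset.mul_sum]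
  refine Finset.sum_congr rfl fun i _ => Finset.sum_congr rfl fun j _ => ?_
  push_cast; ring

end Gram

/-! ### The Riemannian measure -/

section Volume

theorem measurableSet_inter_preimage_of_continuousOn {α β : Type*} [TopologicalSpace α]
    [MeasurableSpace α] [OpensMeasurableSpace α] [TopologicalSpace β] [MeasurableSpace β]
    [BorelSpace β] {f : α → β} {s : Set α} (hf : ContinuousOn f s) (hs : MeasurableSet s)
    {t : Set β} (ht : MeasurableSet t) : MeasurableSet (s ∩ f ⁻¹' t) := by
  have h1 : Measurable (s.domRestrict f) := (continuousOn_iff_continuous_domRestrict.1 hf).measurable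
  have h2 := hs.subtype_image (h1 ht)
  convert h2 using 1
  ext z
  simp [Set.domRestrict, and_comm]

theorem continuousOn_symm_chartInterior {n : ℕ} {X : Type*} [TopologicalSpace X]
    [ChartedSpace (EuclideanHalfSpace (n + 1)) X] [IsManifold (𝓡∂ (n + 1)) ∞ X] (x : X) :
    ContinuousOn (extChartAt (𝓡∂ (n + 1)) x).symm (chartInterior n x) :=
  (contMDiffOn_symm_chartInterior x 0 (by simp)).continuousOn

theorem continuousOn_sqrt_det_gram {n : ℕ} {X : Type*} [TopologicalSpace X]
    [ChartedSpace (EuclideanHalfSpace (n + 1)) X] [IsManifold (𝓡∂ (n + 1)) ∞ X] (h : Metric n X)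
    {ρ : X → ℝ} (hρ : IsBoundaryDefining n ρ) (x : X) :
    ContinuousOn (fun z => Real.sqrt (gram h ρ x z).det) (chartInterior n x) :=
  (contDiffOn_sqrt_det (contDiffOn_gram h hρ x) fun _ hz => (posDef_gram h hρ hz).det_pos).continuousOn

theorem measurableSet_source {n : ℕ} {X : Type*} [TopologicalSpace X]
    [ChartedSpace (EuclideanHalfSpace (n + 1)) X] [MeasurableSpace X] [BorelSpace X] (x : X) : MeasurableSet (extChartAt (𝓡∂ (n + 1)) x).source :=
  (isOpen_extChartAt_source x).measurableSet

theorem chartVolume_eq {n : ℕ} {X : Type*} [TopologicalSpace X]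
    [ChartedSpace (EuclideanHalfSpace (n + 1)) X] [IsManifold (𝓡∂ (n + 1)) ∞ X]
    [MeasurableSpace X] (h : Metric n X) (ρ : X → ℝ) (x : X) :
    chartVolume h ρ x = ((volume.restrict (chartInterior n x)).withDensity
      fun z => ENNReal.ofReal (Real.sqrt (gram h ρ x z).det)).map
        (extChartAt (𝓡∂ (n + 1)) x).symm := rfl

theorem aemeasurable_density {n : ℕ} {X : Type*} [TopologicalSpace X]
    [ChartedSpace (EuclideanHalfSpace (n + 1)) X] [IsManifold (𝓡∂ (n + 1)) ∞ X] (h : Metric n X)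
    {ρ : X → ℝ} (hρ : IsBoundaryDefining n ρ) (x : X) :
    AEMeasurable (fun z => ENNReal.ofReal (Real.sqrt (gram h ρ x z).det))
      (volume.restrict (chartInterior n x)) :=
  ((continuousOn_sqrt_det_gram h hρ x).aemeasurable
    (isOpen_chartInterior x).measurableSet).ennreal_ofReal

variable {n : ℕ} {X : Type*} [TopologicalSpace X] [ChartedSpace (EuclideanHalfSpace (n + 1)) X]
  [IsManifold (𝓡∂ (n + 1)) ∞ X] [MeasurableSpace X] [BorelSpace X] (h : Metric n X) {ρ : X → ℝ}

theorem chartVolume_apply (ρ : X → ℝ) (x : X) {B : Set X} (hB : MeasurableSet B) :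
    chartVolume h ρ x B = ∫⁻ z in chartInterior n x ∩ (extChartAt (𝓡∂ (n + 1)) x).symm ⁻¹' B,
      ENNReal.ofReal (Real.sqrt (gram h ρ x z).det) := by
  rw [chartVolume_eq, Measure.map_apply_of_aemeasurable _ hB, withDensity_apply',
    Measure.restrict_restrict' (isOpen_chartInterior x).measurableSet, inter_comm]
  · exact ((continuousOn_symm_chartInterior x).aemeasurable
      (isOpen_chartInterior x).measurableSet).mono_ac (withDensity_absolutelyContinuous _ _)

theorem measurableSet_interior : MeasurableSet ((𝓡∂ (n + 1)).interior X) :=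
  isOpen_interior_manifold.measurableSet

/-- Change of variables along the transition map, whose Jacobian is absorbed by `sqrt_det_congr`. -/
theorem chartVolume_overlap (x y : X) {B : Set X} (hB : MeasurableSet B) :
    chartVolume h ρ y (B ∩ (extChartAt (𝓡∂ (n + 1)) x).source) =
      chartVolume h ρ x (B ∩ (extChartAt (𝓡∂ (n + 1)) y).source) := by
  rw [chartVolume_apply h ρ y (hB.inter (measurableSet_source x)),
    chartVolume_apply h ρ x (hB.inter (measurableSet_source y))]
  have hA : ∀ x y : X, chartInterior n y ∩ (extChartAt (𝓡∂ (n + 1)) y).symm ⁻¹'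
      (B ∩ (extChartAt (𝓡∂ (n + 1)) x).source) =
      overlap n y x ∩ (extChartAt (𝓡∂ (n + 1)) y).symm ⁻¹' B := fun x y => by
    ext z; simp only [overlap, mem_inter_iff, mem_preimage]; tauto
  rw [hA, hA]
  have hD := isDiffeoOn_transition (n := n) y x
  set A := overlap n y x ∩ (extChartAt (𝓡∂ (n + 1)) y).symm ⁻¹' B with hAdef
  have himg : transition n y x '' A =
      overlap n x y ∩ (extChartAt (𝓡∂ (n + 1)) x).symm ⁻¹' B := by
    rw [← hD.image_inter_preimage]
    congr 1
    ext z
    simp only [hAdef, mem_inter_iff, mem_preimage]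
    exact and_congr_right fun hz => by rw [symm_transition hz]
  have hAm : MeasurableSet A :=
    measurableSet_inter_preimage_of_continuousOn
      ((continuousOn_symm_chartInterior y).mono inter_subset_left)
      (isOpen_overlap y x).measurableSet hB
  rw [← himg, lintegral_image_eq_lintegral_abs_det_fderiv_mul volume hAm
    (fun z hz => hD.hasFDerivWithinAt hz.1 A) (hD.leftInvOn.injOn.mono inter_subset_left)]
  refine setLIntegral_congr_fun hAm fun z hz => ?_
  rw [gram_transition h ρ hz.1, sqrt_det_congr, ENNReal.ofReal_mul (abs_nonneg _)]

theorem chartVolume_compl_source (ρ : X → ℝ) (x : X) :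
    chartVolume h ρ x ((extChartAt (𝓡∂ (n + 1)) x).source ∩ (𝓡∂ (n + 1)).interior X)ᶜ = 0 := by
  rw [chartVolume_apply h ρ x ((measurableSet_source x).inter measurableSet_interior).compl]
  have : chartInterior n x ∩ (extChartAt (𝓡∂ (n + 1)) x).symm ⁻¹'
      ((extChartAt (𝓡∂ (n + 1)) x).source ∩ (𝓡∂ (n + 1)).interior X)ᶜ = ∅ := by
    refine eq_empty_of_forall_notMem fun z hz => hz.2 ?_
    exact ⟨chartInterior_symm_mem_source hz.1, symm_mem_interior hz.1⟩
  rw [this, Measure.restrict_empty, lintegral_zero_measure]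

theorem chartVolume_restrict_source (ρ : X → ℝ) (x : X) :
    (chartVolume h ρ x).restrict (extChartAt (𝓡∂ (n + 1)) x).source = chartVolume h ρ x := by
  refine Measure.restrict_eq_self_of_ae_mem ?_
  refine measure_mono_null (fun p hp => ?_) (chartVolume_compl_source h ρ x)
  exact fun h' => hp h'.1

/-- On the domain of a chart the Riemannian measure is the one of the chart. -/
theorem riemannianVolume_restrict_source (x : X) :
    (riemannianVolume h ρ).restrict (extChartAt (𝓡∂ (n + 1)) x).source = chartVolume h ρ x := by
  set S := (extChartAt (𝓡∂ (n + 1)) x).source with hS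
  have hSm : MeasurableSet S := measurableSet_source x
  refine le_antisymm ?_ ?_
  -- Every chart measure agrees with that of `x` on the overlap and is at most the top measure
  -- elsewhere. The right side is thus an upper bound for the supremum, and restricting to `S` kills
  -- its second term.
  · have hle : riemannianVolume h ρ ≤ chartVolume h ρ x + (⊤ : Measure X).restrict Sᶜ := by
      refine iSup_le fun y => Measure.le_iff.2 fun B hB => ?_
      rw [← measure_inter_add_sdiff B hSm, Measure.add_apply, sdiff_eq]
      refine add_le_add ?_ ?_
      · rw [chartVolume_overlap h x y hB]
        exact measure_mono inter_subset_left
      · rw [Measure.restrict_apply hB]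
        exact (le_top : chartVolume h ρ y ≤ ⊤) _
    refine (Measure.restrict_mono le_rfl hle).trans ?_
    rw [Measure.restrict_add, Measure.restrict_restrict hSm, inter_compl_self,
      Measure.restrict_empty, add_zero]
    exact Measure.restrict_le_self
  · rw [← chartVolume_restrict_source h ρ x]
    exact Measure.restrict_mono le_rfl (le_iSup (chartVolume h ρ) x)

theorem riemannianVolume_apply_of_subset {x : X} {B : Set X}
    (hB : B ⊆ (extChartAt (𝓡∂ (n + 1)) x).source) :
    riemannianVolume h ρ B = chartVolume h ρ x B := by
  rw [← riemannianVolume_restrict_source h x, Measure.restrict_eq_self _ hB]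

theorem aemeasurable_symm (ρ : X → ℝ) (x : X) :
    AEMeasurable (extChartAt (𝓡∂ (n + 1)) x).symm
      ((volume.restrict (chartInterior n x)).withDensity
        fun z => ENNReal.ofReal (Real.sqrt (gram h ρ x z).det)) :=
  ((continuousOn_symm_chartInterior x).aemeasurable
    (isOpen_chartInterior x).measurableSet).mono_ac (withDensity_absolutelyContinuous _ _)

theorem lintegral_source_eq_chart (hρ : IsBoundaryDefining n ρ) {x : X} {f : X → ENNReal}
    (hf : Measurable f) {K : Set X} (hK : MeasurableSet K)
    (hKS : K ⊆ (extChartAt (𝓡∂ (n + 1)) x).source) :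
    ∫⁻ p in K, f p ∂riemannianVolume h ρ =
      ∫⁻ z in chartInterior n x ∩ (extChartAt (𝓡∂ (n + 1)) x).symm ⁻¹' K,
        ENNReal.ofReal (Real.sqrt (gram h ρ x z).det) *
          f ((extChartAt (𝓡∂ (n + 1)) x).symm z) := by
  have hK' := measurableSet_inter_preimage_of_continuousOn
    (continuousOn_symm_chartInterior (n := n) x)
    (isOpen_chartInterior x).measurableSet hK
  have e1 : (riemannianVolume h ρ).restrict K = (chartVolume h ρ x).restrict K := by
    rw [← riemannianVolume_restrict_source h x, Measure.restrict_restrict hK,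
      inter_eq_left.2 hKS]
  rw [e1, ← lintegral_indicator hK, chartVolume_eq,
    lintegral_map' (hf.indicator hK).aemeasurable (aemeasurable_symm h ρ x)]
  rw [lintegral_withDensity_eq_lintegral_mul₀ (aemeasurable_density h hρ x)
    (g := fun z => K.indicator f ((extChartAt (𝓡∂ (n + 1)) x).symm z)) ((hf.indicator hK).comp_aemeasurable ((continuousOn_symm_chartInterior x).aemeasurable
      (isOpen_chartInterior x).measurableSet)), ← lintegral_indicator hK',
    ← lintegral_indicator (isOpen_chartInterior x).measurableSet]
  refine lintegral_congr fun z => ?_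
  by_cases hz : z ∈ chartInterior n x <;>
    by_cases hz' : (extChartAt (𝓡∂ (n + 1)) x).symm z ∈ K <;>
    simp only [indicator, hz, hz', mem_inter_iff, mem_preimage, Pi.mul_apply, if_true, if_false,
      and_true, and_false, and_self, mul_zero]

variable [CompactSpace X]

/-- Each chart measure is null off the interior; by compactness finitely many charts suffice, so
null sets add up. -/
theorem riemannianVolume_compl_interior :
    riemannianVolume h ρ ((𝓡∂ (n + 1)).interior X)ᶜ = 0 := by
  obtain ⟨t, ht⟩ := isCompact_univ.elim_finite_subcover
    (fun x : X => (extChartAt (𝓡∂ (n + 1)) x).source) (fun x => isOpen_extChartAt_source x)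
    fun x _ => mem_iUnion.2 ⟨x, mem_extChartAt_source x⟩
  have : ((𝓡∂ (n + 1)).interior X)ᶜ ⊆ ⋃ x ∈ t, (extChartAt (𝓡∂ (n + 1)) x).source ∩
      ((𝓡∂ (n + 1)).interior X)ᶜ := fun p hp => by
    obtain ⟨x, hx, hpx⟩ := mem_iUnion₂.1 (ht (mem_univ p))
    exact mem_iUnion₂.2 ⟨x, hx, hpx, hp⟩
  refine measure_mono_null this ((measure_biUnion_null_iff t.countable_toSet).2 fun x _ => ?_)
  rw [riemannianVolume_apply_of_subset h inter_subset_left]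
  refine measure_mono_null (fun p hp => ?_) (chartVolume_compl_source h ρ x)
  exact fun h' => hp.2 h'.2

theorem ae_mem_interior : ∀ᵐ p ∂riemannianVolume h ρ, p ∈ (𝓡∂ (n + 1)).interior X :=
  riemannianVolume_compl_interior h

theorem riemannianVolume_restrict_interior :
    (riemannianVolume h ρ).restrict ((𝓡∂ (n + 1)).interior X) = riemannianVolume h ρ :=
  Measure.restrict_eq_self_of_ae_mem (ae_mem_interior h)

theorem aestronglyMeasurable_of_continuousOn {F : Type*} [NormedAddCommGroup F]
    [SecondCountableTopology F] {f : X → F} (hf : ContinuousOn f ((𝓡∂ (n + 1)).interior X)) :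
    AEStronglyMeasurable f (riemannianVolume h ρ) := by
  rw [← riemannianVolume_restrict_interior h]
  exact hf.aestronglyMeasurable measurableSet_interior

/-- Integrals of functions supported in a chart, in coordinates. -/
theorem integral_eq_chart (hρ : IsBoundaryDefining n ρ) {x : X} {f : X → ℂ}
    (hf : ContinuousOn f ((𝓡∂ (n + 1)).interior X))
    (h0 : ∀ p, p ∉ (extChartAt (𝓡∂ (n + 1)) x).source → f p = 0) :
    ∫ p, f p ∂riemannianVolume h ρ = ∫ z in chartInterior n x,
      (Real.sqrt (gram h ρ x z).det : ℂ) * f ((extChartAt (𝓡∂ (n + 1)) x).symm z) := by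
  have hfm : AEStronglyMeasurable f (chartVolume h ρ x) := by
    rw [← riemannianVolume_restrict_source h x]
    exact (aestronglyMeasurable_of_continuousOn h hf).restrict
  rw [← setIntegral_eq_integral_of_forall_compl_eq_zero
    (s := (extChartAt (𝓡∂ (n + 1)) x).source) h0, riemannianVolume_restrict_source h x]
  rw [chartVolume_eq] at hfm ⊢
  rw [integral_map (aemeasurable_symm h ρ x) hfm]
  rw [integral_withDensity_eq_integral_toReal_smul₀ (aemeasurable_density h hρ x)
    (ae_of_all _ fun _ => ENNReal.ofReal_lt_top)]
  simp only [ENNReal.toReal_ofReal (Real.sqrt_nonneg _), Complex.real_smul]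

end Volume

/-! ### The pairing of differentials -/

section Pairing

variable {n : ℕ} {X : Type*} [TopologicalSpace X] [ChartedSpace (EuclideanHalfSpace (n + 1)) X]

/-- Functions that are `Cᵏ` on the interior of `X`. -/
abbrev SmoothInside (n : ℕ) {X : Type*} [TopologicalSpace X]
    [ChartedSpace (EuclideanHalfSpace (n + 1)) X] (k : WithTop ℕ∞) (a : X → ℂ) : Prop :=
  ContMDiffOn (𝓡∂ (n + 1)) 𝓘(ℝ, ℂ) k a ((𝓡∂ (n + 1)).interior X)

theorem SmoothInside.mul {k : WithTop ℕ∞} {a b : X → ℂ} (ha : SmoothInside n k a)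
    (hb : SmoothInside n k b) : SmoothInside n k fun p => a p * b p :=
  (contDiff_mul (𝕜 := ℝ) (𝔸 := ℂ)).contMDiff.comp_contMDiffOn (ha.prodMk_space hb)

theorem SmoothInside.conj {k : WithTop ℕ∞} {a : X → ℂ} (ha : SmoothInside n k a) :
    SmoothInside n k fun p => (starRingEnd ℂ) (a p) :=
  Complex.conjCLE.contDiff.contMDiff.comp_contMDiffOn ha

/-- The differential of `a` at `p`, in the preferred chart at `p`. -/
def covec (n : ℕ) {X : Type*} [TopologicalSpace X]
    [ChartedSpace (EuclideanHalfSpace (n + 1)) X] (a : X → ℂ) (p : X) : Coord n →L[ℝ] ℂ :=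
  fderiv ℝ (a ∘ (extChartAt (𝓡∂ (n + 1)) p).symm) (extChartAt (𝓡∂ (n + 1)) p p)

theorem covec_congr {a b : X → ℂ} {p : X} (hab : a =ᶠ[𝓝 p] b) : covec n a p = covec n b p := by
  refine Filter.EventuallyEq.fderiv_eq ?_
  have hc : ContinuousAt (extChartAt (𝓡∂ (n + 1)) p).symm (extChartAt (𝓡∂ (n + 1)) p p) :=
    continuousAt_extChartAt_symm p
  rw [ContinuousAt, extChartAt_to_inv] at hc
  exact hc.eventually hab

theorem covec_conj (a : X → ℂ) (p : X) :
    covec n (fun q => (starRingEnd ℂ) (a q)) p = conjCovec (covec n a p) :=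
  fderiv_conj (v := a ∘ (extChartAt (𝓡∂ (n + 1)) p).symm) _

variable [IsManifold (𝓡∂ (n + 1)) ∞ X]

theorem SmoothInside.differentiableAt_chart {a : X → ℂ} (ha : SmoothInside n 1 a) {x : X}
    {z : Coord n} (hz : z ∈ chartInterior n x) :
    DifferentiableAt ℝ (a ∘ (extChartAt (𝓡∂ (n + 1)) x).symm) z :=
  ((contDiffOn_comp_symm (by norm_cast) ha x).differentiableOn one_ne_zero).differentiableAt
    ((isOpen_chartInterior x).mem_nhds hz)

theorem self_mem_chartInterior {p : X} (hp : p ∈ (𝓡∂ (n + 1)).interior X) :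
    extChartAt (𝓡∂ (n + 1)) p p ∈ chartInterior n p :=
  (extChartAt_mem_chartInterior_iff (mem_extChartAt_source p)).2 hp

theorem transition_self {n : ℕ} {X : Type*} [TopologicalSpace X]
    [ChartedSpace (EuclideanHalfSpace (n + 1)) X] (p x : X) :
    transition n p x (extChartAt (𝓡∂ (n + 1)) p p) = extChartAt (𝓡∂ (n + 1)) x p := by
  rw [transition, Function.comp_apply, extChartAt_to_inv]

theorem self_mem_overlap {p x : X} (hp : p ∈ (𝓡∂ (n + 1)).interior X)
    (hx : p ∈ (extChartAt (𝓡∂ (n + 1)) x).source) :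
    extChartAt (𝓡∂ (n + 1)) p p ∈ overlap n p x := by
  refine ⟨self_mem_chartInterior hp, ?_⟩
  rw [mem_preimage, extChartAt_to_inv]
  exact hx

variable {p : X}

theorem covec_add {a b : X → ℂ} (ha : SmoothInside n 1 a) (hb : SmoothInside n 1 b)
    (hp : p ∈ (𝓡∂ (n + 1)).interior X) :
    covec n (fun q => a q + b q) p = covec n a p + covec n b p :=
  fderiv_add (ha.differentiableAt_chart (self_mem_chartInterior hp))
    (hb.differentiableAt_chart (self_mem_chartInterior hp))

theorem covec_mul {a b : X → ℂ} (ha : SmoothInside n 1 a) (hb : SmoothInside n 1 b)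
    (hp : p ∈ (𝓡∂ (n + 1)).interior X) :
    covec n (fun q => a q * b q) p = a p • covec n b p + b p • covec n a p := by
  have := fderiv_mul (ha.differentiableAt_chart (self_mem_chartInterior hp))
    (hb.differentiableAt_chart (self_mem_chartInterior hp))
  simp only [Function.comp_apply, extChartAt_to_inv] at this
  exact this

theorem covec_comp_real {ρ : X → ℝ} {k : ℝ → ℂ} {k' : ℂ} (hk : HasDerivAt k k' (ρ p))
    (hρ : SmoothInside n 1 fun q => (ρ q : ℂ)) (hp : p ∈ (𝓡∂ (n + 1)).interior X) :
    covec n (fun q => k (ρ q)) p = k' • covec n (fun q => (ρ q : ℂ)) p := by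
  have hd := hρ.differentiableAt_chart (self_mem_chartInterior hp)
  set z := extChartAt (𝓡∂ (n + 1)) p p with hz
  set r : Coord n → ℝ := ρ ∘ (extChartAt (𝓡∂ (n + 1)) p).symm with hr
  have hrz : r z = ρ p := by rw [hr, hz, Function.comp_apply, extChartAt_to_inv]
  have hrd : DifferentiableAt ℝ r z := Complex.reCLM.differentiableAt.comp z hd
  have h1 : HasFDerivAt (k ∘ r) ((ContinuousLinearMap.toSpanSingleton ℝ k').comp
      (fderiv ℝ r z)) z := (hrz ▸ hk).hasFDerivAt.comp z hrd.hasFDerivAt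
  have h2 : HasFDerivAt (fun w => (r w : ℂ)) (Complex.ofRealCLM.comp (fderiv ℝ r z)) z :=
    Complex.ofRealCLM.hasFDerivAt.comp z hrd.hasFDerivAt
  have e1 : covec n (fun q => k (ρ q)) p =
      (ContinuousLinearMap.toSpanSingleton ℝ k').comp (fderiv ℝ r z) := h1.fderiv
  have e2 : covec n (fun q => (ρ q : ℂ)) p = Complex.ofRealCLM.comp (fderiv ℝ r z) := h2.fderiv
  rw [e1, e2]
  ext v
  simp [mul_comm]

theorem covec_chart {a : X → ℂ} (ha : SmoothInside n 1 a) (hp : p ∈ (𝓡∂ (n + 1)).interior X)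
    {x : X} (hx : p ∈ (extChartAt (𝓡∂ (n + 1)) x).source) :
    covec n a p = (fderiv ℝ (a ∘ (extChartAt (𝓡∂ (n + 1)) x).symm)
      (extChartAt (𝓡∂ (n + 1)) x p)).comp
        (fderiv ℝ (transition n p x) (extChartAt (𝓡∂ (n + 1)) p p)) := by
  have hz : extChartAt (𝓡∂ (n + 1)) p p ∈ overlap n p x :=
    self_mem_overlap hp hx
  have hτ : transition n p x (extChartAt (𝓡∂ (n + 1)) p p) = extChartAt (𝓡∂ (n + 1)) x p :=
    transition_self p x
  have hmem := transition_mapsTo p x hz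
  rw [← hτ, ← (isDiffeoOn_transition p x).fderiv_comp_apply hz
    (ha.differentiableAt_chart hmem.1)]
  refine Filter.EventuallyEq.fderiv_eq ?_
  filter_upwards [(isOpen_overlap p x).mem_nhds hz] with w hw
  simp only [Function.comp_apply]
  rw [symm_transition hw]

variable (h : Metric n X) {ρ : X → ℝ}

/-- The complex bilinear pairing `⟨da, db⟩_g`. -/
def pairing (h : Metric n X) (ρ : X → ℝ) (a b : X → ℂ) (p : X) : ℂ :=
  cometric (gram h ρ p (extChartAt (𝓡∂ (n + 1)) p p)) (covec n a p) (covec n b p)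

/-- Both arguments and the matrix are taken in the preferred chart at `p`, which may jump with `p`.
The pairing is invariant, so one fixed chart computes it at all nearby points. -/
theorem pairing_chart (ρ : X → ℝ) {a b : X → ℂ} (ha : SmoothInside n 1 a)
    (hb : SmoothInside n 1 b) (hp : p ∈ (𝓡∂ (n + 1)).interior X) {x : X}
    (hx : p ∈ (extChartAt (𝓡∂ (n + 1)) x).source) :
    pairing h ρ a b p = cometric (gram h ρ x (extChartAt (𝓡∂ (n + 1)) x p))
      (fderiv ℝ (a ∘ (extChartAt (𝓡∂ (n + 1)) x).symm) (extChartAt (𝓡∂ (n + 1)) x p))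
      (fderiv ℝ (b ∘ (extChartAt (𝓡∂ (n + 1)) x).symm) (extChartAt (𝓡∂ (n + 1)) x p)) := by
  have hz : extChartAt (𝓡∂ (n + 1)) p p ∈ overlap n p x :=
    self_mem_overlap hp hx
  have hτ : transition n p x (extChartAt (𝓡∂ (n + 1)) p p) = extChartAt (𝓡∂ (n + 1)) x p :=
    transition_self p x
  rw [pairing, covec_chart ha hp hx, covec_chart hb hp hx, gram_transition h ρ hz, hτ,
    cometric_comp _ _ ((isDiffeoOn_transition p x).det_fderiv_ne_zero hz)]

theorem coordLaplacian_congr {G : Coord n → Matrix (Fin (n + 1)) (Fin (n + 1)) ℝ}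
    {v w : Coord n → ℂ} {z : Coord n} (hvw : v =ᶠ[𝓝 z] w) :
    coordLaplacian G v z = coordLaplacian G w z := by
  unfold coordLaplacian
  congr 1
  refine Finset.sum_congr rfl fun i _ => ?_
  congr 1
  refine Filter.EventuallyEq.fderiv_eq ?_
  filter_upwards [hvw.eventually_nhds] with y hy
  rw [Filter.EventuallyEq.fderiv_eq hy]

/-- The Laplacian is defined with a possibly different chart at each point. Integration by parts
needs a single chart over an open set, which `coordLaplacian_comp` permits. -/
theorem laplacian_chart (hρ : IsBoundaryDefining n ρ) {u : X → ℂ} (hu : SmoothInside n 2 u)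
    (hp : p ∈ (𝓡∂ (n + 1)).interior X) {x : X}
    (hx : p ∈ (extChartAt (𝓡∂ (n + 1)) x).source) :
    laplacian h ρ u p = coordLaplacian (gram h ρ x) (u ∘ (extChartAt (𝓡∂ (n + 1)) x).symm)
      (extChartAt (𝓡∂ (n + 1)) x p) := by
  have hz : extChartAt (𝓡∂ (n + 1)) p p ∈ overlap n p x :=
    self_mem_overlap hp hx
  have hτ : transition n p x (extChartAt (𝓡∂ (n + 1)) p p) = extChartAt (𝓡∂ (n + 1)) x p :=
    transition_self p x
  rw [← hτ, ← coordLaplacian_comp (isDiffeoOn_transition p x)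
    (fun i j => (contDiffOn_gram h hρ p i j).mono inter_subset_left)
    (fun i j => (contDiffOn_gram h hρ x i j).mono inter_subset_left)
    (fun z hz => posDef_gram h hρ hz.1) (fun z hz => posDef_gram h hρ hz.1)
    (fun z hz => gram_transition h ρ hz)
    ((contDiffOn_comp_symm (by norm_cast) hu x).mono inter_subset_left) hz]
  refine coordLaplacian_congr ?_
  filter_upwards [(isOpen_overlap p x).mem_nhds hz] with w hw
  simp only [Function.comp_apply]
  rw [symm_transition hw]

theorem continuousOn_cometric {s : Set (Coord n)}
    {G : Coord n → Matrix (Fin (n + 1)) (Fin (n + 1)) ℝ}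
    (hG : ∀ i j, ContinuousOn (fun z => (G z)⁻¹ i j) s) {α β : Coord n → Coord n →L[ℝ] ℂ}
    (hα : ContinuousOn α s) (hβ : ContinuousOn β s) :
    ContinuousOn (fun z => cometric (G z) (α z) (β z)) s :=
  continuousOn_finsetSum _ fun i _ => continuousOn_finsetSum _ fun j _ =>
    ((Complex.continuous_ofReal.comp_continuousOn (hG i j)).mul
      (hα.clm_apply continuousOn_const)).mul (hβ.clm_apply continuousOn_const)

theorem continuousOn_pairing (hρ : IsBoundaryDefining n ρ) {a b : X → ℂ}
    (ha : SmoothInside n 1 a) (hb : SmoothInside n 1 b) :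
    ContinuousOn (pairing h ρ a b) ((𝓡∂ (n + 1)).interior X) := by
  intro p hp
  refine ContinuousAt.continuousWithinAt ?_
  have hO : (extChartAt (𝓡∂ (n + 1)) p).source ∩ (𝓡∂ (n + 1)).interior X ∈ 𝓝 p :=
    ((isOpen_extChartAt_source p).inter isOpen_interior_manifold).mem_nhds
      ⟨mem_extChartAt_source p, hp⟩
  have hc : ContinuousOn (fun z => cometric (gram h ρ p z)
      (fderiv ℝ (a ∘ (extChartAt (𝓡∂ (n + 1)) p).symm) z)
      (fderiv ℝ (b ∘ (extChartAt (𝓡∂ (n + 1)) p).symm) z)) (chartInterior n p) :=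
    continuousOn_cometric (fun i j => (contDiffOn_inv_entry (contDiffOn_gram h hρ p)
      (fun z hz => (posDef_gram h hρ hz).det_pos.ne') i j).continuousOn)
      ((contDiffOn_comp_symm (by norm_cast) ha p).continuousOn_fderiv_of_isOpen
        (isOpen_chartInterior p) le_rfl)
      ((contDiffOn_comp_symm (by norm_cast) hb p).continuousOn_fderiv_of_isOpen
        (isOpen_chartInterior p) le_rfl)
  have hc' := (hc.continuousAt ((isOpen_chartInterior p).mem_nhds
    (self_mem_chartInterior hp))).comp (continuousAt_extChartAt (I := 𝓡∂ (n + 1)) p)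
  refine hc'.congr ?_
  filter_upwards [hO] with q hq
  exact (pairing_chart h ρ ha hb hq.2 hq.1).symm

end Pairing

/-! ### The weak equation within one chart -/

section ChartSupport

variable {n : ℕ} {X : Type*} [TopologicalSpace X] [ChartedSpace (EuclideanHalfSpace (n + 1)) X]
  [IsManifold (𝓡∂ (n + 1)) ∞ X]

/-- The coordinate expression of `φ`, extended by zero. -/
def chartExtend (n : ℕ) {X : Type*} [TopologicalSpace X]
    [ChartedSpace (EuclideanHalfSpace (n + 1)) X] (x : X) (φ : X → ℂ) : Coord n → ℂ :=
  (chartInterior n x).indicator (φ ∘ (extChartAt (𝓡∂ (n + 1)) x).symm)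

theorem chartExtend_eqOn {n : ℕ} {X : Type*} [TopologicalSpace X]
    [ChartedSpace (EuclideanHalfSpace (n + 1)) X] {x : X} {φ : X → ℂ} {z : Coord n} (hz : z ∈ chartInterior n x) :
    chartExtend n x φ =ᶠ[𝓝 z] φ ∘ (extChartAt (𝓡∂ (n + 1)) x).symm := by
  filter_upwards [(isOpen_chartInterior x).mem_nhds hz] with y hy using indicator_of_mem hy _

/-- The image of `K` is compact inside the open set `chartInterior n x`, so the extension by zero
takes over where `φ` already vanishes. -/
theorem chartExtend_spec {x : X} {φ : X → ℂ} (hφ : SmoothInside n 1 φ) {K : Set X}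
    (hK : IsCompact K) (hKs : K ⊆ (extChartAt (𝓡∂ (n + 1)) x).source ∩ (𝓡∂ (n + 1)).interior X)
    (h0 : ∀ p, p ∉ K → φ p = 0) :
    ContDiff ℝ 1 (chartExtend n x φ) ∧ HasCompactSupport (chartExtend n x φ) ∧
      tsupport (chartExtend n x φ) ⊆ chartInterior n x := by
  have hK' : IsCompact (extChartAt (𝓡∂ (n + 1)) x '' K) :=
    hK.image_of_continuousOn
      ((continuousOn_extChartAt (I := 𝓡∂ (n + 1)) x).mono fun p hp => (hKs hp).1)
  have hKU : extChartAt (𝓡∂ (n + 1)) x '' K ⊆ chartInterior n x := by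
    rintro _ ⟨p, hp, rfl⟩
    exact (extChartAt_mem_chartInterior_iff (hKs hp).1).2 (hKs hp).2
  have hsup : Function.support (chartExtend n x φ) ⊆ extChartAt (𝓡∂ (n + 1)) x '' K := by
    intro z hz
    rw [Function.mem_support, chartExtend, indicator_apply_ne_zero] at hz
    refine ⟨(extChartAt (𝓡∂ (n + 1)) x).symm z, ?_, extChartAt_right_inv hz.1⟩
    by_contra hK
    exact hz.2 (h0 _ hK)
  have ht : tsupport (chartExtend n x φ) ⊆ extChartAt (𝓡∂ (n + 1)) x '' K :=
    closure_minimal hsup hK'.isClosed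
  refine ⟨?_, HasCompactSupport.of_support_subset_isCompact hK' hsup, ht.trans hKU⟩
  refine contDiff_iff_contDiffAt.2 fun z => ?_
  by_cases hz : z ∈ chartInterior n x
  · exact ((contDiffOn_comp_symm (by norm_cast) hφ x).contDiffAt
      ((isOpen_chartInterior x).mem_nhds hz)).congr_of_eventuallyEq (chartExtend_eqOn hz)
  · have hz' : z ∈ (tsupport (chartExtend n x φ))ᶜ := fun h' => hz (hKU (ht h'))
    refine ContDiffAt.congr_of_eventuallyEq (f := fun _ => 0) contDiffAt_const ?_
    filter_upwards [(isClosed_tsupport _).isOpen_compl.mem_nhds hz'] with y hy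
    exact image_eq_zero_of_notMem_tsupport hy

variable (h : Metric n X) {ρ : X → ℝ}

theorem pairing_eq_zero (ρ : X → ℝ) {a φ : X → ℂ} {K : Set X} (hK : IsClosed K)
    (h0 : ∀ p, p ∉ K → φ p = 0) {p : X} (hp : p ∉ K) : pairing h ρ a φ p = 0 := by
  have : φ =ᶠ[𝓝 p] fun _ => 0 := by
    filter_upwards [hK.isOpen_compl.mem_nhds hp] with q hq using h0 q hq
  have h1 : covec n φ p = 0 := by
    rw [covec_congr this]
    exact fderiv_const_apply (0 : ℂ)
  rw [pairing, h1, cometric_zero_right]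

variable [MeasurableSpace X] [BorelSpace X] [CompactSpace X] [T2Space X]

/-- The weak equation of an eigensolution, against functions supported in a chart. -/
theorem IsEigensolution.integral_pairing_chart {h : Metric n X} (hρ : IsBoundaryDefining n ρ)
    {μ : ℂ} {u : X → ℂ} (hu : IsEigensolution h ρ μ u) {x : X} {φ : X → ℂ}
    (hφ : SmoothInside n 1 φ) {K : Set X} (hK : IsCompact K)
    (hKs : K ⊆ (extChartAt (𝓡∂ (n + 1)) x).source ∩ (𝓡∂ (n + 1)).interior X)
    (h0 : ∀ p, p ∉ K → φ p = 0) :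
    ∫ p, pairing h ρ u φ p ∂riemannianVolume h ρ =
      ∫ p, μ * u p * φ p ∂riemannianVolume h ρ := by
  obtain ⟨c1, c2, c3⟩ := chartExtend_spec hφ hK hKs h0
  have hu2 : SmoothInside n 2 u := hu.contMDiffOn
  have hu1 : SmoothInside n 1 u := hu2.of_le (by norm_num)
  have hKs' : ∀ p, p ∉ (extChartAt (𝓡∂ (n + 1)) x).source → p ∉ K := fun p hp h' =>
    hp (hKs h').1
  rw [integral_eq_chart h hρ (continuousOn_pairing h hρ hu1 hφ)
      fun p hp => pairing_eq_zero h ρ hK.isClosed h0 (hKs' p hp),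
    integral_eq_chart h hρ (f := fun p => μ * u p * φ p) ((continuousOn_const.mul hu1.continuousOn).mul hφ.continuousOn)
      fun p hp => by rw [h0 p (hKs' p hp), mul_zero]]
  have key := integral_coordLaplacian_mul (isOpen_chartInterior x) (contDiffOn_gram h hρ x)
    (fun z hz => (posDef_gram h hρ hz).det_pos) (fun z hz => (posDef_gram h hρ hz).1)
    (contDiffOn_comp_symm (by norm_cast) hu2 x) c1 c2 c3
  refine Eq.trans ?_ (key.trans ?_)
  · refine setIntegral_congr_fun (isOpen_chartInterior x).measurableSet fun z hz => ?_
    rw [(chartExtend_eqOn hz).fderiv_eq, pairing_chart h ρ hu1 hφ (symm_mem_interior hz)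
      (chartInterior_symm_mem_source hz), extChartAt_right_inv hz]
  · refine setIntegral_congr_fun (isOpen_chartInterior x).measurableSet fun z hz => ?_
    have := laplacian_chart h hρ hu2 (symm_mem_interior hz) (chartInterior_symm_mem_source hz)
    rw [extChartAt_right_inv hz, hu.eq _ (symm_mem_interior hz)] at this
    rw [← this, chartExtend, indicator_of_mem hz]
    rfl

end ChartSupport

/-! ### Uniform estimates up to the boundary -/

section LocalBounds

variable {n : ℕ} {X : Type*} [TopologicalSpace X] [ChartedSpace (EuclideanHalfSpace (n + 1)) X]

/-- A locally uniform upper bound is uniform on a compact space. -/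
theorem exists_uniform_bound {X : Type*} [TopologicalSpace X] [CompactSpace X]
    {P : X → ℝ → Prop} (hmono : ∀ p C D, C ≤ D → P p C → P p D)
    (hloc : ∀ x, ∃ C, ∀ᶠ p in 𝓝 x, P p C) : ∃ C, 0 < C ∧ ∀ p, P p C := by
  choose C hC using hloc
  obtain ⟨t, _, ht⟩ := isCompact_univ.elim_nhds_subcover (fun x => {p | P p (C x)})
    fun x _ => hC x
  refine ⟨∑ x ∈ t, |C x| + 1, by positivity, fun p => ?_⟩
  obtain ⟨x, hx, hpx⟩ := mem_iUnion₂.1 (ht (mem_univ p))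
  refine hmono p _ _ ?_ hpx
  have := Finset.single_le_sum (f := fun x => |C x|) (fun _ _ => abs_nonneg _) hx
  linarith [le_abs_self (C x)]

theorem target_mem_nhds {x : X} {z : Coord n} (hz : z ∈ chartInterior n x) :
    (extChartAt (𝓡∂ (n + 1)) x).target ∈ 𝓝 z :=
  mem_interior_iff_mem_nhds.1 hz

/-- A function continuous on the target of a chart is locally bounded up to the boundary. -/
theorem eventually_le_of_continuousOn_target {x : X} {f : Coord n → ℝ}
    (hf : ContinuousOn f (extChartAt (𝓡∂ (n + 1)) x).target) {c : ℝ}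
    (hc : f (extChartAt (𝓡∂ (n + 1)) x x) < c) :
    ∀ᶠ p in 𝓝 x, f (extChartAt (𝓡∂ (n + 1)) x p) < c := by
  have h1 := (hf _ (mem_extChartAt_target x)).eventually_lt_const hc
  have h2 : Tendsto (extChartAt (𝓡∂ (n + 1)) x) (𝓝 x)
      (𝓝[(extChartAt (𝓡∂ (n + 1)) x).target] (extChartAt (𝓡∂ (n + 1)) x x)) := by
    refine tendsto_nhdsWithin_iff.2 ⟨continuousAt_extChartAt x, ?_⟩
    filter_upwards [extChartAt_source_mem_nhds (I := 𝓡∂ (n + 1)) x] with p hp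
    exact (extChartAt (𝓡∂ (n + 1)) x).map_source hp
  exact h2.eventually h1

theorem IsBoundaryDefining.smoothInside_comp {ρ : X → ℝ} (hρ : IsBoundaryDefining n ρ)
    (hpos : ∀ p ∈ (𝓡∂ (n + 1)).interior X, 0 < ρ p) {k : ℝ → ℂ}
    (hk : ContDiffOn ℝ 1 k (Ioi 0)) : SmoothInside n 1 fun p => k (ρ p) :=
  hk.contMDiffOn.comp (hρ.smooth.contMDiffOn.of_le (by norm_cast)) hpos

variable [IsManifold (𝓡∂ (n + 1)) ∞ X]

/-- The differential in the chart around `x`, up to the boundary. -/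
def chartDiff (n : ℕ) {X : Type*} [TopologicalSpace X]
    [ChartedSpace (EuclideanHalfSpace (n + 1)) X] (x : X) (a : X → ℂ) (z : Coord n) :
    Coord n →L[ℝ] ℂ :=
  fderivWithin ℝ (a ∘ (extChartAt (𝓡∂ (n + 1)) x).symm) (extChartAt (𝓡∂ (n + 1)) x).target z

theorem chartDiff_eq {n : ℕ} {X : Type*} [TopologicalSpace X]
    [ChartedSpace (EuclideanHalfSpace (n + 1)) X] {x : X} {a : X → ℂ} {z : Coord n} (hz : z ∈ chartInterior n x) :
    chartDiff n x a z = fderiv ℝ (a ∘ (extChartAt (𝓡∂ (n + 1)) x).symm) z :=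
  fderivWithin_of_mem_nhds (target_mem_nhds hz)

theorem contDiffOn_chartDiff {x : X} {a : X → ℂ}
    (ha : ContMDiff (𝓡∂ (n + 1)) 𝓘(ℝ, ℂ) ∞ a) :
    ContDiffOn ℝ ∞ (chartDiff n x a) (extChartAt (𝓡∂ (n + 1)) x).target := by
  have h1 : ContDiffOn ℝ ∞ (a ∘ (extChartAt (𝓡∂ (n + 1)) x).symm)
      (extChartAt (𝓡∂ (n + 1)) x).target :=
    (ha.comp_contMDiffOn (contMDiffOn_extChartAt_symm (n := ∞) x)).contDiffOn
  exact h1.fderivWithin (uniqueDiffOn_extChartAt_target x) (by simp)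

variable (h : Metric n X) {ρ : X → ℝ}

theorem contDiffOn_coordMetric_inv (x : X) (i j : Fin (n + 1)) :
    ContDiffOn ℝ ∞ (fun z => (coordMetric h x z)⁻¹ i j) (extChartAt (𝓡∂ (n + 1)) x).target :=
  contDiffOn_inv_entry (contDiffOn_coordMetric h x)
    (fun _ hz => (posDef_coordMetric h x hz).det_pos.ne') i j

theorem contDiffOn_sqrt_det_coordMetric (x : X) :
    ContDiffOn ℝ ∞ (fun z => Real.sqrt (coordMetric h x z).det)
      (extChartAt (𝓡∂ (n + 1)) x).target :=
  contDiffOn_sqrt_det (contDiffOn_coordMetric h x) fun _ hz => (posDef_coordMetric h x hz).det_pos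

theorem continuousOn_chartPairing (x : X) {a b : X → ℂ}
    (ha : ContMDiff (𝓡∂ (n + 1)) 𝓘(ℝ, ℂ) ∞ a) (hb : ContMDiff (𝓡∂ (n + 1)) 𝓘(ℝ, ℂ) ∞ b) :
    ContinuousOn (fun z => cometric (coordMetric h x z) (chartDiff n x a z) (chartDiff n x b z))
      (extChartAt (𝓡∂ (n + 1)) x).target :=
  continuousOn_cometric (fun i j => (contDiffOn_coordMetric_inv h x i j).continuousOn)
    (contDiffOn_chartDiff ha).continuousOn (contDiffOn_chartDiff hb).continuousOn

theorem pairing_eq_chartPairing (hρ : IsBoundaryDefining n ρ) {a b : X → ℂ}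
    (ha : SmoothInside n 1 a) (hb : SmoothInside n 1 b) {p x : X}
    (hp : p ∈ (𝓡∂ (n + 1)).interior X) (hx : p ∈ (extChartAt (𝓡∂ (n + 1)) x).source) :
    pairing h ρ a b p = (ρ p : ℂ) ^ 2 * cometric (coordMetric h x (extChartAt (𝓡∂ (n + 1)) x p))
      (chartDiff n x a (extChartAt (𝓡∂ (n + 1)) x p))
      (chartDiff n x b (extChartAt (𝓡∂ (n + 1)) x p)) := by
  have hz := (extChartAt_mem_chartInterior_iff hx).2 hp
  rw [pairing_chart h ρ ha hb hp hx, cometric_gram h hρ hz, chartDiff_eq hz, chartDiff_eq hz,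
    (extChartAt (𝓡∂ (n + 1)) x).left_inv hx]

/-- Functions smooth up to the boundary have `⟨da, db⟩_g = O(ρ²)`. -/
theorem exists_norm_pairing_le [CompactSpace X] (hρ : IsBoundaryDefining n ρ) {a b : X → ℂ}
    (ha : ContMDiff (𝓡∂ (n + 1)) 𝓘(ℝ, ℂ) ∞ a) (hb : ContMDiff (𝓡∂ (n + 1)) 𝓘(ℝ, ℂ) ∞ b) :
    ∃ C, 0 < C ∧ ∀ p ∈ (𝓡∂ (n + 1)).interior X, ‖pairing h ρ a b p‖ ≤ C * ρ p ^ 2 := by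
  refine exists_uniform_bound
    (P := fun p C => p ∈ (𝓡∂ (n + 1)).interior X → ‖pairing h ρ a b p‖ ≤ C * ρ p ^ 2)
    (fun p C D hCD hC hp => (hC hp).trans (by gcongr)) fun x => ?_
  have hf := (continuousOn_chartPairing h x ha hb).norm
  refine ⟨‖cometric (coordMetric h x (extChartAt (𝓡∂ (n + 1)) x x))
    (chartDiff n x a (extChartAt (𝓡∂ (n + 1)) x x))
    (chartDiff n x b (extChartAt (𝓡∂ (n + 1)) x x))‖ + 1, ?_⟩
  filter_upwards [eventually_le_of_continuousOn_target hf (lt_add_one _),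
    extChartAt_source_mem_nhds (I := 𝓡∂ (n + 1)) x] with p hp hps hpi
  rw [pairing_eq_chartPairing h hρ (ha.contMDiffOn.of_le (by norm_cast))
    (hb.contMDiffOn.of_le (by norm_cast)) hpi hps, norm_mul, norm_pow, Complex.norm_real,
    Real.norm_of_nonneg (hρ.nonneg p), mul_comm]
  gcongr

theorem isCompact_ge {n : ℕ} {X : Type*} [TopologicalSpace X]
    [ChartedSpace (EuclideanHalfSpace (n + 1)) X] [CompactSpace X] {ρ : X → ℝ} (hρ : IsBoundaryDefining n ρ) (δ : ℝ) : IsCompact {p | δ ≤ ρ p} :=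
  (isClosed_le continuous_const hρ.smooth.continuous).isCompact

theorem IsBoundaryDefining.contMDiff_complex {n : ℕ} {X : Type*} [TopologicalSpace X]
    [ChartedSpace (EuclideanHalfSpace (n + 1)) X] {ρ : X → ℝ} (hρ : IsBoundaryDefining n ρ) :
    ContMDiff (𝓡∂ (n + 1)) 𝓘(ℝ, ℂ) ∞ fun p => (ρ p : ℂ) :=
  (Complex.ofRealCLM.contDiff.contMDiff (n := ∞)).comp hρ.smooth

theorem IsBoundaryDefining.smoothInside {n : ℕ} {X : Type*} [TopologicalSpace X]
    [ChartedSpace (EuclideanHalfSpace (n + 1)) X] {ρ : X → ℝ} (hρ : IsBoundaryDefining n ρ) :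
    SmoothInside n 1 fun p => (ρ p : ℂ) :=
  hρ.contMDiff_complex.contMDiffOn.of_le (by norm_cast)

theorem cometric_self_re_pos {M : Matrix (Fin (n + 1)) (Fin (n + 1)) ℝ} (hM : M.PosDef)
    {α : Coord n →L[ℝ] ℂ} (hα : conjCovec α = α) (h0 : α ≠ 0) : 0 < (cometric M α α).re := by
  set a : Fin (n + 1) → ℝ := fun i => (α (stdVec i)).re with ha
  have hr : ∀ i, α (stdVec i) = (a i : ℂ) := fun i => by
    have := congrArg (fun γ => γ (stdVec i)) hα
    exact (Complex.conj_eq_iff_re.1 this).symm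
  have hne : a ≠ 0 := fun h' => h0 <| by
    refine ContinuousLinearMap.ext fun v => ?_
    rw [← (EuclideanSpace.basisFun (Fin (n + 1)) ℝ).sum_repr v, map_sum]
    refine Finset.sum_eq_zero fun i _ => ?_
    rw [map_smul, EuclideanSpace.basisFun_apply, hr i, h']
    simp
  have hp := hM.inv.dotProduct_mulVec_pos hne
  refine hp.trans_eq ?_
  have : cometric M α α = ((star a ⬝ᵥ M⁻¹.mulVec a : ℝ) : ℂ) := by
    simp only [cometric, hr, dotProduct, Matrix.mulVec, Pi.star_apply, star_trivial,
      Finset.mul_sum]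
    push_cast
    exact Finset.sum_congr rfl fun i _ => Finset.sum_congr rfl fun j _ => by ring
  rw [this, Complex.ofReal_re]

theorem chartDiff_ofReal {x : X} {z : Coord n} (hρ : IsBoundaryDefining n ρ)
    (hz : z ∈ (extChartAt (𝓡∂ (n + 1)) x).target) :
    chartDiff n x (fun p => (ρ p : ℂ)) z = Complex.ofRealCLM.comp
      (fderivWithin ℝ (ρ ∘ (extChartAt (𝓡∂ (n + 1)) x).symm)
        (extChartAt (𝓡∂ (n + 1)) x).target z) := by
  have h1 : ContDiffOn ℝ ∞ (ρ ∘ (extChartAt (𝓡∂ (n + 1)) x).symm)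
      (extChartAt (𝓡∂ (n + 1)) x).target :=
    (hρ.smooth.comp_contMDiffOn (contMDiffOn_extChartAt_symm (n := ∞) x)).contDiffOn
  exact ((Complex.ofRealCLM.hasFDerivAt).comp_hasFDerivWithinAt z
    ((h1.differentiableOn (by simp) z hz).hasFDerivWithinAt)).fderivWithin
      (uniqueDiffOn_extChartAt_target x z hz)

/-- Translates $d\rho\ne0$ to the chart: near the base point the target and the half space coincide,
so the derivatives within them agree. -/
theorem chartDiff_ne_zero (hρ : IsBoundaryDefining n ρ) {x : X}
    (hx : x ∈ (𝓡∂ (n + 1)).boundary X) :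
    chartDiff n x (fun p => (ρ p : ℂ)) (extChartAt (𝓡∂ (n + 1)) x x) ≠ 0 := by
  intro h0
  rw [chartDiff_ofReal hρ (mem_extChartAt_target x)] at h0
  refine hρ.mfderiv_ne_zero x hx ?_
  have hd : MDifferentiableAt (𝓡∂ (n + 1)) 𝓘(ℝ, ℝ) ρ x := hρ.smooth.mdifferentiableAt (by simp)
  have e : (mfderiv (𝓡∂ (n + 1)) 𝓘(ℝ, ℝ) ρ x : Coord n →L[ℝ] ℝ) =
      fderivWithin ℝ (ρ ∘ (extChartAt (𝓡∂ (n + 1)) x).symm)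
        (extChartAt (𝓡∂ (n + 1)) x).target (extChartAt (𝓡∂ (n + 1)) x x) := by
    rw [hd.mfderiv]
    refine fderivWithin_congr_set ?_
    exact extChartAt_target_eventuallyEq.symm
  refine e.trans (ContinuousLinearMap.ext fun v => ?_)
  have := congrArg (fun T => T v) h0
  exact Complex.ofReal_eq_zero.1 this

/-- Near the boundary `|dρ|_g²` is at least a multiple of `ρ²`. -/
theorem exists_le_pairing [CompactSpace X] (hρ : IsBoundaryDefining n ρ) :
    ∃ c, 0 < c ∧ ∀ p ∈ (𝓡∂ (n + 1)).interior X, ρ p < c →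
      c * ρ p ^ 2 ≤ (pairing h ρ (fun q => (ρ q : ℂ)) (fun q => (ρ q : ℂ)) p).re := by
  -- Written with $C^{-1}$ because `exists_uniform_bound` asks for a property that survives
  -- enlarging the constant.
  suffices hloc : ∀ x : X, ∃ C, ∀ᶠ p in 𝓝 x, 0 < C ∧ (p ∈ (𝓡∂ (n + 1)).interior X → ρ p < C⁻¹ →
      C⁻¹ * ρ p ^ 2 ≤ (pairing h ρ (fun q => (ρ q : ℂ)) (fun q => (ρ q : ℂ)) p).re) by
    obtain ⟨C, hC, hP⟩ := exists_uniform_bound (fun p C D hCD hC => ⟨hC.1.trans_le hCD, fun hp hlt => by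
      have h1 : D⁻¹ ≤ C⁻¹ := inv_anti₀ hC.1 hCD
      exact (by gcongr : D⁻¹ * ρ p ^ 2 ≤ C⁻¹ * ρ p ^ 2).trans (hC.2 hp (hlt.trans_le h1))⟩) hloc
    exact ⟨C⁻¹, inv_pos.2 hC, fun p => (hP p).2⟩
  intro x
  by_cases hx : x ∈ (𝓡∂ (n + 1)).boundary X
  · set f : Coord n → ℝ := fun z => (cometric (coordMetric h x z)
      (chartDiff n x (fun q => (ρ q : ℂ)) z) (chartDiff n x (fun q => (ρ q : ℂ)) z)).re with hf
    have hfc : ContinuousOn f (extChartAt (𝓡∂ (n + 1)) x).target :=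
      Complex.continuous_re.comp_continuousOn
        (continuousOn_chartPairing h x hρ.contMDiff_complex hρ.contMDiff_complex)
    have hpos : 0 < f (extChartAt (𝓡∂ (n + 1)) x x) := by
      refine cometric_self_re_pos (posDef_coordMetric h x (mem_extChartAt_target x)) ?_
        (chartDiff_ne_zero hρ hx)
      rw [chartDiff_ofReal hρ (mem_extChartAt_target x)]
      ext v
      simp [conjCovec_apply]
    set c := f (extChartAt (𝓡∂ (n + 1)) x x) / 2 with hc
    have hc0 : 0 < c := half_pos hpos
    refine ⟨c⁻¹, ?_⟩
    filter_upwards [eventually_le_of_continuousOn_target hfc.neg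
      (c := -c) (by simp only [Pi.neg_apply]; linarith),
      extChartAt_source_mem_nhds (I := 𝓡∂ (n + 1)) x] with p hp hps
    refine ⟨inv_pos.2 hc0, fun hpi _ => ?_⟩
    rw [pairing_eq_chartPairing h hρ hρ.smoothInside hρ.smoothInside hpi hps,
      ← Complex.ofReal_pow, Complex.re_ofReal_mul, inv_inv, mul_comm]
    simp only [Pi.neg_apply, neg_lt_neg_iff] at hp
    exact mul_le_mul_of_nonneg_left hp.le (sq_nonneg _)
  · rw [← ModelWithCorners.compl_interior, mem_compl_iff, not_not, ← hρ.pos_iff] at hx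
    -- At interior points the claim is vacuous: $\rho>\rho(x)/2$ nearby, contrary to the smallness
    -- assumption.
    refine ⟨(ρ x / 2)⁻¹, ?_⟩
    filter_upwards [hρ.smooth.continuous.continuousAt.eventually_const_lt (half_lt_self hx)]
      with p hp
    refine ⟨by positivity, fun _ hlt => ?_⟩
    rw [inv_inv] at hlt
    exact absurd hlt hp.not_gt

end LocalBounds

/-! ### Finite volumes and integrability -/

section Integrability

variable {n : ℕ} {X : Type*} [TopologicalSpace X] [ChartedSpace (EuclideanHalfSpace (n + 1)) X]
  [IsManifold (𝓡∂ (n + 1)) ∞ X] [MeasurableSpace X] [BorelSpace X] (h : Metric n X) {ρ : X → ℝ}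
  [CompactSpace X]

/-- The volume `ρⁿ⁺¹ dvol_g = dvol_h` is finite. -/
theorem lintegral_pow_lt_top (hρ : IsBoundaryDefining n ρ) :
    ∫⁻ p, ENNReal.ofReal (ρ p ^ (n + 1)) ∂riemannianVolume h ρ < ⊤ := by
  have hm : Measurable fun p => ENNReal.ofReal (ρ p ^ (n + 1)) :=
    ((hρ.smooth.continuous.pow (n + 1)).measurable).ennreal_ofReal
  -- The integral becomes the mass of a measure, finite on the compact space once it is finite near
  -- each point. There the density is bounded and a coordinate ball has finite Lebesgue measure.
  rw [← setLIntegral_univ, ← withDensity_apply _ MeasurableSet.univ]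
  refine isCompact_univ.measure_lt_top_of_nhdsWithin fun x _ => ?_
  rw [nhdsWithin_univ]
  have hf := (contDiffOn_sqrt_det_coordMetric h x).continuousOn
  set z₀ := extChartAt (𝓡∂ (n + 1)) x x with hz₀
  set C := Real.sqrt (coordMetric h x z₀).det + 1 with hC
  have hev := eventually_le_of_continuousOn_target hf (lt_add_one _)
  have hball : ∀ᶠ p in 𝓝 x, extChartAt (𝓡∂ (n + 1)) x p ∈ Metric.ball z₀ 1 :=
    (continuousAt_extChartAt (I := 𝓡∂ (n + 1)) x).eventually (Metric.ball_mem_nhds _ one_pos)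
  obtain ⟨N, hN, hNo, hxN⟩ := eventually_nhds_iff.1
    ((hev.and hball).and (extChartAt_source_mem_nhds (I := 𝓡∂ (n + 1)) x))
  refine ⟨N, hNo.mem_nhds hxN, ?_⟩
  rw [withDensity_apply _ hNo.measurableSet,
    lintegral_source_eq_chart h hρ hm hNo.measurableSet fun p hp => (hN p hp).2]
  have hA : MeasurableSet (chartInterior n x ∩ (extChartAt (𝓡∂ (n + 1)) x).symm ⁻¹' N) :=
    measurableSet_inter_preimage_of_continuousOn (continuousOn_symm_chartInterior x)
      (isOpen_chartInterior x).measurableSet hNo.measurableSet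
  calc _ ≤ ∫⁻ z in chartInterior n x ∩ (extChartAt (𝓡∂ (n + 1)) x).symm ⁻¹' N,
        ENNReal.ofReal C := by
        refine setLIntegral_mono' hA fun z hz => ?_
        rw [← ENNReal.ofReal_mul (Real.sqrt_nonneg _), sqrt_det_gram h hρ hz.1]
        refine ENNReal.ofReal_le_ofReal ?_
        have hp := hρ.symm_pos hz.1
        have h1 := ((hN _ hz.2).1.1).le
        rw [extChartAt_right_inv hz.1] at h1
        refine le_trans (le_of_eq ?_) h1
        field_simp
    _ ≤ ∫⁻ z in Metric.ball z₀ 1, ENNReal.ofReal C := by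
        refine lintegral_mono_set fun z hz => ?_
        have := (hN _ hz.2).1.2
        rwa [extChartAt_right_inv hz.1] at this
    _ < ⊤ := by
        rw [setLIntegral_const]
        exact ENNReal.mul_lt_top ENNReal.ofReal_lt_top measure_ball_lt_top

theorem integrable_pow (hρ : IsBoundaryDefining n ρ) :
    Integrable (fun p => ρ p ^ (n + 1)) (riemannianVolume h ρ) := by
  refine ⟨(hρ.smooth.continuous.pow (n + 1)).aestronglyMeasurable, ?_⟩
  rw [hasFiniteIntegral_iff_ofReal (ae_of_all _ fun p => pow_nonneg (hρ.nonneg p) _)]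
  exact lintegral_pow_lt_top h hρ

/-- Markov's inequality for the integrable function $\rho^{n+1}$. -/
theorem riemannianVolume_ge_lt_top (hρ : IsBoundaryDefining n ρ) {δ : ℝ} (hδ : 0 < δ) :
    riemannianVolume h ρ {p | δ ≤ ρ p} < ⊤ := by
  have := (integrable_pow h hρ).measure_norm_ge_lt_top (ε := δ ^ (n + 1)) (by positivity)
  refine (measure_mono fun p hp => ?_).trans_lt this
  rw [mem_ofPred_eq, Real.norm_of_nonneg (pow_nonneg (hρ.nonneg p) _)]
  exact pow_le_pow_left₀ hδ.le hp _

/-- $\{\rho\ge\delta\}$ is compact, lies in the interior and has finite volume, so continuous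
functions on it are bounded and integrable. -/
theorem integrable_of_vanish {F : Type*} [NormedAddCommGroup F] [SecondCountableTopology F]
    (hρ : IsBoundaryDefining n ρ) {f : X → F}
    (hf : ContinuousOn f ((𝓡∂ (n + 1)).interior X)) {δ : ℝ} (hδ : 0 < δ)
    (h0 : ∀ p, ρ p < δ → f p = 0) : Integrable f (riemannianVolume h ρ) := by
  obtain ⟨C, hC⟩ := (isCompact_ge hρ δ).exists_bound_of_continuousOn
    (hf.mono fun p (hp : δ ≤ ρ p) => hρ.pos_iff.1 (hδ.trans_le hp))
  have hm : MeasurableSet {p | δ ≤ ρ p} :=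
    (isClosed_le continuous_const hρ.smooth.continuous).measurableSet
  refine (integrableOn_iff_integrable_of_support_subset (s := {p | δ ≤ ρ p}) fun p hp => ?_).1 ?_
  · by_contra hlt
    exact hp (h0 p (not_le.1 hlt))
  · exact IntegrableOn.of_bound (riemannianVolume_ge_lt_top h hρ hδ)
      (aestronglyMeasurable_of_continuousOn h hf).restrict C
      ((ae_restrict_iff' hm).2 (ae_of_all _ hC))

end Integrability

/-! ### The global weak equation and the divergence of the gradient of `ρ` -/

section WeakGlobal

variable {n : ℕ} {X : Type*} [TopologicalSpace X] [ChartedSpace (EuclideanHalfSpace (n + 1)) X]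

/-- Test functions: `C¹` on the interior and zero near the boundary. -/
structure IsTest (n : ℕ) {X : Type*} [TopologicalSpace X]
    [ChartedSpace (EuclideanHalfSpace (n + 1)) X] (ρ : X → ℝ) (φ : X → ℂ) : Prop where
  smooth : SmoothInside n 1 φ
  vanish : ∃ δ, 0 < δ ∧ ∀ p, ρ p < δ → φ p = 0

variable [IsManifold (𝓡∂ (n + 1)) ∞ X]

theorem covec_sum {ι : Type*} (s : Finset ι) {f : ι → X → ℂ}
    (hf : ∀ i ∈ s, SmoothInside n 1 (f i)) {p : X} (hp : p ∈ (𝓡∂ (n + 1)).interior X) :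
    covec n (fun q => ∑ i ∈ s, f i q) p = ∑ i ∈ s, covec n (f i) p :=
  fderiv_fun_sum fun i hi => (hf i hi).differentiableAt_chart (self_mem_chartInterior hp)

theorem cometric_sum_right {M : Matrix (Fin (n + 1)) (Fin (n + 1)) ℝ} {ι : Type*} (s : Finset ι)
    (α : Coord n →L[ℝ] ℂ) (β : ι → Coord n →L[ℝ] ℂ) :
    cometric M α (∑ i ∈ s, β i) = ∑ i ∈ s, cometric M α (β i) := by
  classical
  induction s using Finset.induction_on with
  | empty => simp [cometric_zero_right]
  | insert i s hi ih => rw [Finset.sum_insert hi, Finset.sum_insert hi, cometric_add_right, ih]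

theorem exists_chart_partition (n : ℕ) (X : Type*) [TopologicalSpace X]
    [ChartedSpace (EuclideanHalfSpace (n + 1)) X] [IsManifold (𝓡∂ (n + 1)) ∞ X] [CompactSpace X]
    [T2Space X] :
    ∃ (t : Finset X) (ψ : X → X → ℝ), (∀ x ∈ t, ContMDiff (𝓡∂ (n + 1)) 𝓘(ℝ, ℝ) ∞ (ψ x)) ∧
      (∀ x ∈ t, tsupport (ψ x) ⊆ (extChartAt (𝓡∂ (n + 1)) x).source) ∧
      (∀ x ∈ t, ∀ p, 0 ≤ ψ x p) ∧ ∀ p, ∑ x ∈ t, ψ x p = 1 := by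
  classical
  obtain ⟨t, ht⟩ := isCompact_univ.elim_finite_subcover
    (fun x : X => (extChartAt (𝓡∂ (n + 1)) x).source) (fun x => isOpen_extChartAt_source x)
    fun x _ => mem_iUnion.2 ⟨x, mem_extChartAt_source x⟩
  obtain ⟨f, hf⟩ := SmoothPartitionOfUnity.exists_isSubordinate (𝓡∂ (n + 1)) isClosed_univ
    (fun i : t => (extChartAt (𝓡∂ (n + 1)) (i : X)).source)
    (fun i => isOpen_extChartAt_source _) (fun p hp => by
      obtain ⟨x, hx, hpx⟩ := mem_iUnion₂.1 (ht hp)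
      exact mem_iUnion.2 ⟨⟨x, hx⟩, hpx⟩)
  -- The functions are indexed by all points, with value zero off `t`, so that sums run over a
  -- `Finset X`.
  refine ⟨t, fun x => if hx : x ∈ t then f ⟨x, hx⟩ else 0, fun x hx => ?_, fun x hx => ?_,
    fun x hx p => ?_, fun p => ?_⟩
  · simp only [dif_pos hx]
    exact (f ⟨x, hx⟩).contMDiff
  · simp only [dif_pos hx]
    exact hf ⟨x, hx⟩
  · simp only [dif_pos hx]
    exact f.nonneg _ _
  · have h1 := f.sum_eq_one (mem_univ p)
    rw [finsum_eq_sum_of_fintype] at h1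
    rw [← h1, ← Finset.sum_attach]
    exact Finset.sum_congr rfl fun i _ => by simp

variable (h : Metric n X) {ρ : X → ℝ} [MeasurableSpace X] [BorelSpace X] [CompactSpace X]

theorem integrable_pairing (hρ : IsBoundaryDefining n ρ) {a φ : X → ℂ} (ha : SmoothInside n 1 a)
    (hφ : IsTest n ρ φ) {b : X → ℂ} (hb : ContinuousOn b ((𝓡∂ (n + 1)).interior X)) :
    Integrable (fun p => b p * pairing h ρ a φ p) (riemannianVolume h ρ) := by
  obtain ⟨δ, hδ, h0⟩ := hφ.vanish
  refine integrable_of_vanish h hρ (hb.mul (continuousOn_pairing h hρ ha hφ.smooth)) hδ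
    fun p hp => ?_
  rw [pairing_eq_zero h ρ (isClosed_le continuous_const hρ.smooth.continuous)
    (K := {p | δ ≤ ρ p}) (fun p hp => h0 p (not_le.1 hp)) (not_le.2 hp), mul_zero]

/-- Integrals of a pairing, localized by a partition of unity. -/
theorem sum_partition_pairing (hρ : IsBoundaryDefining n ρ) {a φ : X → ℂ}
    (ha : SmoothInside n 1 a) (hφ : IsTest n ρ φ) {b : X → ℂ}
    (hb : ContinuousOn b ((𝓡∂ (n + 1)).interior X)) {t : Finset X} {ψ : X → X → ℝ}
    (hψ : ∀ x ∈ t, ContMDiff (𝓡∂ (n + 1)) 𝓘(ℝ, ℝ) ∞ (ψ x)) (hsum : ∀ p, ∑ x ∈ t, ψ x p = 1) :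
    ∫ p, b p * pairing h ρ a φ p ∂riemannianVolume h ρ =
      ∑ x ∈ t, ∫ p, b p * pairing h ρ a (fun q => (ψ x q : ℂ) * φ q) p ∂riemannianVolume h ρ := by
  have hs : ∀ x ∈ t, SmoothInside n 1 fun q => (ψ x q : ℂ) * φ q := fun x hx =>
    SmoothInside.mul (((Complex.ofRealCLM.contDiff.contMDiff (n := ∞)).comp
      (hψ x hx)).contMDiffOn.of_le (by norm_cast)) hφ.smooth
  have htest : ∀ x ∈ t, IsTest n ρ fun q => (ψ x q : ℂ) * φ q := fun x hx => by
    obtain ⟨δ, hδ, h0⟩ := hφ.vanish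
    exact ⟨hs x hx, δ, hδ, fun p hp => by rw [h0 p hp, mul_zero]⟩
  rw [← integral_finsetSum _ fun x hx => integrable_pairing h hρ ha (htest x hx) hb]
  refine integral_congr_ae ?_
  filter_upwards [ae_mem_interior h] with p hp
  rw [← Finset.mul_sum]
  congr 1
  have hφe : φ = fun q => ∑ x ∈ t, (ψ x q : ℂ) * φ q := by
    ext q
    rw [← Finset.sum_mul, ← Complex.ofReal_sum, hsum, Complex.ofReal_one, one_mul]
  conv_lhs => rw [hφe]
  simp only [pairing]
  rw [covec_sum t hs hp, cometric_sum_right]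

variable [T2Space X]

/-- The weak equation of an eigensolution. -/
theorem IsEigensolution.integral_pairing {h : Metric n X} (hρ : IsBoundaryDefining n ρ)
    {μ : ℂ} {u : X → ℂ} (hu : IsEigensolution h ρ μ u) {φ : X → ℂ} (hφ : IsTest n ρ φ) :
    ∫ p, pairing h ρ u φ p ∂riemannianVolume h ρ =
      ∫ p, μ * u p * φ p ∂riemannianVolume h ρ := by
  obtain ⟨t, ψ, hψ, hsupp, _, hsum⟩ := exists_chart_partition n X
  have hu1 : SmoothInside n 1 u := hu.contMDiffOn.of_le (by norm_num)
  obtain ⟨δ, hδ, h0⟩ := hφ.vanish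
  have hs : ∀ x ∈ t, SmoothInside n 1 fun q => (ψ x q : ℂ) * φ q := fun x hx =>
    SmoothInside.mul (((Complex.ofRealCLM.contDiff.contMDiff (n := ∞)).comp
      (hψ x hx)).contMDiffOn.of_le (by norm_cast)) hφ.smooth
  have h1 := sum_partition_pairing h hρ hu1 hφ (b := fun _ => 1) continuousOn_const hψ hsum
  simp only [one_mul] at h1
  have hint : ∀ x ∈ t, Integrable (fun p => μ * u p * ((ψ x p : ℂ) * φ p))
      (riemannianVolume h ρ) := fun x hx =>
    integrable_of_vanish h hρ ((continuousOn_const.mul hu1.continuousOn).mul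
      (hs x hx).continuousOn) hδ fun p hp => by simp [h0 p hp]
  have h2 : ∫ p, μ * u p * φ p ∂riemannianVolume h ρ =
      ∑ x ∈ t, ∫ p, μ * u p * ((ψ x p : ℂ) * φ p) ∂riemannianVolume h ρ := by
    rw [← integral_finsetSum _ hint]
    refine integral_congr_ae (ae_of_all _ fun p => ?_)
    simp only
    rw [← Finset.mul_sum, ← Finset.sum_mul, ← Complex.ofReal_sum, hsum, Complex.ofReal_one,
      one_mul]
  rw [h1, h2]
  refine Finset.sum_congr rfl fun x hx => ?_
  refine hu.integral_pairing_chart hρ (hs x hx) (x := x) (K := tsupport (ψ x) ∩ {p | δ ≤ ρ p})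
    ((isCompact_ge hρ δ).inter_left (isClosed_tsupport _)) (fun p hp => ?_) fun p hp => ?_
  · exact ⟨hsupp x hx hp.1, hρ.pos_iff.1 (hδ.trans_le hp.2)⟩
  · by_cases h' : p ∈ tsupport (ψ x)
    · rw [h0 p (not_le.1 fun h'' => hp ⟨h', h''⟩), mul_zero]
    · rw [image_eq_zero_of_notMem_tsupport h', Complex.ofReal_zero, zero_mul]

/-- The weak bound on the divergence of the gradient of `ρ`, in a chart. -/
theorem exists_chart_divergence_bound (hρ : IsBoundaryDefining n ρ) (x : X) {K₀ : Set X}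
    (hK₀ : IsCompact K₀) (hK₀s : K₀ ⊆ (extChartAt (𝓡∂ (n + 1)) x).source) :
    ∃ C, 0 ≤ C ∧ ∀ φ : X → ℂ, SmoothInside n 1 φ → ∀ K, IsCompact K → K ⊆ K₀ →
      K ⊆ (𝓡∂ (n + 1)).interior X → (∀ p, p ∉ K → φ p = 0) →
      ‖∫ p, (ρ p : ℂ) ^ n * (ρ p : ℂ)⁻¹ * pairing h ρ (fun q => (ρ q : ℂ)) φ p
        ∂riemannianVolume h ρ‖ ≤ C * ∫ p, ρ p ^ (n + 1) * ‖φ p‖ ∂riemannianVolume h ρ := by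
  set T := (extChartAt (𝓡∂ (n + 1)) x).target with hT
  -- `Y` is $\sqrt{\det h}\,\nabla_h\rho$. The weight $\rho^{n-1}$, the factor $\rho^2$ of the dual
  -- metric and $\rho^{-(n+1)}$ of the volume cancel exactly, so no singular factor remains. The
  -- weight appears as $\rho^n\rho^{-1}$ to cover $n=0$.
  set Y : Fin (n + 1) → Coord n → ℂ := fun i z => ∑ j,
    ((Real.sqrt (coordMetric h x z).det * (coordMetric h x z)⁻¹ i j : ℝ) : ℂ) *
      chartDiff n x (fun q => (ρ q : ℂ)) z (stdVec j) with hY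
  have hYs : ∀ i, ContDiffOn ℝ ∞ (Y i) T := fun i => ContDiffOn.sum fun j _ =>
    (Complex.ofRealCLM.contDiff.comp_contDiffOn ((contDiffOn_sqrt_det_coordMetric h x).mul
      (contDiffOn_coordMetric_inv h x i j))).mul
      ((contDiffOn_chartDiff hρ.contMDiff_complex).clm_apply contDiffOn_const)
  set D : Coord n → ℂ := fun z => ∑ i, fderivWithin ℝ (Y i) T z (stdVec i) with hD
  have hDc : ContinuousOn D T := continuousOn_finsetSum _ fun i _ =>
    ((hYs i).continuousOn_fderivWithin (uniqueDiffOn_extChartAt_target x) (by simp)).clm_apply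
      continuousOn_const
  have hsc := (contDiffOn_sqrt_det_coordMetric h x).continuousOn
  have hspos : ∀ z ∈ T, 0 < Real.sqrt (coordMetric h x z).det := fun z hz =>
    Real.sqrt_pos.2 (posDef_coordMetric h x hz).det_pos
  have hKT : extChartAt (𝓡∂ (n + 1)) x '' K₀ ⊆ T := by
    rintro _ ⟨p, hp, rfl⟩
    exact (extChartAt (𝓡∂ (n + 1)) x).map_source (hK₀s hp)
  have hK' : IsCompact (extChartAt (𝓡∂ (n + 1)) x '' K₀) :=
    hK₀.image_of_continuousOn ((continuousOn_extChartAt (I := 𝓡∂ (n + 1)) x).mono hK₀s)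
  -- `D` is continuous up to the boundary, hence bounded over `K₀`, which is fixed before `φ`.
  -- Division by $\sqrt{\det h}$ makes the bound one against
  -- $d\mathrm{vol}_h=\rho^{n+1}d\mathrm{vol}_g$.
  obtain ⟨C, hC⟩ := hK'.exists_bound_of_continuousOn
    ((hDc.norm.div hsc fun z hz => (hspos z hz).ne').mono hKT)
  refine ⟨max C 0, le_max_right _ _, fun φ hφ K hK hKK₀ hKi h0 => ?_⟩
  have hKs : K ⊆ (extChartAt (𝓡∂ (n + 1)) x).source ∩ (𝓡∂ (n + 1)).interior X := fun p hp =>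
    ⟨hK₀s (hKK₀ hp), hKi hp⟩
  have hout : ∀ p, p ∉ (extChartAt (𝓡∂ (n + 1)) x).source → p ∉ K := fun p hp h' =>
    hp (hKs h').1
  obtain ⟨c1, c2, c3⟩ := chartExtend_spec hφ hK hKs h0
  set Φ := chartExtend n x φ with hΦ
  have hρi : ContinuousOn (fun p => (ρ p : ℂ)⁻¹) ((𝓡∂ (n + 1)).interior X) :=
    hρ.smoothInside.continuousOn.inv₀ fun p hp =>
      Complex.ofReal_ne_zero.2 (hρ.pos_iff.2 hp).ne'
  rw [integral_eq_chart h hρ (x := x) (f := fun p => (ρ p : ℂ) ^ n * (ρ p : ℂ)⁻¹ *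
      pairing h ρ (fun q => (ρ q : ℂ)) φ p)
    (((hρ.smoothInside.continuousOn.pow n).mul hρi).mul
      (continuousOn_pairing h hρ hρ.smoothInside hφ))
    fun p hp => by rw [pairing_eq_zero h ρ hK.isClosed h0 (hout p hp), mul_zero]]
  have hint : ∫ p, ρ p ^ (n + 1) * ‖φ p‖ ∂riemannianVolume h ρ =
      ∫ z in chartInterior n x, Real.sqrt (coordMetric h x z).det * ‖Φ z‖ := by
    have e := integral_eq_chart h hρ (x := x)
      (f := fun p => ((ρ p ^ (n + 1) * ‖φ p‖ : ℝ) : ℂ))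
      (Complex.continuous_ofReal.comp_continuousOn
        ((hρ.smooth.continuous.continuousOn.pow (n + 1)).mul hφ.continuousOn.norm))
      fun p hp => by rw [h0 p (hout p hp)]; simp
    rw [integral_complex_ofReal] at e
    simp only [← Complex.ofReal_mul] at e
    rw [integral_complex_ofReal] at e
    rw [Complex.ofReal_injective e]
    refine setIntegral_congr_fun (isOpen_chartInterior x).measurableSet fun z hz => ?_
    have hp := hρ.symm_pos hz
    rw [sqrt_det_gram h hρ hz, hΦ, chartExtend, indicator_of_mem hz, Function.comp_apply]
    field_simp
  have e1 : ∫ z in chartInterior n x, (Real.sqrt (gram h ρ x z).det : ℂ) *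
      ((ρ ((extChartAt (𝓡∂ (n + 1)) x).symm z) : ℂ) ^ n *
        (ρ ((extChartAt (𝓡∂ (n + 1)) x).symm z) : ℂ)⁻¹ *
        pairing h ρ (fun q => (ρ q : ℂ)) φ ((extChartAt (𝓡∂ (n + 1)) x).symm z)) =
      ∫ z in chartInterior n x, ∑ i, Y i z * fderiv ℝ Φ z (stdVec i) := by
    refine setIntegral_congr_fun (isOpen_chartInterior x).measurableSet fun z hz => ?_
    have hp : (ρ ((extChartAt (𝓡∂ (n + 1)) x).symm z) : ℂ) ≠ 0 :=
      Complex.ofReal_ne_zero.2 (hρ.symm_pos hz).ne'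
    rw [pairing_eq_chartPairing h hρ hρ.smoothInside hφ (symm_mem_interior hz)
      (chartInterior_symm_mem_source hz), extChartAt_right_inv hz, chartDiff_eq (a := φ) hz,
      hΦ, (chartExtend_eqOn hz).fderiv_eq, sqrt_det_gram h hρ hz,
      cometric_comm (posDef_coordMetric h x (chartInterior_subset_target x hz)).1]
    simp only [cometric, hY, Finset.mul_sum, Finset.sum_mul]
    refine Finset.sum_congr rfl fun i _ => Finset.sum_congr rfl fun j _ => ?_
    push_cast
    field_simp
    ring
  rw [e1, integral_div_pairing (isOpen_chartInterior x)
    (fun i => ((hYs i).mono (chartInterior_subset_target x)).of_le (by norm_cast)) c1 c2 c3,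
    norm_neg, hint, ← integral_const_mul]
  refine norm_integral_le_of_norm_le ?_ ?_
  · refine ((integrable_of_continuousOn_of_zero c2 c3
      ((hsc.mono (chartInterior_subset_target x)).mul c1.continuous.norm.continuousOn)
      fun z hz => ?_).const_mul _).integrableOn
    simp [image_eq_zero_of_notMem_tsupport hz]
  · refine (ae_restrict_iff' (isOpen_chartInterior x).measurableSet).2 (ae_of_all _ fun z hz => ?_)
    have hDz : ∑ i, fderiv ℝ (Y i) z (stdVec i) = D z := by
      simp only [hD]
      exact Finset.sum_congr rfl fun i _ => by rw [fderivWithin_of_mem_nhds (target_mem_nhds hz)]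
    rw [hDz, norm_mul, ← mul_assoc]
    by_cases hzK : (extChartAt (𝓡∂ (n + 1)) x).symm z ∈ K
    · have hzK₀ : z ∈ extChartAt (𝓡∂ (n + 1)) x '' K₀ :=
        ⟨_, hKK₀ hzK, extChartAt_right_inv hz⟩
      have := hC z hzK₀
      have hsp := hspos z (chartInterior_subset_target x hz)
      rw [Pi.div_apply, norm_div, norm_norm, Real.norm_of_nonneg hsp.le, div_le_iff₀ hsp] at this
      gcongr
      exact this.trans (by gcongr; exact le_max_left _ _)
    · have : Φ z = 0 := by
        rw [hΦ, chartExtend, indicator_of_mem hz, Function.comp_apply, h0 _ hzK]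
      simp [this]

/-- The weak bound on the divergence of the gradient of `ρ`. -/
theorem exists_divergence_bound (hρ : IsBoundaryDefining n ρ) :
    ∃ C, 0 ≤ C ∧ ∀ φ : X → ℂ, IsTest n ρ φ →
      ‖∫ p, (ρ p : ℂ) ^ n * (ρ p : ℂ)⁻¹ * pairing h ρ (fun q => (ρ q : ℂ)) φ p
        ∂riemannianVolume h ρ‖ ≤ C * ∫ p, ρ p ^ (n + 1) * ‖φ p‖ ∂riemannianVolume h ρ := by
  obtain ⟨t, ψ, hψ, hsupp, hnn, hsum⟩ := exists_chart_partition n X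
  have hloc : ∀ x : t, _ := fun x => exists_chart_divergence_bound h hρ (x : X)
    (isClosed_tsupport (ψ x)).isCompact (hsupp x x.2)
  choose C hC0 hC using hloc
  classical
  refine ⟨∑ x : t, C x, Finset.sum_nonneg fun x _ => hC0 x, fun φ hφ => ?_⟩
  have hs : ∀ x ∈ t, SmoothInside n 1 fun q => (ψ x q : ℂ) * φ q := fun x hx =>
    SmoothInside.mul (((Complex.ofRealCLM.contDiff.contMDiff (n := ∞)).comp
      (hψ x hx)).contMDiffOn.of_le (by norm_cast)) hφ.smooth
  obtain ⟨δ, hδ, h0⟩ := hφ.vanish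
  have hρi : ContinuousOn (fun p => (ρ p : ℂ)⁻¹) ((𝓡∂ (n + 1)).interior X) :=
    hρ.smoothInside.continuousOn.inv₀ fun p hp =>
      Complex.ofReal_ne_zero.2 (hρ.pos_iff.2 hp).ne'
  rw [sum_partition_pairing h hρ hρ.smoothInside hφ
    (b := fun p => (ρ p : ℂ) ^ n * (ρ p : ℂ)⁻¹)
    ((hρ.smoothInside.continuousOn.pow n).mul hρi) hψ hsum, ← Finset.sum_attach, Finset.sum_mul]
  refine norm_sum_le_of_le _ fun x _ => ?_
  refine (hC x _ (hs x x.2) (tsupport (ψ x) ∩ {p | δ ≤ ρ p})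
    ((isCompact_ge hρ δ).inter_left (isClosed_tsupport _)) inter_subset_left
    (fun p hp => hρ.pos_iff.1 (hδ.trans_le hp.2)) fun p hp => ?_).trans ?_
  · by_cases h' : p ∈ tsupport (ψ x)
    · rw [h0 p (not_le.1 fun h'' => hp ⟨h', h''⟩), mul_zero]
    · rw [image_eq_zero_of_notMem_tsupport h', Complex.ofReal_zero, zero_mul]
  · refine mul_le_mul_of_nonneg_left (integral_mono_of_nonneg (ae_of_all _ fun p => ?_) ?_
      (ae_of_all _ fun p => ?_)) (hC0 x)
    · exact mul_nonneg (pow_nonneg (hρ.nonneg p) _) (norm_nonneg _)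
    · exact integrable_of_vanish h hρ ((hρ.smooth.continuous.continuousOn.pow (n + 1)).mul
        hφ.smooth.continuousOn.norm) hδ fun p hp => by simp [h0 p hp]
    · refine mul_le_mul_of_nonneg_left ?_ (pow_nonneg (hρ.nonneg p) _)
      rw [norm_mul, Complex.norm_real, Real.norm_of_nonneg (hnn x x.2 p)]
      refine mul_le_of_le_one_left (norm_nonneg _) ?_
      rw [← hsum p]
      exact Finset.single_le_sum (f := fun y => ψ y p) (fun y hy => hnn y hy p) x.2

end WeakGlobal

/-! ### Product rule, chain rule and Cauchy–Schwarz for the pairing -/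

section PairingRules

theorem conjCovec_ofReal {n : ℕ} {X : Type*} [TopologicalSpace X]
    [ChartedSpace (EuclideanHalfSpace (n + 1)) X] (ρ : X → ℝ) (p : X) :
    conjCovec (covec n (fun q => (ρ q : ℂ)) p) = covec n (fun q => (ρ q : ℂ)) p := by
  rw [← covec_conj]
  simp only [Complex.conj_ofReal]

variable {n : ℕ} {X : Type*} [TopologicalSpace X] [ChartedSpace (EuclideanHalfSpace (n + 1)) X]
  [IsManifold (𝓡∂ (n + 1)) ∞ X] {h : Metric n X} {ρ : X → ℝ} {p : X} {a b c : X → ℂ}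

theorem pairing_comm (hρ : IsBoundaryDefining n ρ) (hp : p ∈ (𝓡∂ (n + 1)).interior X)
    (a b : X → ℂ) : pairing h ρ a b p = pairing h ρ b a p :=
  cometric_comm (posDef_gram h hρ (self_mem_chartInterior hp)).1 _ _

theorem pairing_add_right (hb : SmoothInside n 1 b) (hc : SmoothInside n 1 c)
    (hp : p ∈ (𝓡∂ (n + 1)).interior X) (a : X → ℂ) :
    pairing h ρ a (fun q => b q + c q) p = pairing h ρ a b p + pairing h ρ a c p := by
  rw [pairing, covec_add hb hc hp, cometric_add_right]; rfl

theorem pairing_mul_right (hb : SmoothInside n 1 b) (hc : SmoothInside n 1 c)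
    (hp : p ∈ (𝓡∂ (n + 1)).interior X) (a : X → ℂ) :
    pairing h ρ a (fun q => b q * c q) p =
      b p * pairing h ρ a c p + c p * pairing h ρ a b p := by
  rw [pairing, covec_mul hb hc hp, cometric_add_right, cometric_smul_right, cometric_smul_right]
  rfl

theorem pairing_comp_right (hρ : IsBoundaryDefining n ρ) {k : ℝ → ℂ} {k' : ℂ}
    (hk : HasDerivAt k k' (ρ p)) (hp : p ∈ (𝓡∂ (n + 1)).interior X) (a : X → ℂ) :
    pairing h ρ a (fun q => k (ρ q)) p = k' * pairing h ρ a (fun q => (ρ q : ℂ)) p := by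
  rw [pairing, covec_comp_real hk hρ.smoothInside hp, cometric_smul_right]; rfl

theorem pairing_conj_self_im (hρ : IsBoundaryDefining n ρ) (hp : p ∈ (𝓡∂ (n + 1)).interior X)
    (a : X → ℂ) : (pairing h ρ a (fun q => (starRingEnd ℂ) (a q)) p).im = 0 := by
  rw [pairing, covec_conj]
  exact cometric_conj_self_im (posDef_gram h hρ (self_mem_chartInterior hp)) _

theorem pairing_conj_self_re_nonneg (hρ : IsBoundaryDefining n ρ)
    (hp : p ∈ (𝓡∂ (n + 1)).interior X) (a : X → ℂ) :
    0 ≤ (pairing h ρ a (fun q => (starRingEnd ℂ) (a q)) p).re := by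
  rw [pairing, covec_conj]
  exact cometric_conj_self_re_nonneg (posDef_gram h hρ (self_mem_chartInterior hp)) _

theorem pairing_defining_im (hρ : IsBoundaryDefining n ρ) (hp : p ∈ (𝓡∂ (n + 1)).interior X) :
    (pairing h ρ (fun q => (ρ q : ℂ)) (fun q => (ρ q : ℂ)) p).im = 0 := by
  have := pairing_conj_self_im (h := h) hρ hp fun q => (ρ q : ℂ)
  simpa only [Complex.conj_ofReal] using this

theorem pairing_defining_re_nonneg (hρ : IsBoundaryDefining n ρ)
    (hp : p ∈ (𝓡∂ (n + 1)).interior X) :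
    0 ≤ (pairing h ρ (fun q => (ρ q : ℂ)) (fun q => (ρ q : ℂ)) p).re := by
  have := pairing_conj_self_re_nonneg (h := h) hρ hp fun q => (ρ q : ℂ)
  simpa only [Complex.conj_ofReal] using this

/-- The additive inequality for all real $t$ is a nonnegative quadratic, so its discriminant is not
positive; $|d\rho|_g=0$ is allowed. -/
theorem norm_pairing_sq_le (hρ : IsBoundaryDefining n ρ) (hp : p ∈ (𝓡∂ (n + 1)).interior X)
    (a : X → ℂ) : ‖pairing h ρ a (fun q => (ρ q : ℂ)) p‖ ^ 2 ≤
      (pairing h ρ a (fun q => (starRingEnd ℂ) (a q)) p).re *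
        (pairing h ρ (fun q => (ρ q : ℂ)) (fun q => (ρ q : ℂ)) p).re := by
  set G := (pairing h ρ a (fun q => (starRingEnd ℂ) (a q)) p).re with hG
  set Q := (pairing h ρ (fun q => (ρ q : ℂ)) (fun q => (ρ q : ℂ)) p).re with hQ
  set b := ‖pairing h ρ a (fun q => (ρ q : ℂ)) p‖ with hb
  have key : ∀ t : ℝ, 0 ≤ Q * (t * t) + (-2 * b) * t + G := fun t => by
    have := two_mul_norm_cometric_le (posDef_gram h hρ (self_mem_chartInterior hp))
      (covec n a p) (covec n (fun q => (ρ q : ℂ)) p) (conjCovec_ofReal ρ p) t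
    rw [← covec_conj] at this
    change 2 * t * b ≤ G + t ^ 2 * Q at this
    linarith
  have := discrim_le_zero key
  rw [discrim] at this
  linarith

end PairingRules

/-! ### Cutoff functions of one variable -/

section Cutoff

/-- `β` is a bump and `χ` its primitive. $\chi(\rho/\delta)$ vanishes near the boundary only, which
suffices for a test function, and its differential $\delta^{-1}\beta(\rho/\delta)\,d\rho$ averages
over a shell. -/
theorem exists_cutoff {a b : ℝ} (ha : 0 < a) (hab : a < b) :
    ∃ χ β : ℝ → ℝ, ContDiff ℝ ∞ β ∧ (∀ t, HasDerivAt χ (β t) t) ∧ (∀ t, 0 ≤ β t) ∧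
      (∀ t, β t ≤ 1) ∧ (∀ t ∈ Icc a b, β t = 1) ∧ (∀ t, t ∉ Ioo (a / 2) (2 * b) → β t = 0) ∧
      (∀ t, t ∉ Icc (a / 2) (2 * b) → deriv β t = 0) ∧ (∀ t, t ≤ a / 2 → χ t = 0) ∧
      ∃ C, 0 < C ∧ ∀ t, |deriv β t| ≤ C ∧ |χ t| ≤ C := by
  -- The inner ball is exactly $[a,b]$. The outer one runs from $a/2$ to $b+a/2<2b$.
  let f : ContDiffBump ((a + b) / 2 : ℝ) :=
    { rIn := (b - a) / 2, rOut := b / 2, rIn_pos := by linarith, rIn_lt_rOut := by linarith }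
  have hf0 : ∀ t, t ∉ Ioo (a / 2) (2 * b) → f t = 0 := fun t ht => by
    refine f.zero_of_le_dist ?_
    rw [Real.dist_eq]
    by_contra hlt
    have := abs_lt.1 (not_le.1 hlt)
    have h1 : f.rOut = b / 2 := rfl
    rw [h1] at this
    exact ht ⟨by linarith [this.1], by linarith [this.2]⟩
  have hfs : ContDiff ℝ ∞ f := f.contDiff
  have hfc : HasCompactSupport f := f.hasCompactSupport
  have hfi : Integrable f := f.continuous.integrable_of_hasCompactSupport hfc
  obtain ⟨C, hC⟩ := (hfs.continuous_deriv (by simp)).bounded_above_of_compact_support hfc.deriv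
  refine ⟨fun t => ∫ s in (0 : ℝ)..t, f s, f, hfs, fun t =>
    (f.continuous.integral_hasStrictDerivAt 0 t).hasDerivAt, fun t => f.nonneg,
    fun t => f.le_one, fun t ht => ?_, hf0, fun t ht => ?_, fun t ht => ?_,
    max C (∫ s, ‖f s‖) + 1, ?_, fun t => ⟨?_, ?_⟩⟩
  · refine f.one_of_mem_closedBall ?_
    rw [Metric.mem_closedBall, Real.dist_eq]
    have h1 : f.rIn = (b - a) / 2 := rfl
    rw [h1, abs_le]
    exact ⟨by linarith [ht.1], by linarith [ht.2]⟩
  · have : f =ᶠ[𝓝 t] fun _ => (0 : ℝ) := by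
      filter_upwards [isClosed_Icc.isOpen_compl.mem_nhds ht] with s hs
      exact hf0 s fun h' => hs (Ioo_subset_Icc_self h')
    rw [this.deriv_eq, deriv_const]
  · refine (intervalIntegral.integral_congr (g := fun _ => 0) fun s hs => hf0 s ?_).trans (by simp)
    rintro ⟨h1, -⟩
    have := hs.2
    rcases le_total t 0 with h0 | h0
    · rw [sup_of_le_left h0] at this; linarith
    · rw [sup_of_le_right h0] at this; linarith
  · have : (0 : ℝ) ≤ ∫ s, ‖f s‖ := integral_nonneg fun _ => norm_nonneg _
    have := le_max_right C (∫ s, ‖f s‖)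
    linarith
  · have := hC t
    rw [Real.norm_eq_abs] at this
    linarith [le_max_left C (∫ s, ‖f s‖)]
  · have h1 := intervalIntegral.norm_integral_le_integral_norm_uIoc (f := f) (a := 0) (b := t)
      (μ := volume)
    have h2 := setIntegral_le_integral (s := uIoc 0 t) hfi.norm
      (ae_of_all _ fun s => norm_nonneg _)
    rw [Real.norm_eq_abs] at h1
    linarith [le_max_right C (∫ s, ‖f s‖)]

end Cutoff

/-! ### Volume of shells -/

section Shell

variable {n : ℕ} {X : Type*} [TopologicalSpace X] [ChartedSpace (EuclideanHalfSpace (n + 1)) X]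

theorem smoothInside_scaled {ρ : X → ℝ} (hρ : IsBoundaryDefining n ρ) {χ β : ℝ → ℝ}
    (hχ : ∀ t, HasDerivAt χ (β t) t) (hβ : Continuous β) (δ : ℝ) :
    SmoothInside n 1 fun p => ((χ (ρ p / δ) : ℝ) : ℂ) := by
  have hχ1 : ContDiff ℝ 1 χ := by
    rw [contDiff_one_iff_deriv]
    refine ⟨fun t => (hχ t).differentiableAt, ?_⟩
    rw [show deriv χ = β from funext fun t => (hχ t).deriv]
    exact hβ
  exact hρ.smoothInside_comp (fun p hp => hρ.pos_iff.2 hp)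
    (k := fun t => ((χ (t / δ) : ℝ) : ℂ)) (ContDiff.contDiffOn
      (Complex.ofRealCLM.contDiff.comp (hχ1.comp (contDiff_id.div_const δ))))

/-- The region where `ρ` lies in `[a, b]`. -/
def slab (ρ : X → ℝ) (a b : ℝ) : Set X := {p | a ≤ ρ p ∧ ρ p ≤ b}

theorem measurableSet_slab [MeasurableSpace X] [BorelSpace X] {ρ : X → ℝ}
    (hρ : IsBoundaryDefining n ρ) (a b : ℝ) : MeasurableSet (slab ρ a b) :=
  ((isClosed_le continuous_const hρ.smooth.continuous).inter
    (isClosed_le hρ.smooth.continuous continuous_const)).measurableSet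

variable [IsManifold (𝓡∂ (n + 1)) ∞ X] [MeasurableSpace X] [BorelSpace X] [CompactSpace X]
  (h : Metric n X) {ρ : X → ℝ}

theorem riemannianVolume_shell_lt_top (hρ : IsBoundaryDefining n ρ) {δ : ℝ} (hδ : 0 < δ) :
    riemannianVolume h ρ (slab ρ (δ / 16) (16 * δ)) < ⊤ :=
  (measure_mono fun _ hp => hp.1).trans_lt
    (riemannianVolume_ge_lt_top h hρ (by positivity : 0 < δ / 16))

variable [T2Space X]

/-- The volume of a shell is `O(δ⁻ⁿ)`. -/
theorem exists_shell_volume_le (hρ : IsBoundaryDefining n ρ) :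
    ∃ C, 0 < C ∧ ∃ δ₀, 0 < δ₀ ∧ ∀ δ, 0 < δ → δ < δ₀ →
      (riemannianVolume h ρ).real (slab ρ (δ / 16) (16 * δ)) * δ ^ n ≤ C := by
  obtain ⟨χ, β, hβ, hχ, hβ0, hβ1, hβe, hβs, -, hχ0, B, hB, hbd⟩ :=
    exists_cutoff (a := 1 / 16) (b := 16) (by norm_num) (by norm_num)
  obtain ⟨C, hC0, hC⟩ := exists_divergence_bound h hρ
  obtain ⟨c, hc, hcp⟩ := exists_le_pairing h hρ
  set V := riemannianVolume h ρ with hV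
  set I₀ := ∫ p, ρ p ^ (n + 1) ∂V with hI₀
  have hI₀0 : 0 ≤ I₀ := integral_nonneg fun p => pow_nonneg (hρ.nonneg p) _
  refine ⟨16 ^ (n + 1) / c * (C * (B * I₀)) + 1, by positivity, c / 32, by positivity,
    fun δ hδ hδc => ?_⟩
  -- The divergence bound is tested on $\chi(\rho/\delta)$. Its left side contains
  -- $\delta^{-1}\rho^{n-1}|d\rho|_g^2\ge c\,\delta^{-1}\rho^{n+1}$, of order $\delta^n$ on the
  -- shell, while its right side is bounded independently of $\delta$.
  set φ : X → ℂ := fun p => ((χ (ρ p / δ) : ℝ) : ℂ) with hφ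
  have hder : ∀ t, HasDerivAt (fun t => ((χ (t / δ) : ℝ) : ℂ)) ((β (t / δ) * (1 / δ) : ℝ) : ℂ) t :=
    fun t => ((hχ (t / δ)).comp t ((hasDerivAt_id t).div_const δ)).ofReal_comp
  have hφt : IsTest n ρ φ := by
    refine ⟨smoothInside_scaled hρ hχ hβ.continuous δ, δ / 32, by positivity, fun p hp => ?_⟩
    simp only [hφ]
    rw [hχ0, Complex.ofReal_zero]
    rw [div_le_iff₀ hδ]; linarith
  have hle := hC φ hφt
  set g : X → ℂ := fun p => (ρ p : ℂ) ^ n * (ρ p : ℂ)⁻¹ * pairing h ρ (fun q => (ρ q : ℂ)) φ p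
    with hg
  have hρi : ContinuousOn (fun p => (ρ p : ℂ)⁻¹) ((𝓡∂ (n + 1)).interior X) :=
    hρ.smoothInside.continuousOn.inv₀ fun p hp =>
      Complex.ofReal_ne_zero.2 (hρ.pos_iff.2 hp).ne'
  have hgi : Integrable g V := integrable_pairing h hρ hρ.smoothInside hφt
    ((hρ.smoothInside.continuousOn.pow n).mul hρi)
  have hup : ∫ p, ρ p ^ (n + 1) * ‖φ p‖ ∂V ≤ B * I₀ := by
    rw [hI₀, ← integral_const_mul]
    refine integral_mono_of_nonneg (ae_of_all _ fun p =>
      mul_nonneg (pow_nonneg (hρ.nonneg p) _) (norm_nonneg _)) ((integrable_pow h hρ).const_mul B)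
      (ae_of_all _ fun p => ?_)
    simp only [hφ, Complex.norm_real, Real.norm_eq_abs]
    rw [mul_comm]
    exact mul_le_mul_of_nonneg_right (hbd _).2 (pow_nonneg (hρ.nonneg p) _)
  have hlow : V.real (slab ρ (δ / 16) (16 * δ)) * (c * δ ^ n / 16 ^ (n + 1)) ≤ ∫ p, (g p).re ∂V := by
    rw [← smul_eq_mul, ← integral_indicator_const _ (measurableSet_slab hρ _ _)]
    refine integral_mono_ae ((integrable_indicator_iff (measurableSet_slab hρ _ _)).2
      (integrableOn_const (riemannianVolume_shell_lt_top h hρ hδ).ne)) hgi.re ?_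
    filter_upwards [ae_mem_interior h] with p hp
    have hpos := hρ.pos_iff.2 hp
    have hgp : (g p).re = ρ p ^ n * (ρ p)⁻¹ * (β (ρ p / δ) * (1 / δ)) *
        (pairing h ρ (fun q => (ρ q : ℂ)) (fun q => (ρ q : ℂ)) p).re := by
      simp only [hg, hφ]
      rw [pairing_comp_right hρ (hder (ρ p)) hp, ← Complex.re_ofReal_mul]
      push_cast
      ring_nf
    have hQ := pairing_defining_re_nonneg (h := h) hρ hp
    have hg0 : 0 ≤ (g p).re := by
      rw [hgp]
      have := hβ0 (ρ p / δ)
      positivity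
    by_cases hs : p ∈ slab ρ (δ / 16) (16 * δ)
    · rw [indicator_of_mem hs]
      refine le_trans ?_ (le_of_eq hgp.symm)
      have hb : β (ρ p / δ) = 1 := hβe _
        ⟨by rw [le_div_iff₀ hδ]; linarith [hs.1], by rw [div_le_iff₀ hδ]; linarith [hs.2]⟩
      have h1 := hcp p hp (by linarith [hs.2])
      rw [hb]
      calc c * δ ^ n / 16 ^ (n + 1) = (δ / 16) ^ (n + 1) * (c * (1 / δ)) := by
            rw [div_pow]; field_simp; ring
        _ ≤ ρ p ^ (n + 1) * (c * (1 / δ)) := by gcongr; exact hs.1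
        _ = ρ p ^ n * (ρ p)⁻¹ * (1 * (1 / δ)) * (c * ρ p ^ 2) := by
            field_simp; ring
        _ ≤ _ := by gcongr
    · rw [indicator_of_notMem hs]
      exact hg0
  have h1 : ∫ p, (g p).re ∂V ≤ C * (B * I₀) := by
    have e : ∫ p, (g p).re ∂V = (∫ p, g p ∂V).re := integral_re hgi
    rw [e]
    exact (Complex.re_le_norm _).trans (hle.trans (by gcongr))
  have h2 := hlow.trans h1
  have h3 : V.real (slab ρ (δ / 16) (16 * δ)) * δ ^ n =
      16 ^ (n + 1) / c * (V.real (slab ρ (δ / 16) (16 * δ)) * (c * δ ^ n / 16 ^ (n + 1))) := by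
    field_simp
  rw [h3]
  have : 16 ^ (n + 1) / c * (V.real (slab ρ (δ / 16) (16 * δ)) * (c * δ ^ n / 16 ^ (n + 1))) ≤
      16 ^ (n + 1) / c * (C * (B * I₀)) := by gcongr
  linarith

end Shell

/-! ### The Caccioppoli inequality on shells -/

section Energy

variable {n : ℕ} {X : Type*} [TopologicalSpace X] [ChartedSpace (EuclideanHalfSpace (n + 1)) X]
  [IsManifold (𝓡∂ (n + 1)) ∞ X] {ρ : X → ℝ}

theorem pairing_scaled {h : Metric n X} (hρ : IsBoundaryDefining n ρ) {χ β : ℝ → ℝ}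
    (hχ : ∀ t, HasDerivAt χ (β t) t) (δ : ℝ) {p : X} (hp : p ∈ (𝓡∂ (n + 1)).interior X)
    (a : X → ℂ) : pairing h ρ a (fun q => ((χ (ρ q / δ) : ℝ) : ℂ)) p =
      ((β (ρ p / δ) * (1 / δ) : ℝ) : ℂ) * pairing h ρ a (fun q => (ρ q : ℂ)) p :=
  pairing_comp_right hρ (k := fun t => ((χ (t / δ) : ℝ) : ℂ))
    (((hχ (ρ p / δ)).comp (ρ p) ((hasDerivAt_id (ρ p)).div_const δ)).ofReal_comp) hp a

variable [MeasurableSpace X] [BorelSpace X] [CompactSpace X] (h : Metric n X)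

theorem integrableOn_slab (hρ : IsBoundaryDefining n ρ) {F : Type*} [NormedAddCommGroup F]
    [SecondCountableTopology F] {f : X → F} (hf : ContinuousOn f ((𝓡∂ (n + 1)).interior X))
    {a : ℝ} (ha : 0 < a) (b : ℝ) : IntegrableOn f (slab ρ a b) (riemannianVolume h ρ) := by
  obtain ⟨C, hC⟩ := (isCompact_ge hρ a).exists_bound_of_continuousOn
    (hf.mono fun p (hp : a ≤ ρ p) => hρ.pos_iff.1 (ha.trans_le hp))
  exact IntegrableOn.of_bound ((measure_mono fun _ hp => hp.1).trans_lt
    (riemannianVolume_ge_lt_top h hρ ha)) (aestronglyMeasurable_of_continuousOn h hf).restrict C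
    ((ae_restrict_iff' (measurableSet_slab hρ a b)).2 (ae_of_all _ fun p hp => hC p hp.1))

variable [T2Space X]

/-- The energy of an eigensolution in a shell is controlled by its mass in a larger shell. -/
theorem exists_caccioppoli (hρ : IsBoundaryDefining n ρ) (μ : ℝ) :
    ∃ C, 0 < C ∧ ∀ u, IsEigensolution h ρ (μ : ℂ) u → ∀ δ, 0 < δ →
      ∫ p in slab ρ (δ / 2) (4 * δ),
        (pairing h ρ u (fun q => (starRingEnd ℂ) (u q)) p).re ∂riemannianVolume h ρ ≤
      C * ∫ p in slab ρ (δ / 16) (16 * δ), ‖u p‖ ^ 2 ∂riemannianVolume h ρ := by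
  obtain ⟨χ, η, hη, -, hη0, hη1, hηe, hηs, hηd, -, B, hB, hbd⟩ :=
    exists_cutoff (a := 1 / 2) (b := 4) (by norm_num) (by norm_num)
  obtain ⟨K, hK, hKp⟩ := exists_norm_pairing_le h hρ hρ.contMDiff_complex hρ.contMDiff_complex
  set V := riemannianVolume h ρ with hV
  have hder : ∀ t, HasDerivAt η (deriv η t) t := fun t =>
    ((hη.differentiable (by simp)) t).hasDerivAt
  refine ⟨2 * |μ| + 4 * (256 * B ^ 2 * K) + 1, by positivity, fun u hu δ hδ => ?_⟩
  have hu1 : SmoothInside n 1 u := hu.contMDiffOn.of_le (by norm_num)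
  set S := slab ρ (δ / 16) (16 * δ) with hS
  set e : X → ℂ := fun p => ((η (ρ p / δ) : ℝ) : ℂ) with he
  have hes : SmoothInside n 1 e := smoothInside_scaled hρ hder (hη.continuous_deriv (by simp)) δ
  -- The usual test function $\eta^2\bar u$; $\eta(\rho/\delta)$ is $1$ on the inner slab and
  -- supported within `S`.
  set φ : X → ℂ := fun p => e p * (e p * (starRingEnd ℂ) (u p)) with hφ
  have hzero : ∀ p, p ∉ S → η (ρ p / δ) = 0 ∧ deriv η (ρ p / δ) = 0 := fun p hp => by
    have : ρ p / δ ∉ Icc ((1 : ℝ) / 2 / 2) (2 * 4) := fun h' => hp (by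
      have h1 := (le_div_iff₀ hδ).1 h'.1
      have h2 := (div_le_iff₀ hδ).1 h'.2
      exact ⟨by linarith, by linarith⟩)
    exact ⟨hηs _ fun h' => this (Ioo_subset_Icc_self h'), hηd _ this⟩
  have hφt : IsTest n ρ φ := ⟨hes.mul (hes.mul hu1.conj), δ / 16, by positivity, fun p hp => by
    simp only [hφ, he, (hzero p fun h' => not_le.2 hp h'.1).1, Complex.ofReal_zero, zero_mul]⟩
  have hint : ∀ a b : ℝ, 0 < a → IntegrableOn (fun p => ‖u p‖ ^ 2) (slab ρ a b) V :=
    fun a b ha => integrableOn_slab h hρ (hu1.continuousOn.norm.pow 2) ha b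
  have hgi := integrable_pairing h hρ hu1 hφt (b := fun _ => 1) continuousOn_const
  simp only [one_mul] at hgi
  have hweak := hu.integral_pairing hρ hφt
  have hmS : MeasurableSet S := measurableSet_slab hρ _ _
  have hG : ∀ p ∈ (𝓡∂ (n + 1)).interior X, _ := fun p hp =>
    pairing_conj_self_re_nonneg (h := h) hρ hp u
  have hIS : Integrable (S.indicator fun p => 4 * (256 * B ^ 2 * K) * ‖u p‖ ^ 2) V :=
    IntegrableOn.integrable_indicator ((hint _ _ (by positivity)).const_mul _) hmS
  have hpt : ∫ p in slab ρ (δ / 2) (4 * δ),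
      (pairing h ρ u (fun q => (starRingEnd ℂ) (u q)) p).re ∂V ≤
      ∫ p, (2 * (pairing h ρ u φ p).re +
        S.indicator (fun p => 4 * (256 * B ^ 2 * K) * ‖u p‖ ^ 2) p) ∂V := by
    rw [← integral_indicator (measurableSet_slab hρ _ _)]
    refine integral_mono_ae ((integrableOn_slab h hρ (Complex.continuous_re.comp_continuousOn
      (continuousOn_pairing h hρ hu1 hu1.conj)) (by positivity)
      _).integrable_indicator (measurableSet_slab hρ _ _)) ((hgi.re.const_mul 2).add hIS) ?_
    filter_upwards [ae_mem_interior h] with p hp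
    have hG0 := hG p hp
    set G := (pairing h ρ u (fun q => (starRingEnd ℂ) (u q)) p).re with hGd
    have hGim := pairing_conj_self_im (h := h) hρ hp u
    have hCS := norm_pairing_sq_le (h := h) hρ hp u
    rw [← hGd] at hCS
    set A := pairing h ρ u (fun q => (ρ q : ℂ)) p with hA
    set Q := (pairing h ρ (fun q => (ρ q : ℂ)) (fun q => (ρ q : ℂ)) p).re with hQ
    have hQ0 : 0 ≤ Q := pairing_defining_re_nonneg hρ hp
    have hQK : Q ≤ K * ρ p ^ 2 := (Complex.re_le_norm _).trans (hKp p hp)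
    have hexp : (pairing h ρ u φ p).re = η (ρ p / δ) ^ 2 * G +
        2 * η (ρ p / δ) * (deriv η (ρ p / δ) * (1 / δ)) * ((starRingEnd ℂ) (u p) * A).re := by
      simp only [hφ]
      rw [pairing_mul_right hes (hes.mul hu1.conj) hp, pairing_mul_right hes hu1.conj hp,
        pairing_scaled hρ hder δ hp, ← hA]
      have e1 : pairing h ρ u (fun q => (starRingEnd ℂ) (u q)) p = (G : ℂ) :=
        Complex.ext rfl (by simpa using hGim)
      rw [e1]
      have : e p * (e p * (G : ℂ) + (starRingEnd ℂ) (u p) *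
          (((deriv η (ρ p / δ) * (1 / δ) : ℝ) : ℂ) * A)) + e p * (starRingEnd ℂ) (u p) *
          (((deriv η (ρ p / δ) * (1 / δ) : ℝ) : ℂ) * A) =
          ((η (ρ p / δ) ^ 2 * G : ℝ) : ℂ) + ((2 * η (ρ p / δ) * (deriv η (ρ p / δ) * (1 / δ)) : ℝ) : ℂ) *
            ((starRingEnd ℂ) (u p) * A) := by
        simp only [he]; push_cast; ring
      rw [this, Complex.add_re, Complex.re_ofReal_mul, Complex.ofReal_re]
    have hx : |((starRingEnd ℂ) (u p) * A).re| ≤ ‖u p‖ * ‖A‖ := by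
      refine (Complex.abs_re_le_norm _).trans ?_
      rw [norm_mul, RCLike.norm_conj]
    set t := η (ρ p / δ) with ht
    set t' := deriv η (ρ p / δ) * (1 / δ) with ht'
    -- Young's inequality: of the two copies of $\eta^2|du|^2$ one absorbs the cross term, leaving
    -- $4|u|^2|d\eta|^2$.
    have hcross : -(4 * t * t' * ((starRingEnd ℂ) (u p) * A).re) ≤
        t ^ 2 * G + 4 * (‖u p‖ ^ 2 * (t' ^ 2 * Q)) := by
      have h1 : -(4 * t * t' * ((starRingEnd ℂ) (u p) * A).re) ≤
          4 * t * |t'| * (‖u p‖ * ‖A‖) := by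
        have h0 : |4 * t * t' * ((starRingEnd ℂ) (u p) * A).re| ≤ 4 * t * |t'| * (‖u p‖ * ‖A‖) := by
          rw [abs_mul, abs_mul, abs_of_nonneg (by have := hη0 (ρ p / δ); positivity : 0 ≤ 4 * t)]
          have := hη0 (ρ p / δ)
          gcongr
        exact (neg_le_abs _).trans h0
      refine h1.trans ?_
      rcases hQ0.eq_or_lt with hq | hq
      · have : ‖A‖ = 0 := by
          rw [← hq, mul_zero] at hCS
          exact pow_eq_zero_iff (two_ne_zero) |>.1 (le_antisymm hCS (sq_nonneg _))
        rw [this, ← hq]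
        have := mul_nonneg (sq_nonneg t) hG0
        simpa using this
      · have h2 : ‖A‖ ^ 2 / Q ≤ G := by rwa [div_le_iff₀ hq]
        have h3 : 0 ≤ (t * ‖A‖ - 2 * (|t'| * ‖u p‖ * Q)) ^ 2 / Q := by positivity
        have h4 : (t * ‖A‖ - 2 * (|t'| * ‖u p‖ * Q)) ^ 2 / Q = t ^ 2 * (‖A‖ ^ 2 / Q) -
            4 * t * |t'| * (‖u p‖ * ‖A‖) + 4 * (‖u p‖ ^ 2 * (t' ^ 2 * Q)) := by
          rw [← sq_abs t']; field_simp; ring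
        have h5 : t ^ 2 * (‖A‖ ^ 2 / Q) ≤ t ^ 2 * G := by gcongr
        linarith
    have hkey : t ^ 2 * G ≤ 2 * (pairing h ρ u φ p).re +
        S.indicator (fun p => 4 * (256 * B ^ 2 * K) * ‖u p‖ ^ 2) p := by
      rw [hexp]
      have h6 : 4 * (‖u p‖ ^ 2 * (t' ^ 2 * Q)) ≤
          S.indicator (fun p => 4 * (256 * B ^ 2 * K) * ‖u p‖ ^ 2) p := by
        by_cases hs : p ∈ S
        · rw [indicator_of_mem hs]
          -- $|\eta'|/\delta\le B/\delta$ and $|d\rho|_g^2\le K(16\delta)^2$: the powers of $\delta$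
          -- cancel, leaving $16^2B^2K$.
          have h7 : t' ^ 2 * Q ≤ 256 * B ^ 2 * K := by
            have hpos := hρ.nonneg p
            have ha : t' ^ 2 ≤ (B * (1 / δ)) ^ 2 := by
              rw [← sq_abs t', ht', abs_mul, abs_of_pos (by positivity : 0 < 1 / δ)]
              gcongr
              exact (hbd _).1
            have hb : Q ≤ K * (16 * δ) ^ 2 := hQK.trans (by gcongr; exact hs.2)
            calc t' ^ 2 * Q ≤ (B * (1 / δ)) ^ 2 * (K * (16 * δ) ^ 2) := by gcongr
              _ = 256 * B ^ 2 * K := by field_simp; norm_num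
          calc 4 * (‖u p‖ ^ 2 * (t' ^ 2 * Q)) ≤ 4 * (‖u p‖ ^ 2 * (256 * B ^ 2 * K)) := by gcongr
            _ = _ := by ring
        · rw [indicator_of_notMem hs, ht', (hzero p hs).2]; simp
      linarith
    by_cases hs : p ∈ slab ρ (δ / 2) (4 * δ)
    · rw [indicator_of_mem hs]
      refine le_trans (le_of_eq ?_) hkey
      have : t = 1 := hηe _ ⟨by rw [le_div_iff₀ hδ]; linarith [hs.1],
        by rw [div_le_iff₀ hδ]; linarith [hs.2]⟩
      rw [this, one_pow, one_mul]
    · rw [indicator_of_notMem hs]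
      exact le_trans (mul_nonneg (sq_nonneg _) hG0) hkey
  refine hpt.trans ?_
  have hadd := integral_add (hgi.re.const_mul 2) hIS
  simp only [RCLike.re_to_complex] at hadd
  rw [hadd, integral_const_mul, integral_indicator hmS,
    integral_const_mul]
  have e2 : ∫ p, (pairing h ρ u φ p).re ∂V = (∫ p, (μ : ℂ) * u p * φ p ∂V).re := by
    rw [← hweak]; exact integral_re hgi
  have h8 : ∫ p, (pairing h ρ u φ p).re ∂V ≤ |μ| * ∫ p in S, ‖u p‖ ^ 2 ∂V := by
    rw [e2]
    refine (Complex.re_le_norm _).trans ((norm_integral_le_integral_norm _).trans ?_)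
    rw [← integral_const_mul, ← integral_indicator hmS]
    refine integral_mono_of_nonneg (ae_of_all _ fun p => norm_nonneg _)
      (IntegrableOn.integrable_indicator ((hint _ _ (by positivity)).const_mul _) hmS)
      (ae_of_all _ fun p => ?_)
    by_cases hs : p ∈ S
    · rw [indicator_of_mem hs]
      simp only [hφ, he, norm_mul, Complex.norm_real, RCLike.norm_conj, Real.norm_eq_abs]
      have h0 := hη0 (ρ p / δ)
      have h1 := hη1 (ρ p / δ)
      rw [abs_of_nonneg h0]
      calc |μ| * ‖u p‖ * (η (ρ p / δ) * (η (ρ p / δ) * ‖u p‖)) ≤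
          |μ| * ‖u p‖ * (1 * (1 * ‖u p‖)) := by gcongr
        _ = |μ| * ‖u p‖ ^ 2 := by ring
    · rw [indicator_of_notMem hs]
      simp only [hφ, he, (hzero p hs).1, Complex.ofReal_zero, zero_mul, mul_zero, norm_zero, le_refl]
  have h9 : 0 ≤ ∫ p in S, ‖u p‖ ^ 2 ∂V := integral_nonneg fun _ => by positivity
  nlinarith

end Energy

/-! ### Pointwise algebra of the flux -/

section Algebra

open ComplexConjugate

/-- Read $x=\rho$, $z=\rho^\zeta$, $Q=|d\rho|^2$, and $A,P,P_1,P_2,P_3$ as the pairings of $d\rho$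
with the differentials of $u$, $r$, $F$, $\bar F$ and
$\varphi=\frac\rho\delta\beta(\frac\rho\delta)\bar Fr$; $b'$ is the derivative of $t\beta(t)$ at
$\rho/\delta$. The test function $\varphi$ is chosen so that $\rho^{n-1}P_3$ removes the term with
$P$: no derivative of $r$ is left on the right. -/
theorem energy_error_eq {x δ b b' : ℝ} (hx : 0 < x) (n : ℕ) {z F r A Q P P₁ P₂ P₃ ζ u : ℂ}
    (hu : u = z * (F + r)) (hz : conj z * z = (x : ℂ) ^ n)
    (hA : A = z * (P + P₁) + ζ * (x : ℂ)⁻¹ * u * Q)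
    (hP : P₃ = ((x / δ * b : ℝ) : ℂ) * (conj F * P + r * P₂) +
      conj F * r * ((b' * (1 / δ) : ℝ) * Q)) :
    ((b * (1 / δ) : ℝ) : ℂ) * (conj u * A) - (x : ℂ) ^ n * (x : ℂ)⁻¹ * P₃ -
      ζ * (((b * (1 / δ) : ℝ) : ℂ) * ((x : ℂ) ^ n * (x : ℂ)⁻¹) * (conj F * F) * Q) =
    ((b * (1 / δ) : ℝ) : ℂ) * (conj z * conj r * A) +
      ((b * (1 / δ) : ℝ) : ℂ) * (x : ℂ) ^ n * (conj F * P₁ - r * P₂) +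
      ((b * (1 / δ) : ℝ) : ℂ) * (x : ℂ) ^ n * (x : ℂ)⁻¹ * ζ * (conj F * r) * Q -
      ((b' * (1 / δ) : ℝ) : ℂ) * (x : ℂ) ^ n * (x : ℂ)⁻¹ * (conj F * r) * Q := by
  have hx' : (x : ℂ) ≠ 0 := Complex.ofReal_ne_zero.2 hx.ne'
  have h1 : conj z * A = (x : ℂ) ^ n * (P + P₁) + ζ * (x : ℂ)⁻¹ * ((x : ℂ) ^ n * (F + r)) * Q := by
    rw [hA, hu, ← hz]; ring
  have h2 : conj u * A = conj z * conj r * A + conj F * (conj z * A) := by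
    rw [hu, map_mul, map_add]; ring
  have h3 : (x : ℂ) ^ n * (x : ℂ)⁻¹ * P₃ =
      (x : ℂ) ^ n * ((b * (1 / δ) : ℝ) : ℂ) * (conj F * P + r * P₂) +
      (x : ℂ) ^ n * (x : ℂ)⁻¹ * (conj F * r * ((b' * (1 / δ) : ℝ) * Q)) := by
    rw [hP, mul_add]
    congr 1
    push_cast
    field_simp
  rw [h3, h2, h1]
  ring

/-- Every error term contains either $r$ or a spare factor $x$, both controlled by
$d=\rho^\epsilon$. The factor $1/\delta\le16/x$ is paid for by the factors $x$ in the pairings. `G`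
stands for $|du|_g^2$. -/
theorem norm_energy_error_le {x δ b b' d K L M G : ℝ} (hx : 0 < x) (hδ : 0 < δ)
    (hxδ : x ≤ 16 * δ) (hd : x ≤ d) (hK : 0 ≤ K) (hM : 0 ≤ M) (n : ℕ)
    {z F r A Q P₁ P₂ ζ : ℂ} (hb0 : 0 ≤ b) (hb1 : b ≤ 1) (hb' : |b'| ≤ L)
    (hz : ‖z‖ ^ 2 = x ^ n) (hF : ‖F‖ ≤ M) (hr : ‖r‖ ≤ M * d) (hrM : ‖r‖ ≤ M) (hQ : ‖Q‖ ≤ K * x ^ 2)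
    (hP₁ : ‖P₁‖ ≤ K * x ^ 2) (hP₂ : ‖P₂‖ ≤ K * x ^ 2) (hA : ‖A‖ ^ 2 ≤ G * (K * x ^ 2))
    (hG : 0 ≤ G) :
    ‖((b * (1 / δ) : ℝ) : ℂ) * (conj z * conj r * A) +
      ((b * (1 / δ) : ℝ) : ℂ) * (x : ℂ) ^ n * (conj F * P₁ - r * P₂) +
      ((b * (1 / δ) : ℝ) : ℂ) * (x : ℂ) ^ n * (x : ℂ)⁻¹ * ζ * (conj F * r) * Q -
      ((b' * (1 / δ) : ℝ) : ℂ) * (x : ℂ) ^ n * (x : ℂ)⁻¹ * (conj F * r) * Q‖ ≤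
    (16 * M * (1 + K) + 32 * M * K + 16 * ‖ζ‖ * M ^ 2 * K + 16 * L * M ^ 2 * K) *
      (d * (x ^ n + G)) := by
  have hd0 : 0 ≤ d := hx.le.trans hd
  have hL : 0 ≤ L := (abs_nonneg _).trans hb'
  have hδx : 1 / δ ≤ 16 / x := by
    rw [div_le_div_iff₀ hδ hx]; linarith
  have hb : |b * (1 / δ)| ≤ 16 / x := by
    rw [abs_of_nonneg (by positivity)]
    calc b * (1 / δ) ≤ 1 * (16 / x) := by gcongr
      _ = _ := one_mul _
  have hbb : |b' * (1 / δ)| ≤ L * (16 / x) := by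
    rw [abs_mul, abs_of_nonneg (by positivity : 0 ≤ 1 / δ)]
    gcongr
  have hN : 0 < x ^ n := by positivity
  have hxn : ‖(x : ℂ)‖ = x := by rw [Complex.norm_real, Real.norm_of_nonneg hx.le]
  have t1 : ‖((b * (1 / δ) : ℝ) : ℂ) * (conj z * conj r * A)‖ ≤
      16 * M * (1 + K) * (d * (x ^ n + G)) := by
    rw [norm_mul, norm_mul, norm_mul, RCLike.norm_conj, RCLike.norm_conj, Complex.norm_real,
      Real.norm_eq_abs]
    -- Arithmetic–geometric mean with $|z|^2=x^n$ and $(|A|/x)^2\le KG$. This is where the energy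
    -- density of $u$ enters.
    have hq : ‖z‖ * (‖A‖ / x) ≤ (1 + K) * (x ^ n + G) := by
      have e1 : (‖A‖ / x) ^ 2 ≤ K * G := by
        rw [div_pow, div_le_iff₀ (by positivity)]; linarith
      have e2 := two_mul_le_add_sq ‖z‖ (‖A‖ / x)
      have e3 : 0 ≤ K * G := by positivity
      have e4 : 0 ≤ K * x ^ n := by positivity
      have e5 : 0 ≤ ‖z‖ * (‖A‖ / x) := by positivity
      rw [hz] at e2
      linarith
    calc |b * (1 / δ)| * (‖z‖ * ‖r‖ * ‖A‖) ≤ 16 / x * (‖z‖ * (M * d) * ‖A‖) := by gcongr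
      _ = 16 * M * d * (‖z‖ * (‖A‖ / x)) := by ring
      _ ≤ 16 * M * d * ((1 + K) * (x ^ n + G)) := by gcongr
      _ = _ := by ring
  have t2 : ‖((b * (1 / δ) : ℝ) : ℂ) * (x : ℂ) ^ n * (conj F * P₁ - r * P₂)‖ ≤
      32 * M * K * (d * (x ^ n + G)) := by
    rw [norm_mul, norm_mul, norm_pow, hxn, Complex.norm_real, Real.norm_eq_abs]
    have e1 : ‖conj F * P₁ - r * P₂‖ ≤ M * (K * x ^ 2) + M * (K * x ^ 2) := by
      refine (norm_sub_le _ _).trans ?_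
      rw [norm_mul, norm_mul, RCLike.norm_conj]
      gcongr
    calc |b * (1 / δ)| * x ^ n * ‖conj F * P₁ - r * P₂‖ ≤
        16 / x * x ^ n * (M * (K * x ^ 2) + M * (K * x ^ 2)) := by gcongr
      _ = 32 * M * K * (x * (x ^ n + 0)) := by field_simp; ring
      _ ≤ _ := by gcongr
  have t3 : ‖((b * (1 / δ) : ℝ) : ℂ) * (x : ℂ) ^ n * (x : ℂ)⁻¹ * ζ * (conj F * r) * Q‖ ≤
      16 * ‖ζ‖ * M ^ 2 * K * (d * (x ^ n + G)) := by
    simp only [norm_mul, norm_pow, norm_inv, hxn, RCLike.norm_conj, Complex.norm_real,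
      Real.norm_eq_abs]
    rw [← abs_mul]
    calc |b * (1 / δ)| * x ^ n * x⁻¹ * ‖ζ‖ * (‖F‖ * ‖r‖) * ‖Q‖ ≤
        16 / x * x ^ n * x⁻¹ * ‖ζ‖ * (M * (M * d)) * (K * x ^ 2) := by gcongr
      _ = 16 * ‖ζ‖ * M ^ 2 * K * (d * (x ^ n + 0)) := by field_simp; ring
      _ ≤ _ := by gcongr
  have t4 : ‖((b' * (1 / δ) : ℝ) : ℂ) * (x : ℂ) ^ n * (x : ℂ)⁻¹ * (conj F * r) * Q‖ ≤
      16 * L * M ^ 2 * K * (d * (x ^ n + G)) := by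
    simp only [norm_mul, norm_pow, norm_inv, hxn, RCLike.norm_conj, Complex.norm_real,
      Real.norm_eq_abs]
    rw [← abs_mul]
    calc |b' * (1 / δ)| * x ^ n * x⁻¹ * (‖F‖ * ‖r‖) * ‖Q‖ ≤
        L * (16 / x) * x ^ n * x⁻¹ * (M * (M * d)) * (K * x ^ 2) := by gcongr
      _ = 16 * L * M ^ 2 * K * (d * (x ^ n + 0)) := by field_simp; ring
      _ ≤ _ := by gcongr
  refine (norm_sub_le _ _).trans ((add_le_add ((norm_add_le _ _).trans (add_le_add
    ((norm_add_le _ _).trans (add_le_add t1 t2)) t3)) t4).trans (le_of_eq ?_))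
  ring

end Algebra

/-! ### Complex powers of a positive variable -/

section Power

/-- The power `t ^ ζ` for `t > 0`. -/
def cexpLog (ζ : ℂ) (t : ℝ) : ℂ := Complex.exp (ζ * (Real.log t : ℂ))

theorem contDiffOn_cexpLog (ζ : ℂ) : ContDiffOn ℝ 1 (cexpLog ζ) (Ioi 0) :=
  (contDiffOn_const.mul (Complex.ofRealCLM.contDiff.comp_contDiffOn
    (Real.contDiffOn_log.mono fun t (ht : 0 < t) => ht.ne'))).cexp

theorem hasDerivAt_cexpLog (ζ : ℂ) {t : ℝ} (ht : 0 < t) :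
    HasDerivAt (cexpLog ζ) (ζ * (t : ℂ)⁻¹ * cexpLog ζ t) t := by
  have := (((Real.hasDerivAt_log ht.ne').ofReal_comp).const_mul ζ).cexp
  rw [Complex.ofReal_inv, mul_comm] at this
  exact this

/-- Valid for every real $t$, zero included, so $u=\rho^\zeta(F+r)$ can be used without a positivity
condition. -/
theorem cexpLog_mul_neg (ζ : ℂ) (t : ℝ) : cexpLog ζ t * cexpLog (-ζ) t = 1 := by
  rw [cexpLog, cexpLog, ← Complex.exp_add, neg_mul, add_neg_cancel, Complex.exp_zero]

theorem cexpLog_eq_cpow (ζ : ℂ) {t : ℝ} (ht : 0 < t) : cexpLog ζ t = (t : ℂ) ^ ζ := by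
  rw [Complex.cpow_def_of_ne_zero (Complex.ofReal_ne_zero.2 ht.ne'), ← Complex.ofReal_log ht.le,
    mul_comm, cexpLog]

theorem norm_cexpLog (ζ : ℂ) {t : ℝ} (ht : 0 < t) : ‖cexpLog ζ t‖ = t ^ ζ.re := by
  rw [cexpLog_eq_cpow ζ ht, Complex.norm_cpow_eq_rpow_re_of_pos ht]

end Power

/-! ### Conservation of flux -/

section Decay

open ComplexConjugate

variable {n : ℕ} {X : Type*} [TopologicalSpace X] [ChartedSpace (EuclideanHalfSpace (n + 1)) X]
  [IsManifold (𝓡∂ (n + 1)) ∞ X] {ρ : X → ℝ}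

theorem IsBoundaryDefining.smoothInside_cexpLog {n : ℕ} {X : Type*} [TopologicalSpace X]
    [ChartedSpace (EuclideanHalfSpace (n + 1)) X] {ρ : X → ℝ} (hρ : IsBoundaryDefining n ρ)
    (ζ : ℂ) : SmoothInside n 1 fun p => cexpLog ζ (ρ p) :=
  hρ.smoothInside_comp (fun _ hp => hρ.pos_iff.2 hp) (contDiffOn_cexpLog ζ)

/-- The gradient of `u` in terms of that of the remainder `ρ ^ (-ζ) u - F`. -/
theorem pairing_defining_eq {h : Metric n X} (hρ : IsBoundaryDefining n ρ) {u F : X → ℂ} (ζ : ℂ)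
    (hu : SmoothInside n 1 u) (hF : SmoothInside n 1 F)
    (hr : SmoothInside n 1 fun q => cexpLog (-ζ) (ρ q) * u q - F q) {p : X}
    (hp : p ∈ (𝓡∂ (n + 1)).interior X) :
    pairing h ρ (fun q => (ρ q : ℂ)) u p = cexpLog ζ (ρ p) *
      (pairing h ρ (fun q => (ρ q : ℂ)) (fun q => cexpLog (-ζ) (ρ q) * u q - F q) p +
        pairing h ρ (fun q => (ρ q : ℂ)) F p) +
      ζ * (ρ p : ℂ)⁻¹ * u p * pairing h ρ (fun q => (ρ q : ℂ)) (fun q => (ρ q : ℂ)) p := by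
  have h1 := pairing_add_right (h := h) (ρ := ρ) hr hF hp fun q => (ρ q : ℂ)
  simp only [sub_add_cancel] at h1
  rw [← h1, pairing_mul_right (hρ.smoothInside_cexpLog (-ζ)) hu hp, pairing_comp_right hρ
    (hasDerivAt_cexpLog (-ζ) (hρ.pos_iff.2 hp)) hp]
  have h2 := cexpLog_mul_neg ζ (ρ p)
  linear_combination (ζ * (ρ p : ℂ)⁻¹ * u p *
    pairing h ρ (fun q => (ρ q : ℂ)) (fun q => (ρ q : ℂ)) p -
    pairing h ρ (fun q => (ρ q : ℂ)) u p) * h2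

variable [MeasurableSpace X] [BorelSpace X] [CompactSpace X] [T2Space X]

/-- The flux of an eigensolution with real eigenvalue through the level sets of `ρ` vanishes. -/
theorem IsEigensolution.flux_eq_zero {h : Metric n X} (hρ : IsBoundaryDefining n ρ) {μ : ℝ}
    {u : X → ℂ} (hu : IsEigensolution h ρ (μ : ℂ) u) {χ β : ℝ → ℝ}
    (hχ : ∀ t, HasDerivAt χ (β t) t) (hβ : Continuous β) {a : ℝ} (ha : 0 < a)
    (hχ0 : ∀ t, t ≤ a → χ t = 0) (hβ0 : ∀ t, t ≤ a → β t = 0) {δ : ℝ} (hδ : 0 < δ) :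
    (∫ p, ((β (ρ p / δ) * (1 / δ) : ℝ) : ℂ) *
      (conj (u p) * pairing h ρ (fun q => (ρ q : ℂ)) u p) ∂riemannianVolume h ρ).im = 0 := by
  set V := riemannianVolume h ρ with hV
  have hu1 : SmoothInside n 1 u := hu.contMDiffOn.of_le (by norm_num)
  have hχs := smoothInside_scaled hρ hχ hβ δ
  have hvan : ∀ p, ρ p < a * δ → ρ p / δ ≤ a := fun p hp => by
    rw [div_le_iff₀ hδ]; exact hp.le
  -- Tested on $\chi(\rho/\delta)\bar u$, the weak equation has real right side $\mu\chi|u|^2$ and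
  -- real term $\chi|du|_g^2$; the remaining term is the averaged flux.
  have hφt : IsTest n ρ fun p => ((χ (ρ p / δ) : ℝ) : ℂ) * conj (u p) :=
    ⟨hχs.mul hu1.conj, a * δ, by positivity, fun p hp => by
      rw [hχ0 _ (hvan p hp), Complex.ofReal_zero, zero_mul]⟩
  have hgi := integrable_pairing h hρ hu1 hφt (b := fun _ => 1) continuousOn_const
  simp only [one_mul] at hgi
  have hβc : ContinuousOn (fun p => ((β (ρ p / δ) * (1 / δ) : ℝ) : ℂ))
      ((𝓡∂ (n + 1)).interior X) :=
    (Complex.continuous_ofReal.comp ((hβ.comp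
      (hρ.smooth.continuous.div_const δ)).mul continuous_const)).continuousOn
  have hfi : Integrable (fun p => ((β (ρ p / δ) * (1 / δ) : ℝ) : ℂ) *
      (conj (u p) * pairing h ρ (fun q => (ρ q : ℂ)) u p)) V :=
    integrable_of_vanish h hρ (hβc.mul (hu1.conj.continuousOn.mul
      (continuousOn_pairing h hρ hρ.smoothInside hu1))) (by positivity : 0 < a * δ) fun p hp => by
        rw [hβ0 _ (hvan p hp)]; simp
  have hri : Integrable (fun p => (μ : ℂ) * u p * (((χ (ρ p / δ) : ℝ) : ℂ) * conj (u p))) V :=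
    integrable_of_vanish h hρ ((continuousOn_const.mul hu1.continuousOn).mul
      (hχs.continuousOn.mul hu1.conj.continuousOn)) (by positivity : 0 < a * δ) fun p hp => by
        rw [hχ0 _ (hvan p hp)]; simp
  have e1 : (∫ p, (μ : ℂ) * u p * (((χ (ρ p / δ) : ℝ) : ℂ) * conj (u p)) ∂V).im = 0 := by
    rw [← RCLike.im_eq_complex_im, ← integral_im hri]
    refine (integral_congr_ae (ae_of_all _ fun p => ?_)).trans (integral_zero X ℝ)
    have : (μ : ℂ) * u p * (((χ (ρ p / δ) : ℝ) : ℂ) * conj (u p)) =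
        ((μ * χ (ρ p / δ) * Complex.normSq (u p) : ℝ) : ℂ) := by
      push_cast
      rw [← Complex.mul_conj]; ring
    simp only [this, RCLike.im_eq_complex_im, Complex.ofReal_im]
  rw [← hu.integral_pairing hρ hφt, ← RCLike.im_eq_complex_im, ← integral_im hgi] at e1
  rw [← RCLike.im_eq_complex_im, ← integral_im hfi, ← e1]
  refine integral_congr_ae ?_
  filter_upwards [ae_mem_interior h] with p hp
  rw [pairing_mul_right hχs hu1.conj hp, pairing_scaled hρ hχ δ hp,
    pairing_comm hρ hp u fun q => (ρ q : ℂ)]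
  have him := pairing_conj_self_im (h := h) hρ hp u
  simp only [RCLike.im_eq_complex_im]
  rw [Complex.im_ofReal_mul, Complex.add_im, Complex.im_ofReal_mul, him, mul_zero, zero_add,
    mul_left_comm, Complex.im_ofReal_mul]

end Decay

/-! ### Mass of a solution in a shell -/

section Mass

open ComplexConjugate

variable {n : ℕ} {X : Type*} [TopologicalSpace X] [ChartedSpace (EuclideanHalfSpace (n + 1)) X]
  [IsManifold (𝓡∂ (n + 1)) ∞ X] {ρ : X → ℝ} [MeasurableSpace X] [BorelSpace X] [CompactSpace X]
  (h : Metric n X) [T2Space X]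

/-- Functions that are `O(ρ ^ σ)` have mass `O(δ ^ (2σ - n))` where `ρ` is comparable to `δ`. -/
theorem exists_slab_integral_le (hρ : IsBoundaryDefining n ρ) {σ M ρ₁ : ℝ} (hσ : 0 ≤ σ)
    (hρ₁ : 0 < ρ₁) {f : X → ℂ}
    (hf : ∀ p ∈ (𝓡∂ (n + 1)).interior X, ρ p < ρ₁ → ‖f p‖ ≤ M * ρ p ^ σ) :
    ∃ C δ₀, 0 < δ₀ ∧ 0 ≤ C ∧ ∀ δ, 0 < δ → δ < δ₀ →
      ∫ p in slab ρ (δ / 16) (16 * δ), ‖f p‖ ^ 2 ∂riemannianVolume h ρ ≤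
        C * δ ^ (2 * σ - n) := by
  obtain ⟨C, hC, δ₀, hδ₀, hV⟩ := exists_shell_volume_le h hρ
  set V := riemannianVolume h ρ with hVd
  refine ⟨M ^ 2 * (16 ^ σ) ^ 2 * C, min δ₀ (ρ₁ / 16), by positivity, by positivity,
    fun δ hδ hlt => ?_⟩
  have h1 : δ < δ₀ := hlt.trans_le (min_le_left _ _)
  have h2 : δ < ρ₁ / 16 := hlt.trans_le (min_le_right _ _)
  have h3 := norm_setIntegral_le_of_norm_le_const_ae' (μ := V) (f := fun p => ‖f p‖ ^ 2)
    (s := slab ρ (δ / 16) (16 * δ)) (C := (M * (16 * δ) ^ σ) ^ 2)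
    (riemannianVolume_shell_lt_top h hρ hδ) (by
      filter_upwards [ae_mem_interior h] with p hp hs
      have hpos := hρ.pos_iff.2 hp
      have h4 := hf p hp (by linarith [hs.2])
      rw [norm_pow, norm_norm]
      have hM : 0 ≤ M := by
        by_contra hneg
        have := mul_neg_of_neg_of_pos (not_le.1 hneg) (Real.rpow_pos_of_pos hpos σ)
        linarith [norm_nonneg (f p)]
      gcongr
      refine h4.trans ?_
      gcongr
      exact hs.2)
  refine (le_abs_self _).trans (h3.trans ?_)
  have h5 : (M * (16 * δ) ^ σ) ^ 2 * V.real (slab ρ (δ / 16) (16 * δ)) =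
      M ^ 2 * (16 ^ σ) ^ 2 * (V.real (slab ρ (δ / 16) (16 * δ)) * δ ^ n) * δ ^ (2 * σ - n) := by
    rw [Real.mul_rpow (by norm_num) hδ.le, Real.rpow_sub hδ, Real.rpow_natCast, mul_comm 2 σ,
      Real.rpow_mul hδ.le, Real.rpow_two]
    field_simp
  rw [h5]
  have := hV δ hδ h1
  gcongr

set_option maxHeartbeats 1000000 in
/-- On the critical line, solutions with a boundary expansion decay: the conserved flux forces the
leading coefficient to be small in the mean. -/
theorem exists_slab_mass_le (hρ : IsBoundaryDefining n ρ) {μ : ℝ} {ζ : ℂ}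
    (hζ : ζ.re = (n : ℝ) / 2) (hζ' : ζ.im ≠ 0) {u F : X → ℂ}
    (hu : IsEigensolution h ρ (μ : ℂ) u) (hF : ContMDiff (𝓡∂ (n + 1)) 𝓘(ℝ, ℂ) ∞ F)
    {ε M ρ₁ : ℝ} (hε : 0 < ε) (hε1 : ε ≤ 1) (hM : 0 ≤ M) (hFM : ∀ p, ‖F p‖ ≤ M) (hρ₁ : 0 < ρ₁)
    (hr : ∀ p ∈ (𝓡∂ (n + 1)).interior X, ρ p < ρ₁ →
      ‖cexpLog (-ζ) (ρ p) * u p - F p‖ ≤ M * ρ p ^ ε) :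
    ∃ C δ₀, 0 < δ₀ ∧ 0 ≤ C ∧ ∀ δ, 0 < δ → δ < δ₀ →
      ∫ p in slab ρ δ (2 * δ), ‖u p‖ ^ 2 ∂riemannianVolume h ρ ≤ C * δ ^ ε := by
  obtain ⟨χ, β, hβ, hχ, hβ0, hβ1, hβe, hβs, hβd, hχ0, B, hB, hbd⟩ :=
    exists_cutoff (a := 1) (b := 2) (by norm_num) (by norm_num)
  have hFc : ContMDiff (𝓡∂ (n + 1)) 𝓘(ℝ, ℂ) ∞ fun p => conj (F p) :=
    Complex.conjCLE.contDiff.contMDiff.comp hF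
  obtain ⟨K₁, hK₁, hKQ⟩ := exists_norm_pairing_le h hρ hρ.contMDiff_complex hρ.contMDiff_complex
  obtain ⟨K₂, hK₂, hKF⟩ := exists_norm_pairing_le h hρ hρ.contMDiff_complex hF
  obtain ⟨K₃, hK₃, hKFc⟩ := exists_norm_pairing_le h hρ hρ.contMDiff_complex hFc
  obtain ⟨Cd, hCd, hdiv⟩ := exists_divergence_bound h hρ
  obtain ⟨Cc, hCc, hcac⟩ := exists_caccioppoli h hρ μ
  obtain ⟨c, hc, hcp⟩ := exists_le_pairing h hρ
  obtain ⟨Cv, hCv, δv, hδv, hvol⟩ := exists_shell_volume_le h hρ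
  set V := riemannianVolume h ρ with hV
  set K := K₁ + K₂ + K₃ with hK
  set r : X → ℂ := fun p => cexpLog (-ζ) (ρ p) * u p - F p with hrd
  set L : ℝ := 1 + 4 * B with hL
  have hu1 : SmoothInside n 1 u := hu.contMDiffOn.of_le (by norm_num)
  have hF1 : SmoothInside n 1 F := hF.contMDiffOn.of_le (by norm_cast)
  have hrs : SmoothInside n 1 r := ((hρ.smoothInside_cexpLog (-ζ)).mul hu1).sub hF1
  have hur : ∀ p, u p = cexpLog ζ (ρ p) * (F p + r p) := fun p => by
    simp only [hrd]
    linear_combination -u p * cexpLog_mul_neg ζ (ρ p)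
  have hzn : ∀ p ∈ (𝓡∂ (n + 1)).interior X, ‖cexpLog ζ (ρ p)‖ = ρ p ^ ((n : ℝ) / 2) :=
    fun p hp => by rw [norm_cexpLog ζ (hρ.pos_iff.2 hp), hζ]
  have hzsq : ∀ p ∈ (𝓡∂ (n + 1)).interior X, ‖cexpLog ζ (ρ p)‖ ^ 2 = ρ p ^ n := fun p hp => by
    rw [hzn p hp, ← Real.rpow_natCast, ← Real.rpow_mul (hρ.nonneg p)]
    push_cast
    rw [div_mul_cancel₀ _ (by norm_num : (2 : ℝ) ≠ 0), Real.rpow_natCast]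
  set ρ₂ := min ρ₁ 1 with hρ₂
  have hρ₂0 : 0 < ρ₂ := by positivity
  have hrM : ∀ p ∈ (𝓡∂ (n + 1)).interior X, ρ p < ρ₂ → ‖r p‖ ≤ M := fun p hp hlt => by
    refine (hr p hp (hlt.trans_le (min_le_left _ _))).trans (mul_le_of_le_one_right hM ?_)
    exact Real.rpow_le_one (hρ.nonneg p) (hlt.trans_le (min_le_right _ _)).le hε.le
  -- On the critical line the exponent $2\sigma-n$ is zero: this bound gives no decay but, through
  -- Caccioppoli, bounds the energy. The next one shows that $\rho^\zeta r$ has mass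
  -- $O(\delta^{2\epsilon})$.
  obtain ⟨Cu, δu, hδu, hCu, hmass⟩ := exists_slab_integral_le h hρ (σ := (n : ℝ) / 2) (M := 2 * M)
    (f := u) (by positivity) hρ₂0 fun p hp hlt => by
      rw [hur, norm_mul, hzn p hp, mul_comm]
      refine mul_le_mul_of_nonneg_right ?_ (Real.rpow_nonneg (hρ.nonneg p) _)
      linarith [norm_add_le (F p) (r p), hFM p, hrM p hp hlt]
  obtain ⟨Cw, δw, hδw, hCw, hrem⟩ := exists_slab_integral_le h hρ (σ := (n : ℝ) / 2 + ε) (M := M)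
    (f := fun p => cexpLog ζ (ρ p) * r p) (by positivity) hρ₂0 fun p hp hlt => by
      rw [norm_mul, hzn p hp, Real.rpow_add (hρ.pos_iff.2 hp), mul_left_comm]
      exact mul_le_mul_of_nonneg_left (hr p hp (hlt.trans_le (min_le_left _ _)))
        (Real.rpow_nonneg (hρ.nonneg p) _)
  set C₁ := 16 * M * (1 + K) + 32 * M * K + 16 * ‖ζ‖ * M ^ 2 * K + 16 * L * M ^ 2 * K with hC₁
  have hC₁0 : 0 ≤ C₁ := by positivity
  set I₀ := ∫ p, ρ p ^ (n + 1) ∂V with hI₀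
  have hI₀0 : 0 ≤ I₀ := integral_nonneg fun p => pow_nonneg (hρ.nonneg p) _
  set E := Cd * (16 * M ^ 2 * I₀) + C₁ * (4 * (4 ^ n * Cv + Cc * Cu)) with hE
  refine ⟨2 * (E / (|ζ.im| * c)) + 2 * Cw, min (min δu δv) (min δw (min (ρ₂ / 16) (c / 16))),
    by positivity, by positivity, fun δ hδ hlt => ?_⟩
  simp only [lt_min_iff] at hlt
  obtain ⟨⟨hl1, hl2⟩, hl3, hl4, hl5⟩ := hlt
  have hδ1 : 16 * δ < ρ₁ := by linarith [min_le_left ρ₁ 1]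
  have hδ2 : 16 * δ < 1 := by linarith [min_le_right ρ₁ 1]
  set d := δ ^ ε with hd
  have hd0 : 0 < d := Real.rpow_pos_of_pos hδ ε
  have hxd : ∀ p ∈ slab ρ (δ / 2) (4 * δ), ρ p ^ ε ≤ 4 * d := fun p hp => by
    calc ρ p ^ ε ≤ (4 * δ) ^ ε := Real.rpow_le_rpow (hρ.nonneg p) hp.2 hε.le
      _ = 4 ^ ε * d := Real.mul_rpow (by norm_num) hδ.le
      _ ≤ 4 ^ (1 : ℝ) * d := by
        gcongr
        · norm_num
      _ = 4 * d := by rw [Real.rpow_one]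
  set b : X → ℝ := fun p => β (ρ p / δ) with hb
  set b' : X → ℝ := fun p => β (ρ p / δ) + ρ p / δ * deriv β (ρ p / δ) with hb'
  have hBd : ∀ t, HasDerivAt (fun t => t * β t) (β t + t * deriv β t) t := fun t => by
    have := (hasDerivAt_id t).mul ((hβ.differentiable (by simp)) t).hasDerivAt
    rwa [one_mul] at this
  have hBc : Continuous fun t => β t + t * deriv β t :=
    hβ.continuous.add (continuous_id.mul (hβ.continuous_deriv (by simp)))
  set φ : X → ℂ := fun p => ((ρ p / δ * β (ρ p / δ) : ℝ) : ℂ) * (conj (F p) * r p) with hφ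
  have hzero : ∀ p, p ∉ slab ρ (δ / 2) (4 * δ) → b p = 0 ∧ deriv β (ρ p / δ) = 0 := fun p hp => by
    have : ρ p / δ ∉ Icc ((1 : ℝ) / 2) (2 * 2) := fun h' => hp (by
      have h1 := (le_div_iff₀ hδ).1 h'.1
      have h2 := (div_le_iff₀ hδ).1 h'.2
      exact ⟨by linarith, by linarith⟩)
    exact ⟨hβs _ fun h' => this (Ioo_subset_Icc_self h'), hβd _ this⟩
  have hvan : ∀ p, ρ p < δ / 2 → b p = 0 := fun p hp => (hzero p fun h' => not_le.2 hp h'.1).1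
  have hφs := smoothInside_scaled hρ hBd hBc δ
  have hφt : IsTest n ρ φ := ⟨hφs.mul ((hF1.conj).mul hrs), δ / 2, by positivity, fun p hp => by
    have : β (ρ p / δ) = 0 := hvan p hp
    simp [hφ, this]⟩
  set R : X → ℂ := fun q => (ρ q : ℂ) with hR
  set G : X → ℝ := fun p => (pairing h ρ u (fun q => conj (u q)) p).re with hG
  -- $\zeta g_3$ is the leading part of the flux density `g₁`, and `g₂` is the integrand of the
  -- divergence bound.
  set g₃ : X → ℝ := fun p => b p * (1 / δ) * (ρ p ^ n * (ρ p)⁻¹) * ‖F p‖ ^ 2 *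
    (pairing h ρ R R p).re with hg₃
  have hRs : SmoothInside n 1 R := hρ.smoothInside
  have hinv : ContinuousOn (fun p => (ρ p)⁻¹) ((𝓡∂ (n + 1)).interior X) :=
    hρ.smooth.continuous.continuousOn.inv₀ fun p hp => (hρ.pos_iff.2 hp).ne'
  have hbc : Continuous b := hβ.continuous.comp (hρ.smooth.continuous.div_const δ)
  have hpw : ContinuousOn (fun p => ρ p ^ n * (ρ p)⁻¹) ((𝓡∂ (n + 1)).interior X) :=
    (hρ.smooth.continuous.pow n).continuousOn.mul hinv
  have hg₃i : Integrable g₃ V := integrable_of_vanish h hρ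
    ((((hbc.mul continuous_const).continuousOn.mul hpw).mul
      (hF1.continuousOn.norm.pow 2)).mul (Complex.continuous_re.comp_continuousOn
        (continuousOn_pairing h hρ hRs hRs))) (by positivity : 0 < δ / 2) fun p hp => by
      simp only [hg₃, hvan p hp, zero_mul]
  set g₁ : X → ℂ := fun p => ((b p * (1 / δ) : ℝ) : ℂ) * (conj (u p) * pairing h ρ R u p) with hg₁
  have hg₁i : Integrable g₁ V := integrable_of_vanish h hρ
    ((Complex.continuous_ofReal.comp (hbc.mul continuous_const)).continuousOn.mul
      (hu1.conj.continuousOn.mul (continuousOn_pairing h hρ hRs hu1)))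
      (by positivity : 0 < δ / 2) fun p hp => by
      simp only [hg₁, hvan p hp, zero_mul, Complex.ofReal_zero]
  set g₂ : X → ℂ := fun p => (ρ p : ℂ) ^ n * (ρ p : ℂ)⁻¹ * pairing h ρ R φ p with hg₂
  have hg₂i : Integrable g₂ V := integrable_pairing h hρ hRs hφt
    ((hRs.continuousOn.pow n).mul (hRs.continuousOn.inv₀ fun p hp =>
      Complex.ofReal_ne_zero.2 (hρ.pos_iff.2 hp).ne'))
  have hflux : (∫ p, g₁ p ∂V).im = 0 := hu.flux_eq_zero hρ hχ hβ.continuous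
    (by norm_num : (0 : ℝ) < 1 / 2) hχ0 (fun t ht => hβs t fun h' => not_lt.2 ht h'.1) hδ
  have hmW : MeasurableSet (slab ρ (δ / 2) (4 * δ)) := measurableSet_slab hρ _ _
  have hGi : IntegrableOn G (slab ρ (δ / 2) (4 * δ)) V :=
    integrableOn_slab h hρ (Complex.continuous_re.comp_continuousOn
      (continuousOn_pairing h hρ hu1 hu1.conj)) (by positivity) _
  have hci : IntegrableOn (fun _ => (4 ^ n * δ ^ n : ℝ)) (slab ρ (δ / 2) (4 * δ)) V :=
    integrableOn_slab h hρ continuousOn_const (by positivity) _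
  have herri : IntegrableOn (fun p => C₁ * (4 * d * (4 ^ n * δ ^ n + G p)))
      (slab ρ (δ / 2) (4 * δ)) V := ((hci.add hGi).const_mul _).const_mul _
  have herr : ∀ᵐ p ∂V, ‖g₁ p - g₂ p - ζ * (g₃ p : ℂ)‖ ≤
      (slab ρ (δ / 2) (4 * δ)).indicator (fun p => C₁ * (4 * d * (4 ^ n * δ ^ n + G p))) p := by
    filter_upwards [ae_mem_interior h] with p hp
    have hpos := hρ.pos_iff.2 hp
    have hQre : pairing h ρ R R p = ((pairing h ρ R R p).re : ℂ) :=
      Complex.ext rfl (by simpa using pairing_defining_im hρ hp)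
    have hφp : pairing h ρ R φ p = ((ρ p / δ * b p : ℝ) : ℂ) * (conj (F p) * pairing h ρ R r p +
        r p * pairing h ρ R (fun q => conj (F q)) p) +
        conj (F p) * r p * ((b' p * (1 / δ) : ℝ) * pairing h ρ R R p) := by
      simp only [hφ]
      rw [pairing_mul_right hφs (hF1.conj.mul hrs) hp, pairing_mul_right hF1.conj hrs hp,
        pairing_scaled hρ hBd δ hp]
    have hid := energy_error_eq (δ := δ) (b := b p) hpos n (hur p)
      (by rw [Complex.conj_mul', ← Complex.ofReal_pow, hzsq p hp, Complex.ofReal_pow])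
      (pairing_defining_eq (h := h) hρ ζ hu1 hF1 hrs hp) hφp
    have e3 : ζ * (g₃ p : ℂ) = ζ * (((b p * (1 / δ) : ℝ) : ℂ) * ((ρ p : ℂ) ^ n * (ρ p : ℂ)⁻¹) *
        (conj (F p) * F p) * pairing h ρ R R p) := by
      rw [hQre, Complex.conj_mul']
      simp only [hg₃]
      push_cast
      rfl
    rw [e3, hid]
    by_cases hs : p ∈ slab ρ (δ / 2) (4 * δ)
    · rw [indicator_of_mem hs]
      have hx1 : ρ p ≤ 1 := by linarith [hs.2]
      have hx2 : ρ p < ρ₁ := by linarith [hs.2]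
      have hb'L : |b' p| ≤ L := by
        have h1 : |ρ p / δ| ≤ 4 := by
          rw [abs_of_nonneg (by positivity), div_le_iff₀ hδ]; exact hs.2
        calc |b' p| ≤ |b p| + |ρ p / δ * deriv β (ρ p / δ)| := abs_add_le _ _
          _ ≤ 1 + 4 * B := by
            rw [abs_mul, abs_of_nonneg (hβ0 _)]
            gcongr
            · exact hβ1 _
            · exact (hbd _).1
      have hsq : 0 ≤ ρ p ^ 2 := sq_nonneg _
      have hG0 : 0 ≤ G p := pairing_conj_self_re_nonneg hρ hp u
      have hlep : ρ p ≤ ρ p ^ ε := by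
        have := Real.rpow_le_rpow_of_exponent_ge hpos hx1 hε1
        rwa [Real.rpow_one] at this
      have hKle : ∀ {k : ℝ}, k ≤ K → k * ρ p ^ 2 ≤ K * ρ p ^ 2 := fun hk =>
        mul_le_mul_of_nonneg_right hk hsq
      have hQ := (hKQ p hp).trans (hKle (by linarith))
      refine (norm_energy_error_le (K := K) (L := L) (M := M) (G := G p) (d := ρ p ^ ε) hpos hδ
        (by linarith [hs.2]) hlep (by positivity) hM n (hβ0 _) (hβ1 _) hb'L (hzsq p hp) (hFM p)
        (hr p hp hx2) ((hr p hp hx2).trans (mul_le_of_le_one_right hM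
          (Real.rpow_le_one hpos.le hx1 hε.le)))
        hQ ((hKF p hp).trans (hKle (by linarith)))
        ((hKFc p hp).trans (hKle (by linarith))) ?_ hG0).trans ?_
      · rw [pairing_comm hρ hp]
        refine (norm_pairing_sq_le hρ hp u).trans ?_
        exact mul_le_mul_of_nonneg_left ((Complex.re_le_norm _).trans hQ) hG0
      · refine mul_le_mul_of_nonneg_left ?_ hC₁0
        have h1 := hxd p hs
        have h2 : ρ p ^ n ≤ 4 ^ n * δ ^ n := by
          rw [← mul_pow]; exact pow_le_pow_left₀ hpos.le hs.2 _
        gcongr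
    · rw [indicator_of_notMem hs]
      have h1 : b' p = 0 := by
        have := (hzero p hs).1
        simp only [hb] at this
        simp only [hb', this, (hzero p hs).2, mul_zero, add_zero]
      rw [(hzero p hs).1, h1]
      simp
  have herrint : ‖∫ p, (g₁ p - g₂ p - ζ * (g₃ p : ℂ)) ∂V‖ ≤
      C₁ * (4 * (4 ^ n * Cv + Cc * Cu)) * d := by
    refine (norm_integral_le_of_norm_le (herri.integrable_indicator hmW) herr).trans ?_
    rw [integral_indicator hmW, integral_const_mul, integral_const_mul, integral_add hci hGi,
      setIntegral_const, smul_eq_mul]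
    have h1 : V.real (slab ρ (δ / 2) (4 * δ)) * δ ^ n ≤ Cv := by
      have hsub : slab ρ (δ / 2) (4 * δ) ⊆ slab ρ (δ / 16) (16 * δ) := fun p hp =>
        ⟨by linarith [hp.1], by linarith [hp.2]⟩
      refine le_trans ?_ (hvol δ hδ hl2)
      gcongr
      exact (riemannianVolume_shell_lt_top h hρ hδ).ne
    -- Caccioppoli and the bounded mass of $u$.
    have h2 : ∫ p in slab ρ (δ / 2) (4 * δ), G p ∂V ≤ Cc * Cu := by
      refine (hcac u hu δ hδ).trans ?_
      have := hmass δ hδ hl1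
      rw [show 2 * ((n : ℝ) / 2) - n = 0 by ring, Real.rpow_zero, mul_one] at this
      gcongr
    calc C₁ * (4 * d * (V.real (slab ρ (δ / 2) (4 * δ)) * (4 ^ n * δ ^ n) +
          ∫ p in slab ρ (δ / 2) (4 * δ), G p ∂V)) =
          C₁ * (4 * d * (4 ^ n * (V.real (slab ρ (δ / 2) (4 * δ)) * δ ^ n) +
          ∫ p in slab ρ (δ / 2) (4 * δ), G p ∂V)) := by ring
      _ ≤ C₁ * (4 * d * (4 ^ n * Cv + Cc * Cu)) := by gcongr
      _ = _ := by ring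
  have hg₂le : ‖∫ p, g₂ p ∂V‖ ≤ Cd * (16 * M ^ 2 * I₀) * d := by
    refine (hdiv φ hφt).trans ?_
    rw [mul_assoc Cd]
    refine mul_le_mul_of_nonneg_left ?_ hCd
    rw [mul_right_comm, hI₀, ← integral_const_mul]
    refine integral_mono_of_nonneg (ae_of_all _ fun p =>
      mul_nonneg (pow_nonneg (hρ.nonneg p) _) (norm_nonneg _))
      ((integrable_pow h hρ).const_mul _) ?_
    filter_upwards [ae_mem_interior h] with p hp
    rw [mul_comm]
    refine mul_le_mul_of_nonneg_right ?_ (pow_nonneg (hρ.nonneg p) _)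
    by_cases hs : p ∈ slab ρ (δ / 2) (4 * δ)
    · simp only [hφ, norm_mul, RCLike.norm_conj, Complex.norm_real, Real.norm_eq_abs]
      have h1 : |ρ p / δ| ≤ 4 := by
        have := hρ.nonneg p
        rw [abs_of_nonneg (by positivity), div_le_iff₀ hδ]; exact hs.2
      have h2 : |β (ρ p / δ)| ≤ 1 := by
        rw [abs_of_nonneg (hβ0 _)]; exact hβ1 _
      have h3 : ‖r p‖ ≤ M * (4 * d) :=
        (hr p hp (by linarith [hs.2])).trans (mul_le_mul_of_nonneg_left (hxd p hs) hM)
      calc |ρ p / δ| * |β (ρ p / δ)| * (‖F p‖ * ‖r p‖) ≤ 4 * 1 * (M * (M * (4 * d))) := by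
            gcongr
            exact hFM p
        _ = _ := by ring
    · have : β (ρ p / δ) = 0 := (hzero p hs).1
      simp only [hφ, this, mul_zero, Complex.ofReal_zero, zero_mul, norm_zero]
      positivity
  have hg₃c : Integrable (fun p => ζ * (g₃ p : ℂ)) V := hg₃i.ofReal.const_mul ζ
  -- Imaginary parts of $g_1-g_2-\zeta g_3=$ error: the flux contributes nothing and $g_3$ is real,
  -- so $\operatorname{Im}\zeta\int g_3$ is as small as the divergence and error terms.
  have hI₃ : |ζ.im| * |∫ p, g₃ p ∂V| ≤ E * d := by
    have h1 : ∫ p, (g₁ p - g₂ p - ζ * (g₃ p : ℂ)) ∂V =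
        ∫ p, g₁ p ∂V - ∫ p, g₂ p ∂V - ζ * ((∫ p, g₃ p ∂V : ℝ) : ℂ) := by
      have hsub := integral_sub (hg₁i.sub hg₂i) hg₃c
      simp only [Pi.sub_apply] at hsub
      rw [hsub, integral_sub hg₁i hg₂i, integral_const_mul, integral_complex_ofReal]
    have h2 : ζ.im * ∫ p, g₃ p ∂V = -(∫ p, (g₁ p - g₂ p - ζ * (g₃ p : ℂ)) ∂V).im -
        (∫ p, g₂ p ∂V).im := by
      rw [h1, Complex.sub_im, Complex.sub_im, hflux, mul_comm ζ, Complex.im_ofReal_mul]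
      ring
    rw [← abs_mul, h2]
    refine (abs_sub _ _).trans ?_
    rw [abs_neg, hE, add_mul, add_comm]
    exact add_le_add ((Complex.abs_im_le_norm _).trans hg₂le)
      ((Complex.abs_im_le_norm _).trans herrint)
  have hmN : MeasurableSet (slab ρ δ (2 * δ)) := measurableSet_slab hρ _ _
  have hFi : IntegrableOn (fun p => ρ p ^ n * ‖F p‖ ^ 2) (slab ρ δ (2 * δ)) V :=
    integrableOn_slab h hρ ((hρ.smooth.continuous.pow n).continuousOn.mul
      (hF1.continuousOn.norm.pow 2)) hδ _
  -- `g₃` is nonnegative, and on the inner slab $1/\delta\ge1/\rho$ together with $|d\rho|_g^2\ge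
  -- c\rho^2$ restores the full power $\rho^n$.
  have hlow : c * ∫ p in slab ρ δ (2 * δ), ρ p ^ n * ‖F p‖ ^ 2 ∂V ≤ ∫ p, g₃ p ∂V := by
    rw [← integral_const_mul, ← integral_indicator hmN]
    refine integral_mono_ae (IntegrableOn.integrable_indicator (hFi.const_mul c) hmN) hg₃i ?_
    filter_upwards [ae_mem_interior h] with p hp
    have hpos := hρ.pos_iff.2 hp
    have hQ0 : 0 ≤ (pairing h ρ R R p).re := pairing_defining_re_nonneg hρ hp
    by_cases hs : p ∈ slab ρ δ (2 * δ)
    · rw [indicator_of_mem hs]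
      have h1 : b p = 1 := hβe _ ⟨by rw [le_div_iff₀ hδ]; linarith [hs.1],
        by rw [div_le_iff₀ hδ]; linarith [hs.2]⟩
      have h2 := hcp p hp (by linarith [hs.2, min_le_left ρ₁ 1])
      simp only [hg₃, h1, one_mul]
      calc c * (ρ p ^ n * ‖F p‖ ^ 2) = 1 / ρ p * (ρ p ^ n * (ρ p)⁻¹) * ‖F p‖ ^ 2 *
            (c * ρ p ^ 2) := by field_simp
        _ ≤ 1 / δ * (ρ p ^ n * (ρ p)⁻¹) * ‖F p‖ ^ 2 * (pairing h ρ R R p).re := by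
          gcongr
          exact hs.1
    · rw [indicator_of_notMem hs]
      have := hβ0 (ρ p / δ)
      simp only [hg₃, hb]
      positivity
  have hζ0 : 0 < |ζ.im| := abs_pos.2 hζ'
  have hJ : ∫ p in slab ρ δ (2 * δ), ρ p ^ n * ‖F p‖ ^ 2 ∂V ≤ E / (|ζ.im| * c) * d := by
    rw [div_mul_eq_mul_div, le_div_iff₀ (by positivity)]
    have := mul_le_mul_of_nonneg_left (hlow.trans (le_abs_self _)) hζ0.le
    linarith
  have hsub : slab ρ δ (2 * δ) ⊆ slab ρ (δ / 16) (16 * δ) := fun p hp =>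
    ⟨by linarith [hp.1], by linarith [hp.2]⟩
  have hwi : ∀ a b : ℝ, 0 < a →
      IntegrableOn (fun p => ‖cexpLog ζ (ρ p) * r p‖ ^ 2) (slab ρ a b) V := fun a b ha =>
    integrableOn_slab h hρ ((((hρ.smoothInside_cexpLog ζ).continuousOn.mul
      hrs.continuousOn).norm).pow 2) ha b
  have hW : ∫ p in slab ρ δ (2 * δ), ‖cexpLog ζ (ρ p) * r p‖ ^ 2 ∂V ≤ Cw * d := by
    refine (setIntegral_mono_set (hwi _ _ (by positivity)) (ae_of_all _ fun p => sq_nonneg _)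
      hsub.eventuallyLE).trans ((hrem δ hδ hl3).trans ?_)
    refine mul_le_mul_of_nonneg_left ?_ hCw
    exact Real.rpow_le_rpow_of_exponent_ge hδ (by linarith) (by linarith)
  have hle : ∫ p in slab ρ δ (2 * δ), ‖u p‖ ^ 2 ∂V ≤ ∫ p in slab ρ δ (2 * δ),
      (2 * (ρ p ^ n * ‖F p‖ ^ 2) + 2 * ‖cexpLog ζ (ρ p) * r p‖ ^ 2) ∂V := by
    refine integral_mono_ae (integrableOn_slab h hρ (hu1.continuousOn.norm.pow 2) hδ _)
      ((hFi.const_mul 2).add ((hwi _ _ hδ).const_mul 2)) ?_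
    filter_upwards [ae_restrict_of_ae (ae_mem_interior h)] with p hp
    rw [← hzsq p hp, ← mul_pow, ← norm_mul, hur p, mul_add]
    have h1 := norm_add_le (cexpLog ζ (ρ p) * F p) (cexpLog ζ (ρ p) * r p)
    have h2 := pow_le_pow_left₀ (norm_nonneg _) h1 2
    have h3 := sq_nonneg (‖cexpLog ζ (ρ p) * F p‖ - ‖cexpLog ζ (ρ p) * r p‖)
    linarith
  refine hle.trans ?_
  rw [integral_add (hFi.const_mul 2) ((hwi _ _ hδ).const_mul 2), integral_const_mul,
    integral_const_mul]
  linarith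

end Mass

/-! ### Square integrability and conclusion -/

section SquareIntegrable

variable {n : ℕ} {X : Type*} [TopologicalSpace X] [ChartedSpace (EuclideanHalfSpace (n + 1)) X]
  [IsManifold (𝓡∂ (n + 1)) ∞ X] {ρ : X → ℝ} [MeasurableSpace X] [BorelSpace X] [CompactSpace X]
  (h : Metric n X)

/-- Dyadic shells exhaust the region near the boundary with masses dominated by a geometric series
of ratio $2^{-\kappa}$; the rest of $X$ is compact in the interior. -/
theorem memLp_two_of_slab_le (hρ : IsBoundaryDefining n ρ) {u : X → ℂ}
    (hu : ContinuousOn u ((𝓡∂ (n + 1)).interior X)) {C κ a : ℝ} (hκ : 0 < κ)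
    (ha : 0 < a) (hb : ∀ δ, 0 < δ → δ < a →
      ∫ p in slab ρ δ (2 * δ), ‖u p‖ ^ 2 ∂riemannianVolume h ρ ≤ C * δ ^ κ) :
    MemLp u 2 (riemannianVolume h ρ) := by
  set V := riemannianVolume h ρ with hV
  rw [memLp_two_iff_integrable_sq_norm (aestronglyMeasurable_of_continuousOn h hu)]
  have hc : ContinuousOn (fun p => ‖u p‖ ^ 2) ((𝓡∂ (n + 1)).interior X) := hu.norm.pow 2
  -- The exponent $k+1$ keeps the inner radius strictly below $a$, as the bound requires; the first
  -- shell still reaches up to $a$.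
  set s : ℕ → Set X := fun k => slab ρ (a * (1 / 2) ^ (k + 1)) (2 * (a * (1 / 2) ^ (k + 1)))
    with hs
  have hpow : ∀ k : ℕ, (a * (1 / 2) ^ (k + 1)) ^ κ = a ^ κ * (1 / 2) ^ κ * ((1 / 2) ^ κ) ^ k :=
    fun k => by
      rw [Real.mul_rpow ha.le (by positivity), ← Real.rpow_natCast, ← Real.rpow_mul (by norm_num),
        mul_comm ((k + 1 : ℕ) : ℝ), Real.rpow_mul (by norm_num), Real.rpow_natCast, pow_succ]
      ring
  have hsum : Summable fun k => ∫ p in s k, ‖‖u p‖ ^ 2‖ ∂V := by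
    have hg : Summable fun k : ℕ => C * (a * (1 / 2) ^ (k + 1)) ^ κ := by
      simp only [hpow]
      exact ((summable_geometric_of_lt_one (by positivity)
        (Real.rpow_lt_one (by norm_num) (by norm_num) hκ)).mul_left _).mul_left _
    refine Summable.of_nonneg_of_le (fun k => integral_nonneg fun _ => norm_nonneg _)
      (fun k => ?_) hg
    simp only [norm_pow, norm_norm]
    refine hb _ (by positivity) ?_
    have : ((1 : ℝ) / 2) ^ (k + 1) < 1 := pow_lt_one₀ (by norm_num) (by norm_num) (by omega)
    calc a * (1 / 2) ^ (k + 1) < a * 1 := by gcongr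
      _ = a := mul_one a
  have h1 : IntegrableOn (fun p => ‖u p‖ ^ 2) (⋃ k, s k) V :=
    integrableOn_iUnion_of_summable_integral_norm
      (fun k => integrableOn_slab h hρ hc (by positivity) _) hsum
  obtain ⟨B, hB⟩ := isCompact_univ.exists_bound_of_continuousOn hρ.smooth.continuous.continuousOn
  have h2 := h1.union (integrableOn_slab h hρ hc ha B)
  rw [← riemannianVolume_restrict_interior h]
  refine h2.mono_set fun p hp => ?_
  have hpos := hρ.pos_iff.2 hp
  rcases le_or_gt a (ρ p) with hle | hlt
  · exact Or.inr ⟨hle, (le_abs_self _).trans (hB p (mem_univ p))⟩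
  · obtain ⟨k, hk1, hk2⟩ := exists_nat_pow_near_of_lt_one (x := ρ p / a) (y := 1 / 2)
      (by positivity) ((div_le_one ha).2 hlt.le) (by norm_num) (by norm_num)
    rw [lt_div_iff₀ ha] at hk1
    rw [div_le_iff₀ ha] at hk2
    refine Or.inl (mem_iUnion.2 ⟨k, by linarith, hk2.trans (le_of_eq ?_)⟩)
    rw [pow_succ]; ring

/-- Unpacks the asymptotic bound with one constant for both `F` and the remainder; $\rho_1\le1$
makes powers of $\rho$ decrease in the exponent. -/
theorem exists_boundary_bound {n : ℕ} {X : Type*} [TopologicalSpace X]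
    [ChartedSpace (EuclideanHalfSpace (n + 1)) X] [CompactSpace X] {ρ : X → ℝ} {ζ : ℂ} {ε : ℝ} {u : X → ℂ} {f : (𝓡∂ (n + 1)).boundary X → ℂ}
    (hexp : HasBoundaryExpansion ρ u ζ ε f) :
    ∃ F : X → ℂ, ContMDiff (𝓡∂ (n + 1)) 𝓘(ℝ, ℂ) ∞ F ∧ ∃ M ρ₁, 0 ≤ M ∧ 0 < ρ₁ ∧ ρ₁ ≤ 1 ∧
      (∀ p, ‖F p‖ ≤ M) ∧ ∀ p, 0 < ρ p → ρ p < ρ₁ →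
        ‖u p - cexpLog ζ (ρ p) * F p‖ ≤ M * ρ p ^ (ζ.re + ε) := by
  obtain ⟨F, hF, hO⟩ := hexp
  obtain ⟨C, hC⟩ := hO.bound
  rw [eventually_comap] at hC
  obtain ⟨ρ₁, hρ₁, hsub⟩ := mem_nhdsGT_iff_exists_Ioo_subset.1 hC
  obtain ⟨B, hB⟩ := isCompact_univ.exists_bound_of_continuousOn hF.smooth.continuous.continuousOn
  refine ⟨F, hF.smooth, max 0 (max B C), min ρ₁ 1, le_max_left _ _, lt_min hρ₁ one_pos,
    min_le_right _ _, fun p => (hB p (mem_univ p)).trans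
      ((le_max_left _ _).trans (le_max_right _ _)), fun p hp hlt => ?_⟩
  have h1 := hsub ⟨hp, hlt.trans_le (min_le_left _ _)⟩ p rfl
  rw [cexpLog_eq_cpow ζ hp]
  refine h1.trans ?_
  rw [Real.norm_of_nonneg (Real.rpow_nonneg hp.le _)]
  have : C ≤ max 0 (max B C) := (le_max_right _ _).trans (le_max_right _ _)
  gcongr

variable [T2Space X]

/-- Off the critical line the size of $u$ suffices; on it the flux argument is needed, and $\zeta\ne
n/2$ means $\operatorname{Im}\zeta\ne0$. -/
theorem IsEigensolution.memLp_two {h : Metric n X} (hρ : IsBoundaryDefining n ρ) {ζ : ℂ}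
    (hζ : (n : ℝ) / 2 ≤ ζ.re) (hζn : ζ ≠ (n : ℂ) / 2) {u : X → ℂ}
    (hu : IsEigensolution h ρ (ζ * ((n : ℂ) - ζ)) u) {f : (𝓡∂ (n + 1)).boundary X → ℂ} {ε : ℝ}
    (hε : 0 < ε) (hexp : HasBoundaryExpansion ρ u ζ ε f) : MemLp u 2 (riemannianVolume h ρ) := by
  obtain ⟨F, hF, M, ρ₁, hM, hρ₁, hρ₁1, hFM, hb⟩ := exists_boundary_bound hexp
  have huc : ContinuousOn u ((𝓡∂ (n + 1)).interior X) := hu.contMDiffOn.continuousOn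
  rcases hζ.eq_or_lt with heq | hlt
  · have him : ζ.im ≠ 0 := fun h0 => hζn (Complex.ext (by
      rw [← heq]; simp) (by rw [h0]; simp))
    -- The eigenvalue is real here, as conservation of flux demands.
    have hμ : ζ * ((n : ℂ) - ζ) = (((n : ℝ) / 2) ^ 2 + ζ.im ^ 2 : ℝ) := by
      refine Complex.ext ?_ ?_
      · rw [Complex.mul_re, Complex.sub_re, Complex.sub_im, Complex.natCast_re,
          Complex.natCast_im, ← heq, Complex.ofReal_re]
        ring
      · rw [Complex.mul_im, Complex.sub_re, Complex.sub_im, Complex.natCast_re,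
          Complex.natCast_im, ← heq, Complex.ofReal_im]
        ring
    rw [hμ] at hu
    -- The exponent is lowered to at most $1$ so that $\rho\le\rho^\epsilon$ near the boundary,
    -- which the error estimate uses.
    have hε' : 0 < min ε 1 := lt_min hε one_pos
    obtain ⟨C, δ₀, hδ₀, -, hle⟩ := exists_slab_mass_le h hρ heq.symm him hu hF
      hε' (min_le_right _ _) hM hFM hρ₁ fun p hp hlt => by
        have hpos := hρ.pos_iff.2 hp
        have h1 : cexpLog (-ζ) (ρ p) * u p - F p =
            cexpLog (-ζ) (ρ p) * (u p - cexpLog ζ (ρ p) * F p) := by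
          linear_combination F p * cexpLog_mul_neg ζ (ρ p)
        rw [h1, norm_mul, norm_cexpLog (-ζ) hpos, Complex.neg_re]
        calc ρ p ^ (-ζ.re) * ‖u p - cexpLog ζ (ρ p) * F p‖ ≤
            ρ p ^ (-ζ.re) * (M * ρ p ^ (ζ.re + ε)) := by gcongr; exact hb p hpos hlt
          _ = M * (ρ p ^ (-ζ.re) * ρ p ^ (ζ.re + ε)) := by ring
          _ = M * ρ p ^ ε := by rw [← Real.rpow_add hpos]; congr 2; ring
          _ ≤ M * ρ p ^ min ε 1 := mul_le_mul_of_nonneg_left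
            (Real.rpow_le_rpow_of_exponent_ge hpos (hlt.le.trans hρ₁1) (min_le_left _ _)) hM
    exact memLp_two_of_slab_le h hρ huc hε' hδ₀ hle
  · have hσ : 0 ≤ ζ.re := le_trans (by positivity) hlt.le
    obtain ⟨C, δ₀, hδ₀, -, hle⟩ := exists_slab_integral_le h hρ (M := 2 * M) (f := u) hσ hρ₁
      fun p hp hlt => by
        have hpos := hρ.pos_iff.2 hp
        have h1 := hb p hpos hlt
        have h2 : ρ p ^ (ζ.re + ε) ≤ ρ p ^ ζ.re :=
          Real.rpow_le_rpow_of_exponent_ge hpos (hlt.le.trans hρ₁1) (by linarith)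
        have h3 : ‖cexpLog ζ (ρ p) * F p‖ ≤ ρ p ^ ζ.re * M := by
          rw [norm_mul, norm_cexpLog ζ hpos]
          gcongr
          exact hFM p
        have h4 := norm_sub_norm_le (u p) (cexpLog ζ (ρ p) * F p)
        have h5 := mul_le_mul_of_nonneg_left h2 hM
        linarith
    refine memLp_two_of_slab_le h hρ huc (C := C) (κ := 2 * ζ.re - n) (by linarith) hδ₀
      fun δ hδ hlt => ?_
    have hsub : slab ρ δ (2 * δ) ⊆ slab ρ (δ / 16) (16 * δ) := fun p hp =>
      ⟨by linarith [hp.1], by linarith [hp.2]⟩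
    exact (setIntegral_mono_set (integrableOn_slab h hρ (huc.norm.pow 2) (by positivity) _)
      (ae_of_all _ fun p => sq_nonneg _) hsub.eventuallyLE).trans (hle δ hδ hlt)

end SquareIntegrable

end AsympHyp

end

theorem mainTheorem5 (n : ℕ) {X : Type*} [TopologicalSpace X] [T2Space X] [CompactSpace X]
    [ChartedSpace (EuclideanHalfSpace (n + 1)) X] [IsManifold (𝓡∂ (n + 1)) ∞ X]
    [MeasurableSpace X] [BorelSpace X]
    (h : AsympHyp.Metric n X) (ρ : X → ℝ) (hρ : AsympHyp.IsBoundaryDefining n ρ)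
    (hah : ∀ p ∈ (𝓡∂ (n + 1)).boundary X, AsympHyp.covectorNorm h ρ p = 1)
    (ζ : ℂ) (hζ : (n : ℝ) / 2 ≤ ζ.re) (hζn : ζ ≠ (n : ℂ) / 2)
    (hspec : ζ * ((n : ℂ) - ζ) ∉ AsympHyp.pointSpectrum h ρ)
    (u : X → ℂ) (hu : AsympHyp.IsEigensolution h ρ (ζ * ((n : ℂ) - ζ)) u)
    (f : (𝓡∂ (n + 1)).boundary X → ℂ) (ε : ℝ) (hε : 0 < ε)
    (hexp : AsympHyp.HasBoundaryExpansion ρ u ζ ε f) :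
    ∀ p ∈ (𝓡∂ (n + 1)).interior X, u p = 0 := by
  intro p hp
  by_contra hne
  -- A nonzero value makes $u$ itself an $L^2$ eigenfunction, against the assumption on the point
  -- spectrum.
  exact hspec ⟨u, hu, hu.memLp_two hρ hζ hζn hε hexp, p, hp, hne⟩
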